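/- **Theorem 1.3.** Let $\mathbb T=\mathbb R/2\pi\mathbb Z$, and let $e>0$ and $m_->0$ be constants. For a function $f$ on $\mathbb T\times\mathbb R$ write $f_a(y)=\frac1{2\pi}\int_{\mathbb T}f(x,y)\,dx$ and $$\widehat f(k,\xi)=\frac1{2\pi}\iint_{\mathbb T\times\mathbb R}e^{-i(kx+\xi y)}f(x,y)\,dx\,dy\qquad(k\in\mathbb Z,\ \xi\in\mathbb R)$$ (in the $L^2$ sense in $y$), and set $\langle a\rangle=(1+a^2)^{1/2}$, $\langle a,b\rangle=(1+a^2+b^2)^{1/2}$, $$\|f\|_{H^r_xH^s_y}^2=\sum_{k}\int\langle k\rangle^{2r}\langle\xi\rangle^{2s}|\widehat f(k,\xi)|^2d\xi,\qquad \|f\|_{H^s}^2=\sum_{k}\int\langle k,\xi\rangle^{2s}|\widehat f(k,\xi)|^2d\xi .$$ Consider the electron Euler–Poisson system linearized at the Couette flow on $\mathbb T\times\mathbb R$, $$\partial_t\eta+y\partial_x\eta+\nabla\cdot u=0,\qquad \partial_tu+y\partial_xu+\begin{pmatrix}u^y\\0\end{pmatrix}+\frac1{m_-}\nabla\eta=\frac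 e{m_-}\nabla\phi,\qquad \Delta\phi=4\pi e\,\eta .$$ Put $\psi=\nabla\cdot u$ and $\omega=\nabla^\perp\cdot u$ with $\nabla^\perp=(-\partial_y,\partial_x)^\top$, and let $$\mathbb Q[u]=\nabla\Delta^{-1}\psi,\qquad \mathbb P[u]=\nabla^\perp\Delta^{-1}\omega$$ be the Helmholtz projections ($\Delta^{-1}$ being the Fourier multiplier $-1/(k^2+\xi^2)$), with $\mathbb P[u]=(\mathbb P[u]^x,\mathbb P[u]^y)^\top$. There is a constant $C$, depending only on $e$ and $m_-$, with the following property. Let $(\eta,u,\phi)$ be a real-valued solution of the system that is smooth on $[0,\infty)\times\mathbb T\times\mathbb R$ and whose components $\eta,u^x,u^y,\phi$ have $L^2(\mathbb T\times\mathbb R)$ norms that are bounded on bounded time intervals. Let $\eta^{in},\psi^{in},\omega^{in}$ be the values of $\eta,\psi,\omega$ at $t=0$, and suppose that $\eta^{in},\omega^{in}\in H^1_xH^2_y$, that $\psi^{in}\in H^{-1/2}_xL^2_y$, and that $\eta^{in}_a=\psi^{in}_a=\omega^{in}_a=0$. Then for all $t\ge0$ $$\begin{aligned}\|\mathbb P[u]^x(t)\|_{L^2}+\|\phi(t)\|_{L^2}\le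 C\Big[&\frac{\sqrt{m_-}}{\langle t\rangle^{1/2}}\Big(\big\|m_-^{-1/2}\eta^{in}\big\|_{H^{-1/2}_xL^2_y}+\|\eta^{in}+\omega^{in}\|_{H^{-1/2}_xH^{1/2}_y}\Big)\\&+\frac1{\langle t\rangle}\|\eta^{in}+\omega^{in}\|_{H^{-1}_xH^1_y}+\frac{\sqrt{m_-}}{\langle t\rangle^{1/2}}\|\psi^{in}\|_{H^{-1/2}_xH^{-1}_y}\Big],\end{aligned}$$ $$\begin{aligned}\|\mathbb P[u]^y(t)\|_{L^2}\le C\Big[&\frac{\sqrt{m_-}}{\langle t\rangle^{3/2}}\Big(\big\|m_-^{-1/2}\eta^{in}\big\|_{H^{-1/2}_xH^1_y}+\|\eta^{in}+\omega^{in}\|_{H^{-1/2}_xH^{3/2}_y}\Big)\\&+\frac1{\langle t\rangle^2}\|\eta^{in}+\omega^{in}\|_{H^{-1}_xH^2_y}+\frac{\sqrt{m_-}}{\langle t\rangle^{3/2}}\|\psi^{in}\|_{H^{-1/2}_xL^2_y}\Big],\end{aligned}$$ $$\|\mathbb Q[u](t)\|_{L^2}+m_-^{-1/2}\|\eta(t)\|_{L^2}\le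 C\,\langle t\rangle^{1/2}\Big(\big\|m_-^{-1/2}\eta^{in}\big\|_{L^2}+\|\psi^{in}\|_{H^{-1}}+\|\eta^{in}+\omega^{in}\|_{H^1}\Big).$$ -/

import Mathlib

open scoped ENNReal NNReal FourierTransform
open MeasureTheory

noncomputable section

namespace ElectronEP

/-! Functions on the cylinder `𝕋 × ℝ`, where `𝕋 = ℝ / 2πℤ`, are functions `f x y` on `ℝ × ℝ` that
are `2π`-periodic in `x`; integrals over the cylinder are integrals over `(0, 2π] × ℝ`. -/

/-- Lebesgue measure on the period cell `(0, 2π] × ℝ`. -/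
def cylMeasure : Measure (ℝ × ℝ) :=
  (volume.restrict (Set.Ioc (0 : ℝ) (2 * Real.pi))).prod volume

/-- Partial derivative in `x`. -/
def dx (f : ℝ → ℝ → ℝ) (x y : ℝ) : ℝ := deriv (fun s => f s y) x

/-- Partial derivative in `y`. -/
def dy (f : ℝ → ℝ → ℝ) (x y : ℝ) : ℝ := deriv (fun s => f x s) y

/-- The divergence `∂ₓ u^x + ∂_y u^y`. -/
def divergence (ux uy : ℝ → ℝ → ℝ) (x y : ℝ) : ℝ := dx ux x y + dy uy x y

/-- The scalar curl `∇^⊥ · u = -∂_y u^x + ∂ₓ u^y`. -/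
def curl (ux uy : ℝ → ℝ → ℝ) (x y : ℝ) : ℝ := -dy ux x y + dx uy x y

/-- The Laplacian. -/
def laplacian (f : ℝ → ℝ → ℝ) (x y : ℝ) : ℝ := dx (dx f) x y + dy (dy f) x y

/-- The `x`-average `f_a(y) = (1/2π) ∫_𝕋 f(x,y) dx`. -/
def xAverage (f : ℝ → ℝ → ℝ) (y : ℝ) : ℝ :=
  (2 * Real.pi)⁻¹ * ∫ x in (0 : ℝ)..(2 * Real.pi), f x y

/-- The `L²(𝕋 × ℝ)` norm of a function. -/
def l2Norm (f : ℝ → ℝ → ℝ) : ℝ≥0∞ := eLpNorm (fun p : ℝ × ℝ => f p.1 p.2) 2 cylMeasure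

/-! ### Fourier transform and Sobolev norms -/

/-- The `k`-th mode in `x`: `y ↦ ∫_𝕋 e^{-ikx} f(x,y) dx`. -/
def xMode (f : ℝ → ℝ → ℝ) (k : ℤ) (y : ℝ) : ℂ :=
  ∫ x in (0 : ℝ)..(2 * Real.pi), Complex.exp (-(Complex.I * k * x)) * (f x y : ℂ)

/-- The modes of `f` in `x` belong to `L²(ℝ)`, so that the Fourier transform of `f` can be taken in
the `L²` sense, mode by mode. Every `f` in `L²(𝕋 × ℝ)` has this property, and so has every function
whose Fourier transform `f̂(k,·)` belongs to `L²(ℝ)` for every `k`. -/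
def HasL2Modes (f : ℝ → ℝ → ℝ) : Prop := ∀ k : ℤ, MemLp (xMode f k) 2 volume

open Classical in
/-- The Fourier transform `f̂(k,ξ) = (1/2π) ∬ e^{-i(kx+ξy)} f(x,y) dx dy`, in the `L²` sense.
Mathlib's transform `𝓕` has the kernel `e^{-2πi yζ}`, whence `ζ = ξ/2π`. -/
def ft (f : ℝ → ℝ → ℝ) (k : ℤ) (ξ : ℝ) : ℂ :=
  (2 * Real.pi : ℂ)⁻¹ *
    (if h : MemLp (xMode f k) 2 (volume : Measure ℝ) then
      (𝓕 (h.toLp (xMode f k)) : Lp ℂ 2 (volume : Measure ℝ)) (ξ / (2 * Real.pi))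
    else 0)

/-- `⟨a⟩ = (1 + a²)^{1/2}`. -/
def jap (a : ℝ) : ℝ := Real.sqrt (1 + a ^ 2)

/-- `⟨a,b⟩ = (1 + a² + b²)^{1/2}`. -/
def jap₂ (a b : ℝ) : ℝ := Real.sqrt (1 + a ^ 2 + b ^ 2)

/-- The norm of `H^r_x H^s_y`:
`‖f‖² = ∑ₖ ∫ ⟨k⟩^{2r} ⟨ξ⟩^{2s} |f̂(k,ξ)|² dξ`, for `f` with modes in `L²(ℝ)`. -/
def anisoNorm (r s : ℝ) (f : ℝ → ℝ → ℝ) : ℝ≥0∞ :=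
  (∑' k : ℤ, ∫⁻ ξ : ℝ,
    ENNReal.ofReal (jap k ^ (2 * r) * jap ξ ^ (2 * s)) * ‖ft f k ξ‖ₑ ^ (2 : ℕ)) ^ (1 / 2 : ℝ)

/-- The norm of `H^s`: `‖f‖² = ∑ₖ ∫ ⟨k,ξ⟩^{2s} |f̂(k,ξ)|² dξ`, for `f` with modes in `L²(ℝ)`. -/
def sobNorm (s : ℝ) (f : ℝ → ℝ → ℝ) : ℝ≥0∞ :=
  (∑' k : ℤ, ∫⁻ ξ : ℝ,
    ENNReal.ofReal (jap₂ k ξ ^ (2 * s)) * ‖ft f k ξ‖ₑ ^ (2 : ℕ)) ^ (1 / 2 : ℝ)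

/-- Membership in `H^r_x H^s_y`, for `s ≥ 0` (which puts every mode into `L²(ℝ)`). -/
def MemAniso (r s : ℝ) (f : ℝ → ℝ → ℝ) : Prop := HasL2Modes f ∧ anisoNorm r s f < ⊤

/-! ### Inverse Fourier transform and Helmholtz projections -/

theorem memLp_planeMode (k : ℤ) (g : Lp ℂ 2 (volume : Measure ℝ)) :
    MemLp (fun p : ℝ × ℝ => Complex.exp (Complex.I * k * p.1) * g p.2) 2 cylMeasure := by
  have h : MemLp (fun p : ℝ × ℝ => g p.2) 2 cylMeasure := (Lp.memLp g).comp_snd _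
  refine h.of_le ?_ (Filter.Eventually.of_forall fun p => ?_)
  · refine AEStronglyMeasurable.mul ?_ h.1
    exact Continuous.aestronglyMeasurable (by fun_prop)
  · have : Complex.I * k * p.1 = ((k * p.1 : ℝ) : ℂ) * Complex.I := by push_cast; ring
    rw [norm_mul, this, Complex.norm_exp_ofReal_mul_I, one_mul]

/-- `(x,y) ↦ e^{ikx} g(y)` as an element of `L²(𝕋 × ℝ)`. -/
def planeMode (k : ℤ) (g : Lp ℂ 2 (volume : Measure ℝ)) : Lp ℂ 2 cylMeasure :=
  (memLp_planeMode k g).toLp _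

open Classical in
/-- The inverse Fourier transform `(1/2π) ∑ₖ ∫ e^{i(kx+ξy)} g(k,ξ) dξ`, as an element of
`L²(𝕋 × ℝ)`; after `ξ = 2πζ` the inner integral is `2π` times Mathlib's `𝓕⁻` of
`ζ ↦ g(k, 2πζ)`. The series converges in `L²` when `∑ₖ ∫ |g(k,ξ)|² dξ < ∞`. -/
def invFT (g : ℤ → ℝ → ℂ) : Lp ℂ 2 cylMeasure :=
  ∑' k : ℤ, planeMode k
    (if h : MemLp (fun ζ : ℝ => g k (2 * Real.pi * ζ)) 2 (volume : Measure ℝ) then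
      𝓕⁻ (h.toLp (fun ζ : ℝ => g k (2 * Real.pi * ζ)))
    else 0)

/-- The symbol of `∂ₓ` applied to a Fourier transform. -/
def dxHat (g : ℤ → ℝ → ℂ) (k : ℤ) (ξ : ℝ) : ℂ := Complex.I * k * g k ξ

/-- The symbol of `∂_y` applied to a Fourier transform. -/
def dyHat (g : ℤ → ℝ → ℂ) (k : ℤ) (ξ : ℝ) : ℂ := Complex.I * ξ * g k ξ

/-- The symbol `-1/(k² + ξ²)` of `Δ⁻¹` applied to a Fourier transform. -/
def invLapHat (g : ℤ → ℝ → ℂ) (k : ℤ) (ξ : ℝ) : ℂ := -((k : ℂ) ^ 2 + (ξ : ℂ) ^ 2)⁻¹ * g k ξ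

/-- The Fourier transform of `∇ · u`. -/
def divHat (ux uy : ℝ → ℝ → ℝ) (k : ℤ) (ξ : ℝ) : ℂ := dxHat (ft ux) k ξ + dyHat (ft uy) k ξ

/-- The Fourier transform of `∇^⊥ · u`. -/
def curlHat (ux uy : ℝ → ℝ → ℝ) (k : ℤ) (ξ : ℝ) : ℂ := -dyHat (ft ux) k ξ + dxHat (ft uy) k ξ

/-- First component of `ℚ[u] = ∇Δ⁻¹(∇ · u)`. -/
def projQx (ux uy : ℝ → ℝ → ℝ) : Lp ℂ 2 cylMeasure := invFT (dxHat (invLapHat (divHat ux uy)))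

/-- Second component of `ℚ[u] = ∇Δ⁻¹(∇ · u)`. -/
def projQy (ux uy : ℝ → ℝ → ℝ) : Lp ℂ 2 cylMeasure := invFT (dyHat (invLapHat (divHat ux uy)))

/-- First component of `ℙ[u] = ∇^⊥Δ⁻¹(∇^⊥ · u)`, where `∇^⊥ = (-∂_y, ∂ₓ)`. -/
def projPx (ux uy : ℝ → ℝ → ℝ) : Lp ℂ 2 cylMeasure :=
  invFT (fun k ξ => -dyHat (invLapHat (curlHat ux uy)) k ξ)

/-- Second component of `ℙ[u] = ∇^⊥Δ⁻¹(∇^⊥ · u)`. -/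
def projPy (ux uy : ℝ → ℝ → ℝ) : Lp ℂ 2 cylMeasure := invFT (dxHat (invLapHat (curlHat ux uy)))

/-- The `L²` norm of the vector field `ℚ[u]`. -/
def normQ (ux uy : ℝ → ℝ → ℝ) : ℝ≥0∞ :=
  (‖projQx ux uy‖ₑ ^ (2 : ℕ) + ‖projQy ux uy‖ₑ ^ (2 : ℕ)) ^ (1 / 2 : ℝ)

/-! ### Smooth solutions of the linearized system -/

/-- A function of `(t,x,y)` that is smooth on `[0,∞) × 𝕋 × ℝ` and whose `L²(𝕋 × ℝ)` norm is bounded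
on bounded time intervals. -/
structure IsSmoothField (f : ℝ → ℝ → ℝ → ℝ) : Prop where
  smooth : ContDiffOn ℝ ((⊤ : ℕ∞) : WithTop ℕ∞) (fun p : ℝ × ℝ × ℝ => f p.1 p.2.1 p.2.2) (Set.Ici 0 ×ˢ Set.univ)
  periodic : ∀ t : ℝ, 0 ≤ t → ∀ x y : ℝ, f t (x + 2 * Real.pi) y = f t x y
  bounded : ∀ T : ℝ, ∃ M : ℝ≥0, ∀ t ∈ Set.Icc 0 T, l2Norm (f t) ≤ M

/-- `(η, u, φ)` is a smooth solution on `[0,∞) × 𝕋 × ℝ` of the electron Euler-Poisson system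
linearized at the Couette flow, with electron charge `e` and mass `m`. The evolution equations are
imposed for `t > 0`; by smoothness they persist at `t = 0` with one-sided time derivatives. -/
structure IsSmoothSolution (e m : ℝ) (η ux uy φ : ℝ → ℝ → ℝ → ℝ) : Prop where
  density : IsSmoothField η
  velocity_x : IsSmoothField ux
  velocity_y : IsSmoothField uy
  potential : IsSmoothField φ
  continuity_eq : ∀ t : ℝ, 0 < t → ∀ x y : ℝ,
    deriv (fun s => η s x y) t + y * dx (η t) x y + divergence (ux t) (uy t) x y = 0
  momentum_x : ∀ t : ℝ, 0 < t → ∀ x y : ℝ,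
    deriv (fun s => ux s x y) t + y * dx (ux t) x y + uy t x y + 1 / m * dx (η t) x y
      = e / m * dx (φ t) x y
  momentum_y : ∀ t : ℝ, 0 < t → ∀ x y : ℝ,
    deriv (fun s => uy s x y) t + y * dx (uy t) x y + 1 / m * dy (η t) x y
      = e / m * dy (φ t) x y
  poisson : ∀ t : ℝ, 0 ≤ t → ∀ x y : ℝ,
    laplacian (φ t) x y = 4 * Real.pi * e * η t x y

end ElectronEP

end

/-! Take the Fourier transform and follow each frequency along the characteristics of the Couette
transport, that is, look at `(k, ξ - kt)` at time `t`. There the system is an ODE for `N = η̂`, `V =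
-ψ̂` and `Γ = η̂ + ω̂`. The stretching by the shear gives `ω` the source `ψ` and the continuity
equation gives `η` the source `-ψ`, so `Γ` is conserved. With `τ = t - ξ/k` and `β = 4πe²` the rest
reads `N' = V`, `V' = 2τ/(1+τ²) V - (k²(1+τ²)+β)/m N + 2/(1+τ²) (Γ - N)`.

This is an oscillator whose frequency grows like `|kτ|`, with the term `2τ/(1+τ²) V` in place of
friction; WKB predicts that `N` grows like `(1+τ²)^{1/4}`. In the energy `V²/(1+τ²) + (k²/m + ...)
N²` the kinetic part grows at the rate `2τ/(1+τ²)` and the main potential part not at all. The cross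
term `-τ/(1+τ²)² NV` of `modeForm` equidistributes the two rates, so that the derivative is
`τ/(1+τ²)` times the form plus a remainder of relative size `1/(1+τ²)`. Dividing by `√(1+τ²)`,
adding `Γ²` and multiplying by `exp(-c arctan τ)` gives a nonincreasing quantity. As `arctan` is
bounded, the resulting estimate `exists_mode_bound` is uniform in `k`, `ξ` and `t`.

Write `r = ⟨t - ξ/k⟩` and `s = ⟨ξ/k⟩`. The estimate bounds `|N|²` by `r/s` times the data, and `ω̂ =
Γ - N`. Since `k² + (ξ-kt)² = k²r²`, inverting the Laplacian gains powers of `r`, and `⟨t⟩ ≤ 2rs`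
turns them into decay in time, at the cost of powers of `s ≤ ⟨ξ⟩`, which are `y`-derivatives of the
data. The growth estimate uses `r ≤ 2⟨t⟩s` instead. These computations are the lemmas on
`IsFrequencyData`; `le_sum_weightedNorm` integrates them. The mode `k = 0` starts at zero and stays
there.

The solution is only smooth with `L²` bounds on the fields, and its derivatives need not be square
integrable, so the ODE cannot be written for `ft` directly. It is derived for the transforms of
`χ(y) f(x,y)`, where `χ` is a cutoff: a function of `y` commutes with `y∂ₓ`, so the only errors
contain `χ'` and `χ''`. They are `O(1/n)` at scale `n`, and the energy inequalities pass to the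
limit for almost every `ξ` (`isModeSolution_truncFT`, `isL1Null_cutoffError`,
`ae_exists_isModeLimit`). -/

namespace ElectronEP

/-! ### The `L²` Fourier transform on the line -/

/-- On `L¹ ∩ L²` the `L²` Fourier transform is given by the Fourier integral. -/
theorem fourier_toLp_ae_eq {h : ℝ → ℂ} (h1 : Integrable h) (h2 : MemLp h 2) :
    (𝓕 (h2.toLp h) : Lp ℂ 2 (volume : Measure ℝ)) =ᵐ[volume] 𝓕 h := by
  -- Test functions are Schwartz functions. The transform is moved onto them, on the left as a
  -- tempered distribution and on the right by Fubini.
  refine ae_eq_of_integral_contDiff_smul_eq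
    ((Lp.memLp _).locallyIntegrable (by norm_num)) ?_ ?_
  · have hc : Continuous (𝓕 h) :=
      VectorFourier.fourierIntegral_continuous Real.continuous_fourierChar
        (by fun_prop) h1
    exact hc.locallyIntegrable
  · intro g hg hgs
    have hg' : ContDiff ℝ ((⊤ : ℕ∞) : WithTop ℕ∞) (fun x => (g x : ℂ)) :=
      Complex.ofRealCLM.contDiff.comp hg
    have hgs' : HasCompactSupport (fun x => (g x : ℂ)) :=
      hgs.comp_left (g := fun x : ℝ => (x : ℂ)) (by simp)
    set G := hgs'.toSchwartzMap hg' with hG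
    have hGx : ∀ x, G x = (g x : ℂ) := fun x => rfl
    have e1 := congrArg (fun T => T G)
      (Lp.fourier_toTemperedDistribution_eq (h2.toLp h))
    simp only [TemperedDistribution.fourier_apply, Lp.toTemperedDistribution_apply] at e1
    have e2 : ∫ x, (𝓕 (G : ℝ → ℂ)) x • h x = ∫ x, G x • (𝓕 h) x := by
      simpa using! (VectorFourier.integral_fourierIntegral_smul_eq_flip (L := innerₗ ℝ)
        Real.continuous_fourierChar continuous_inner G.integrable h1)
    have e3 : ∫ x, (𝓕 G) x • (h2.toLp h) x = ∫ x, (𝓕 (G : ℝ → ℂ)) x • h x := by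
      refine integral_congr_ae ?_
      filter_upwards [h2.coeFn_toLp] with x hx
      rw [hx, SchwartzMap.fourier_coe]
    have : ∀ u : ℝ → ℂ, ∫ x, g x • u x = ∫ x, G x • u x := fun u => by
      refine integral_congr_ae (.of_forall fun x => ?_)
      simp [hGx]
    rw [this, this, ← e2, ← e3, e1]

theorem lintegral_comp_div_two_pi (F : ℝ → ℝ≥0∞) :
    ∫⁻ ξ : ℝ, F (ξ / (2 * Real.pi)) = ENNReal.ofReal (2 * Real.pi) * ∫⁻ ζ : ℝ, F ζ := by
  have hpi : (0 : ℝ) < 2 * Real.pi := Real.two_pi_pos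
  have hm := Real.map_volume_mul_left (inv_ne_zero hpi.ne')
  have he : MeasurableEmbedding (fun x : ℝ => (2 * Real.pi)⁻¹ * x) :=
    (Homeomorph.mulLeft₀ _ (inv_ne_zero hpi.ne')).measurableEmbedding
  have : ∫⁻ ξ : ℝ, F (ξ / (2 * Real.pi)) =
      ∫⁻ y, F y ∂(Measure.map ((2 * Real.pi)⁻¹ * ·) volume) := by
    rw [he.lintegral_map]
    simp only [div_eq_inv_mul]
  rw [this, hm, lintegral_smul_measure, inv_inv, abs_of_pos hpi, smul_eq_mul]

theorem lintegral_comp_two_pi_mul (F : ℝ → ℝ≥0∞) :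
    ENNReal.ofReal (2 * Real.pi) * ∫⁻ ζ : ℝ, F (2 * Real.pi * ζ) = ∫⁻ ξ : ℝ, F ξ := by
  rw [← lintegral_comp_div_two_pi]
  refine lintegral_congr fun ξ => ?_
  congr 1
  field_simp

theorem enorm_sq_eq_lintegral {α : Type*} [MeasurableSpace α] {μ : Measure α} (g : Lp ℂ 2 μ) :
    ‖g‖ₑ ^ (2 : ℕ) = ∫⁻ x, ‖g x‖ₑ ^ (2 : ℕ) ∂μ := by
  rw [Lp.enorm_def, eLpNorm_eq_lintegral_rpow_enorm_toReal (by norm_num) (by norm_num)]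
  simp only [ENNReal.toReal_ofNat, ENNReal.rpow_ofNat]
  rw [← ENNReal.rpow_natCast, ← ENNReal.rpow_mul]
  norm_num

theorem eLpNorm_two_sq {α E : Type*} [MeasurableSpace α] [NormedAddCommGroup E] {μ : Measure α}
    (g : α → E) : eLpNorm g 2 μ ^ (2 : ℕ) = ∫⁻ x, ‖g x‖ₑ ^ (2 : ℕ) ∂μ := by
  rw [eLpNorm_eq_lintegral_rpow_enorm_toReal (by norm_num) (by norm_num)]
  simp only [ENNReal.toReal_ofNat, ENNReal.rpow_ofNat]
  rw [← ENNReal.rpow_natCast, ← ENNReal.rpow_mul]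
  norm_num

theorem enorm_fourier_eq (g : Lp ℂ 2 (volume : Measure ℝ)) : ‖𝓕 g‖ₑ = ‖g‖ₑ := by
  rw [← ofReal_norm, ← ofReal_norm, Lp.norm_fourier_eq]

theorem enorm_fourierInv_eq (g : Lp ℂ 2 (volume : Measure ℝ)) : ‖𝓕⁻ g‖ₑ = ‖g‖ₑ := by
  rw [← enorm_fourier_eq, FourierTransform.fourier_fourierInv_eq]

/-- The normalised `L²` Fourier transform `(2π)⁻¹ ∫ e^{-iξy} a(y) dy`. -/
noncomputable def lpFT (g : Lp ℂ 2 (volume : Measure ℝ)) (ξ : ℝ) : ℂ :=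
  (2 * Real.pi : ℂ)⁻¹ * (𝓕 g : Lp ℂ 2 (volume : Measure ℝ)) (ξ / (2 * Real.pi))

theorem enorm_two_pi_inv : ‖(2 * Real.pi : ℂ)⁻¹‖ₑ = (ENNReal.ofReal (2 * Real.pi))⁻¹ := by
  rw [enorm_inv (by simp)]
  congr 1
  rw [show (2 * Real.pi : ℂ) = ((2 * Real.pi : ℝ) : ℂ) by push_cast; rfl, ← ofReal_norm,
    Complex.norm_real, Real.norm_of_nonneg Real.two_pi_pos.le]

theorem lintegral_lpFT (g : Lp ℂ 2 (volume : Measure ℝ)) :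
    ∫⁻ ξ, ‖lpFT g ξ‖ₑ ^ (2 : ℕ) = (ENNReal.ofReal (2 * Real.pi))⁻¹ * ‖g‖ₑ ^ (2 : ℕ) := by
  have h0 : ENNReal.ofReal (2 * Real.pi) ≠ 0 := by
    simp [Real.pi_pos]
  simp only [lpFT, enorm_mul, mul_pow, enorm_two_pi_inv]
  rw [lintegral_const_mul' _ _ (by simp [Real.pi_pos]), lintegral_comp_div_two_pi
    (fun ζ => ‖(𝓕 g : Lp ℂ 2 (volume : Measure ℝ)) ζ‖ₑ ^ (2 : ℕ)), ← enorm_sq_eq_lintegral,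
    enorm_fourier_eq, ← mul_assoc, sq, mul_assoc _ _ (ENNReal.ofReal _),
    ENNReal.inv_mul_cancel h0 ENNReal.ofReal_ne_top, mul_one]

theorem ae_comp_div_two_pi {P : ℝ → Prop} (h : ∀ᵐ x : ℝ, P x) :
    ∀ᵐ ξ : ℝ, P (ξ / (2 * Real.pi)) := by
  have hq : Measure.QuasiMeasurePreserving (fun ξ : ℝ => ξ / (2 * Real.pi)) volume volume := by
    refine ⟨by fun_prop, ?_⟩
    have : (fun ξ : ℝ => ξ / (2 * Real.pi)) = fun x => (2 * Real.pi)⁻¹ * x := by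
      ext; ring
    rw [this]
    rw [Real.map_volume_mul_left (inv_ne_zero Real.two_pi_pos.ne')]
    exact Measure.smul_absolutelyContinuous
  exact hq.ae h

theorem lpFT_add (g h : Lp ℂ 2 (volume : Measure ℝ)) :
    ∀ᵐ ξ, lpFT (g + h) ξ = lpFT g ξ + lpFT h ξ := by
  have : 𝓕 (g + h) = 𝓕 g + 𝓕 h := FourierTransform.fourier_add g h
  filter_upwards [ae_comp_div_two_pi (Lp.coeFn_add (𝓕 g) (𝓕 h))] with ξ hξ
  rw [lpFT, this, hξ, Pi.add_apply, mul_add]; rfl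

theorem lpFT_sub (g h : Lp ℂ 2 (volume : Measure ℝ)) :
    ∀ᵐ ξ, lpFT (g - h) ξ = lpFT g ξ - lpFT h ξ := by
  filter_upwards [lpFT_add (g - h) h] with ξ hξ
  rw [sub_add_cancel] at hξ
  rw [hξ]; ring

theorem lpFT_smul (c : ℂ) (g : Lp ℂ 2 (volume : Measure ℝ)) :
    ∀ᵐ ξ, lpFT (c • g) ξ = c * lpFT g ξ := by
  have : 𝓕 (c • g) = c • 𝓕 g := FourierTransform.fourier_smul c g
  filter_upwards [ae_comp_div_two_pi (Lp.coeFn_smul c (𝓕 g))] with ξ hξ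
  rw [lpFT, this, hξ, Pi.smul_apply, smul_eq_mul, lpFT]; ring

theorem ft_eq_lpFT {f : ℝ → ℝ → ℝ} {k : ℤ} (h : MemLp (xMode f k) 2 volume) (ξ : ℝ) :
    ft f k ξ = lpFT (h.toLp _) ξ := by
  simp [ft, lpFT, h]

theorem aestronglyMeasurable_lpFT (g : Lp ℂ 2 (volume : Measure ℝ)) :
    AEStronglyMeasurable (lpFT g) volume := by
  have hq : Measure.QuasiMeasurePreserving (fun ξ : ℝ => ξ / (2 * Real.pi)) volume volume :=
    ⟨by fun_prop, Measure.AbsolutelyContinuous.mk fun s hs h0 => by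
      rw [Measure.map_apply (by fun_prop) hs]
      have := ae_comp_div_two_pi (P := fun x => x ∉ s) (by
        rw [ae_iff]; simpa using h0)
      rw [ae_iff] at this
      simpa using! this⟩
  exact ((Lp.aestronglyMeasurable _).comp_quasiMeasurePreserving hq).const_mul _

theorem aestronglyMeasurable_ft (f : ℝ → ℝ → ℝ) (k : ℤ) :
    AEStronglyMeasurable (ft f k) volume := by
  by_cases h : MemLp (xMode f k) 2 (volume : Measure ℝ)
  · exact (aestronglyMeasurable_lpFT (h.toLp _)).congr (.of_forall fun ξ => (ft_eq_lpFT h ξ).symm)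
  · have : ft f k = fun _ => 0 := by ext ξ; simp [ft, h]
    rw [this]; exact aestronglyMeasurable_const

theorem enorm_toLp_sq {α : Type*} [MeasurableSpace α] {μ : Measure α} {a : α → ℂ}
    (h : MemLp a 2 μ) : ‖h.toLp a‖ₑ ^ (2 : ℕ) = ∫⁻ x, ‖a x‖ₑ ^ (2 : ℕ) ∂μ := by
  rw [Lp.enorm_toLp, eLpNorm_two_sq]

theorem lintegral_ft {f : ℝ → ℝ → ℝ} {k : ℤ} (h : MemLp (xMode f k) 2 volume) :
    ∫⁻ ξ, ‖ft f k ξ‖ₑ ^ (2 : ℕ) =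
      (ENNReal.ofReal (2 * Real.pi))⁻¹ * ∫⁻ y, ‖xMode f k y‖ₑ ^ (2 : ℕ) := by
  simp only [ft_eq_lpFT h]
  rw [lintegral_lpFT, enorm_toLp_sq]

/-- For `a ∈ L¹ ∩ L²` the transform `lpFT` is given by the integral. -/
theorem lpFT_toLp_ae {a : ℝ → ℂ} (h1 : Integrable a) (h2 : MemLp a 2) :
    ∀ᵐ ξ : ℝ, lpFT (h2.toLp a) ξ =
      (2 * Real.pi : ℂ)⁻¹ * ∫ y : ℝ, Complex.exp (-(Complex.I * (ξ * y))) * a y := by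
  filter_upwards [ae_comp_div_two_pi (fourier_toLp_ae_eq h1 h2)] with ξ hξ
  rw [lpFT, hξ, Real.fourier_real_eq_integral_exp_smul]
  congr 1
  refine integral_congr_ae (.of_forall fun y => ?_)
  simp only [smul_eq_mul]
  congr 2
  push_cast
  have : (Real.pi : ℂ) ≠ 0 := by exact_mod_cast Real.pi_ne_zero
  field_simp

end ElectronEP

/-! ### Parseval and Plancherel on the cylinder -/

namespace ElectronEP

theorem continuous_xMode {f : ℝ → ℝ → ℝ} (hf : Continuous (Function.uncurry f)) (k : ℤ) :
    Continuous (xMode f k) := by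
  unfold xMode
  refine intervalIntegral.continuous_parametric_intervalIntegral_of_continuous' ?_ _ _
  have : Continuous fun p : ℝ × ℝ => (f p.2 p.1 : ℂ) :=
    Complex.continuous_ofReal.comp (hf.comp continuous_swap)
  simp only [Function.uncurry_def]
  fun_prop

/-- Parseval on the circle at fixed `y`. The factor `2π` appears because `xMode` is `2π` times the
normalised Fourier coefficient. -/
theorem tsum_enorm_xMode_sq {f : ℝ → ℝ → ℝ} (hf : Continuous (Function.uncurry f)) (y : ℝ) :
    ∑' k : ℤ, ‖xMode f k y‖ₑ ^ (2 : ℕ) =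
      ENNReal.ofReal (2 * Real.pi) *
        ∫⁻ x in Set.Ioc (0 : ℝ) (2 * Real.pi), ‖f x y‖ₑ ^ (2 : ℕ) := by
  have hpi : (0 : ℝ) < 2 * Real.pi := Real.two_pi_pos
  have hfy : Continuous fun x => f x y := by
    have := hf.comp (Continuous.prodMk_left y)
    simpa [Function.comp_def] using this
  have hc : Continuous fun x => (f x y : ℂ) := Complex.continuous_ofReal.comp hfy
  have hL2 : MemLp (fun x => (f x y : ℂ)) 2 (volume.restrict (Set.Ioc 0 (2 * Real.pi))) := by
    exact (memLp_two_iff_integrable_sq_norm hc.aestronglyMeasurable).2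
      (Continuous.integrableOn_Ioc (by fun_prop))
  have h := hasSum_sq_fourierCoeffOn hpi hL2
  have hcoef : ∀ k : ℤ, ‖fourierCoeffOn hpi (fun x => (f x y : ℂ)) k‖ ^ 2 =
      ((2 * Real.pi)⁻¹) ^ 2 * ‖xMode f k y‖ ^ 2 := by
    intro k
    rw [fourierCoeffOn_eq_integral, norm_smul, mul_pow, sub_zero, one_div,
      Real.norm_of_nonneg (by positivity)]
    congr 3
    unfold xMode
    refine intervalIntegral.integral_congr fun x _ => ?_
    simp only [smul_eq_mul]
    congr 1
    rw [fourier_coe_apply]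
    congr 1
    push_cast
    have : (Real.pi : ℂ) ≠ 0 := by exact_mod_cast Real.pi_ne_zero
    field_simp
  simp only [hcoef] at h
  have h2 := h.mul_left ((2 * Real.pi) ^ 2)
  have e1 : ∀ k : ℤ, (2 * Real.pi) ^ 2 * ((2 * Real.pi)⁻¹ ^ 2 * ‖xMode f k y‖ ^ 2) =
      ‖xMode f k y‖ ^ 2 := fun k => by field_simp
  simp only [e1] at h2
  have h3 : ∑' k : ℤ, ‖xMode f k y‖ₑ ^ (2 : ℕ) = ENNReal.ofReal (∑' k : ℤ, ‖xMode f k y‖ ^ 2) := by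
    rw [ENNReal.ofReal_tsum_of_nonneg (fun _ => by positivity) h2.summable]
    refine tsum_congr fun k => ?_
    rw [ENNReal.ofReal_pow (norm_nonneg _), ofReal_norm]
  rw [h3, h2.tsum_eq, intervalIntegral.integral_of_le hpi.le, sub_zero, smul_eq_mul]
  have e2 : (2 * Real.pi) ^ 2 * ((2 * Real.pi)⁻¹ *
      ∫ x in Set.Ioc 0 (2 * Real.pi), ‖(f x y : ℂ)‖ ^ 2) =
      (2 * Real.pi) * ∫ x in Set.Ioc 0 (2 * Real.pi), ‖(f x y : ℂ)‖ ^ 2 := by field_simp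
  rw [e2, ENNReal.ofReal_mul hpi.le, ofReal_integral_eq_lintegral_ofReal]
  · congr 1
    refine lintegral_congr fun x => ?_
    rw [ENNReal.ofReal_pow (norm_nonneg _), ofReal_norm, ← ofReal_norm, ← ofReal_norm,
      Complex.norm_real]
  · exact hL2.integrable_norm_pow (by norm_num)
  · exact .of_forall fun x => by positivity

/-- **Parseval**: the `L²` norm on the cylinder in terms of the modes. -/
theorem l2Norm_sq_eq_tsum_xMode {f : ℝ → ℝ → ℝ} (hf : Continuous (Function.uncurry f)) :
    l2Norm f ^ (2 : ℕ) = ∑' k : ℤ,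
      (ENNReal.ofReal (2 * Real.pi))⁻¹ * ∫⁻ y, ‖xMode f k y‖ₑ ^ (2 : ℕ) := by
  have h0 : ENNReal.ofReal (2 * Real.pi) ≠ 0 := by simp [Real.pi_pos]
  have hfm : Continuous fun p : ℝ × ℝ => f p.1 p.2 := hf
  have hm : ∀ k : ℤ, AEMeasurable (fun y => ‖xMode f k y‖ₑ ^ (2 : ℕ)) volume := fun k =>
    ((ENNReal.continuous_pow 2).comp (continuous_xMode hf k).enorm).measurable.aemeasurable
  rw [l2Norm, eLpNorm_two_sq, cylMeasure, lintegral_prod_symm _ (by fun_prop),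
    ENNReal.tsum_mul_left, ← lintegral_tsum hm]
  simp only [tsum_enorm_xMode_sq hf]
  rw [lintegral_const_mul' _ _ ENNReal.ofReal_ne_top, ← mul_assoc,
    ENNReal.inv_mul_cancel h0 ENNReal.ofReal_ne_top, one_mul]

theorem hasL2Modes_of_l2Norm_lt_top {f : ℝ → ℝ → ℝ} (hf : Continuous (Function.uncurry f))
    (h : l2Norm f < ⊤) : HasL2Modes f := by
  intro k
  refine ⟨(continuous_xMode hf k).aestronglyMeasurable, ?_⟩
  have h1 : (ENNReal.ofReal (2 * Real.pi))⁻¹ * ∫⁻ y, ‖xMode f k y‖ₑ ^ (2 : ℕ) ≤ l2Norm f ^ 2 := by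
    rw [l2Norm_sq_eq_tsum_xMode hf]
    exact ENNReal.le_tsum k
  have h2 : eLpNorm (xMode f k) 2 volume ^ 2 ≠ ⊤ := by
    rw [eLpNorm_two_sq]
    intro htop
    rw [htop, ENNReal.mul_top (ENNReal.inv_ne_zero.2 ENNReal.ofReal_ne_top)] at h1
    exact (ENNReal.pow_lt_top h).ne (top_le_iff.1 h1)
  rw [lt_top_iff_ne_top]
  rintro h3
  simp [h3] at h2

/-- **Plancherel** on the cylinder. -/
theorem l2Norm_sq_eq_tsum_ft {f : ℝ → ℝ → ℝ} (hf : Continuous (Function.uncurry f))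
    (h : HasL2Modes f) :
    l2Norm f ^ (2 : ℕ) = ∑' k : ℤ, ∫⁻ ξ, ‖ft f k ξ‖ₑ ^ (2 : ℕ) := by
  rw [l2Norm_sq_eq_tsum_xMode hf]
  exact tsum_congr fun k => (lintegral_ft (h k)).symm

theorem enorm_planeMode_sq (k : ℤ) (g : Lp ℂ 2 (volume : Measure ℝ)) :
    ‖planeMode k g‖ₑ ^ (2 : ℕ) = ENNReal.ofReal (2 * Real.pi) * ‖g‖ₑ ^ (2 : ℕ) := by
  rw [planeMode, enorm_toLp_sq, enorm_sq_eq_lintegral]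
  have : ∀ p : ℝ × ℝ, ‖Complex.exp (Complex.I * k * p.1) * g p.2‖ₑ ^ (2 : ℕ) =
      ‖g p.2‖ₑ ^ (2 : ℕ) := by
    intro p
    have h : Complex.I * k * p.1 = ((k * p.1 : ℝ) : ℂ) * Complex.I := by push_cast; ring
    rw [enorm_mul, ← ofReal_norm, h, Complex.norm_exp_ofReal_mul_I, ENNReal.ofReal_one, one_mul]
  simp only [this]
  rw [cylMeasure, lintegral_prod]
  · simp [mul_comm]
  · exact ((Lp.aestronglyMeasurable g).comp_snd.enorm.pow_const 2)

theorem integral_exp_int_mul {k : ℤ} (hk : k ≠ 0) :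
    ∫ x in Set.Ioc (0 : ℝ) (2 * Real.pi), Complex.exp (Complex.I * k * x) = 0 := by
  have hc : Complex.I * k ≠ 0 := by simp [hk]
  rw [← intervalIntegral.integral_of_le Real.two_pi_pos.le, integral_exp_mul_complex hc]
  have : Complex.I * k * ((2 * Real.pi : ℝ) : ℂ) = k * (2 * Real.pi * Complex.I) := by
    push_cast; ring
  rw [this, Complex.exp_int_mul_two_pi_mul_I]
  simp

theorem inner_planeMode {k l : ℤ} (hkl : k ≠ l) (g h : Lp ℂ 2 (volume : Measure ℝ)) :
    inner ℂ (planeMode k g) (planeMode l h) = 0 := by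
  rw [L2.inner_def]
  have : ∫ p, inner ℂ (planeMode k g p) (planeMode l h p) ∂cylMeasure =
      ∫ p : ℝ × ℝ, Complex.exp (Complex.I * (l - k : ℤ) * p.1) *
        (starRingEnd ℂ (g p.2) * h p.2) ∂cylMeasure := by
    refine integral_congr_ae ?_
    filter_upwards [(memLp_planeMode k g).coeFn_toLp, (memLp_planeMode l h).coeFn_toLp]
      with p h1 h2
    rw [planeMode, planeMode, h1, h2, RCLike.inner_apply, map_mul, ← Complex.exp_conj]
    have : Complex.exp (Complex.I * (l - k : ℤ) * p.1) = Complex.exp (Complex.I * l * p.1) *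
        Complex.exp ((starRingEnd ℂ) (Complex.I * k * p.1)) := by
      rw [← Complex.exp_add]
      congr 1
      simp only [map_mul, Complex.conj_I, Complex.conj_ofReal, map_intCast]
      push_cast; ring
    rw [this]; ring
  rw [this, cylMeasure, integral_prod_mul (fun x : ℝ => Complex.exp (Complex.I * (l - k : ℤ) * x))
    (fun y : ℝ => starRingEnd ℂ (g y) * h y), integral_exp_int_mul (sub_ne_zero.2 hkl.symm),
    zero_mul]

theorem norm_sum_sq_of_pairwise_inner_eq_zero {E ι : Type*} [NormedAddCommGroup E]
    [InnerProductSpace ℂ E] (v : ι → E) (hv : Pairwise fun i j => inner ℂ (v i) (v j) = 0)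
    (s : Finset ι) : ‖∑ i ∈ s, v i‖ ^ 2 = ∑ i ∈ s, ‖v i‖ ^ 2 := by
  classical
  induction s using Finset.induction_on with
  | empty => simp
  | insert a s ha ih =>
    rw [Finset.sum_insert ha, Finset.sum_insert ha, ← ih, sq, sq, sq]
    refine norm_add_sq_eq_norm_sq_add_norm_sq_of_inner_eq_zero (𝕜 := ℂ) _ _ ?_
    rw [inner_sum]
    exact Finset.sum_eq_zero fun i hi => hv (by rintro rfl; exact ha hi)

/-- Pythagoras for the finite partial sums, followed by a limit. No summability is required: a
divergent family has sum `0` by convention. -/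
theorem enorm_tsum_sq_le {E ι : Type*} [NormedAddCommGroup E]
    [InnerProductSpace ℂ E] (v : ι → E) (hv : Pairwise fun i j => inner ℂ (v i) (v j) = 0) :
    ‖∑' i, v i‖ₑ ^ (2 : ℕ) ≤ ∑' i, ‖v i‖ₑ ^ (2 : ℕ) := by
  by_cases hs : Summable v
  · have h1 : Filter.Tendsto (fun s : Finset ι => ‖∑ i ∈ s, v i‖ₑ ^ (2 : ℕ)) Filter.atTop
        (nhds (‖∑' i, v i‖ₑ ^ (2 : ℕ))) :=
      ((ENNReal.continuous_pow 2).comp continuous_enorm).continuousAt.tendsto.comp hs.hasSum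
    refine le_of_tendsto' h1 fun s => ?_
    have h2 : ‖∑ i ∈ s, v i‖ₑ ^ (2 : ℕ) = ∑ i ∈ s, ‖v i‖ₑ ^ (2 : ℕ) := by
      simp only [← ofReal_norm, ← ENNReal.ofReal_pow (norm_nonneg _)]
      rw [norm_sum_sq_of_pairwise_inner_eq_zero v hv,
        ENNReal.ofReal_sum_of_nonneg fun _ _ => by positivity]
    rw [h2]
    exact ENNReal.sum_le_tsum s
  · rw [tsum_eq_zero_of_not_summable hs]
    simp

/-- The inequality holds for every symbol, since a mode that is not square integrable contributes
`0` to `invFT`. Hence the Helmholtz projections can be estimated without first showing that their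
symbols lie in `L²`. The `2π` from the norm of `planeMode` cancels the Jacobian of `ξ = 2πζ`. -/
theorem enorm_invFT_sq_le (g : ℤ → ℝ → ℂ) :
    ‖invFT g‖ₑ ^ (2 : ℕ) ≤ ∑' k : ℤ, ∫⁻ ξ, ‖g k ξ‖ₑ ^ (2 : ℕ) := by
  refine (enorm_tsum_sq_le _ fun i j hij => inner_planeMode hij _ _).trans ?_
  refine ENNReal.tsum_le_tsum fun k => ?_
  rw [enorm_planeMode_sq]
  split_ifs with h
  · rw [enorm_fourierInv_eq, enorm_toLp_sq,
      lintegral_comp_two_pi_mul fun ξ => ‖g k ξ‖ₑ ^ (2 : ℕ)]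
  · simp

end ElectronEP

/-! ### Transforms truncated in `y`, and integration by parts -/

namespace ElectronEP

open scoped ContDiff

theorem cylMeasure_eq_restrict :
    cylMeasure = (volume : Measure (ℝ × ℝ)).restrict
      (Set.Ioc (0 : ℝ) (2 * Real.pi) ×ˢ Set.univ) := by
  rw [cylMeasure, Measure.volume_eq_prod, ← Measure.prod_restrict, Measure.restrict_univ]

theorem ae_cylMeasure_mem : ∀ᵐ p ∂cylMeasure, p.1 ∈ Set.Ioc (0 : ℝ) (2 * Real.pi) := by
  rw [cylMeasure_eq_restrict]
  filter_upwards [ae_restrict_mem (measurableSet_Ioc.prod MeasurableSet.univ)] with p hp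
  exact hp.1

/-- The rectangle `[0, 2π] × [-R, R]`. -/
def cell (R : ℝ) : Set (ℝ × ℝ) := Set.Icc 0 (2 * Real.pi) ×ˢ Set.Icc (-R) R

theorem isCompact_cell (R : ℝ) : IsCompact (cell R) := isCompact_Icc.prod isCompact_Icc

theorem cylMeasure_cell_lt_top (R : ℝ) : cylMeasure (cell R) < ⊤ := by
  rw [cylMeasure_eq_restrict]
  exact (Measure.restrict_apply_le _ _).trans_lt (isCompact_cell R).measure_lt_top

theorem ae_not_mem_cell {R : ℝ} {E : Type*} [Zero E] {g : ℝ × ℝ → E}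
    (hg : ∀ p : ℝ × ℝ, R < |p.2| → g p = 0) : ∀ᵐ p ∂cylMeasure, p ∉ cell R → g p = 0 := by
  filter_upwards [ae_cylMeasure_mem] with p hp hpc
  refine hg p ?_
  by_contra hlt
  exact hpc ⟨⟨hp.1.le, hp.2⟩, abs_le.1 (not_lt.1 hlt)⟩

/-- Replaces the cylinder by a compact rectangle, on which continuous dependence on parameters needs
no domination. -/
theorem integral_cell_eq {R : ℝ} {g : ℝ × ℝ → ℂ} (hg : ∀ p : ℝ × ℝ, R < |p.2| → g p = 0) :
    ∫ p in cell R, g p ∂cylMeasure = ∫ p, g p ∂cylMeasure :=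
  setIntegral_eq_integral_of_ae_compl_eq_zero (ae_not_mem_cell hg)

instance : IsLocallyFiniteMeasure cylMeasure := by
  rw [cylMeasure_eq_restrict]; infer_instance

theorem integrable_of_support_strip {R : ℝ} {g : ℝ × ℝ → ℂ} (hc : Continuous g)
    (hg : ∀ p : ℝ × ℝ, R < |p.2| → g p = 0) : Integrable g cylMeasure := by
  have h1 : IntegrableOn g (cell R) cylMeasure :=
    hc.continuousOn.integrableOn_compact (isCompact_cell R)
  rw [← integrableOn_univ]
  refine h1.of_ae_sdiff_eq_zero MeasurableSet.univ.nullMeasurableSet ?_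
  filter_upwards [ae_not_mem_cell hg] with p hp hpc
  exact hp hpc.2

/-- The kernel `e^{-i(kx+qy)}`. -/
noncomputable def waveKernel (k : ℤ) (q : ℝ) (p : ℝ × ℝ) : ℂ :=
  Complex.exp (-(Complex.I * (k * p.1 + q * p.2)))

/-- The Fourier transform of `χ(y) f(x,y)` for a compactly supported cutoff `χ`. -/
noncomputable def truncFT (χ : ℝ → ℝ) (k : ℤ) (q : ℝ) (f : ℝ → ℝ → ℝ) : ℂ :=
  (2 * Real.pi : ℂ)⁻¹ * ∫ p, waveKernel k q p * ((χ p.2 * f p.1 p.2 : ℝ) : ℂ) ∂cylMeasure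

/-- `χ` is smooth and vanishes outside `[-R, R]`. -/
structure IsCutoff (R : ℝ) (χ : ℝ → ℝ) : Prop where
  smooth : ContDiff ℝ ∞ χ
  zero : ∀ y, R < |y| → χ y = 0

theorem IsCutoff.deriv {R : ℝ} {χ : ℝ → ℝ} (h : IsCutoff R χ) : IsCutoff R (deriv χ) := by
  refine ⟨(contDiff_infty_iff_deriv.1 h.smooth).2, fun y hy => ?_⟩
  have hop : IsOpen {y : ℝ | R < |y|} := isOpen_lt continuous_const continuous_abs
  have : χ =ᶠ[nhds y] fun _ => 0 := by
    filter_upwards [hop.mem_nhds hy] with z hz using h.zero z hz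
  rw [this.deriv_eq]; simp

theorem IsCutoff.hasCompactSupport {R : ℝ} {χ : ℝ → ℝ} (h : IsCutoff R χ) :
    HasCompactSupport χ := by
  refine HasCompactSupport.intro (isCompact_Icc (a := -R) (b := R)) fun y hy => h.zero y ?_
  by_contra hlt
  exact hy (abs_le.1 (not_lt.1 hlt))

theorem continuous_waveKernel (k : ℤ) (q : ℝ) : Continuous (waveKernel k q) := by
  unfold waveKernel; fun_prop

section Slice

variable {R : ℝ} {χ : ℝ → ℝ} {f : ℝ → ℝ → ℝ}

theorem continuous_truncFT_integrand (hχ : IsCutoff R χ) (hf : Continuous (Function.uncurry f))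
    (k : ℤ) (q : ℝ) :
    Continuous fun p : ℝ × ℝ => waveKernel k q p * ((χ p.2 * f p.1 p.2 : ℝ) : ℂ) := by
  have h1 : Continuous fun p : ℝ × ℝ => f p.1 p.2 := hf
  have h2 := hχ.smooth.continuous
  exact (continuous_waveKernel k q).mul (Complex.continuous_ofReal.comp (by fun_prop))

theorem integrable_truncFT (hχ : IsCutoff R χ) (hf : Continuous (Function.uncurry f))
    (k : ℤ) (q : ℝ) :
    Integrable (fun p : ℝ × ℝ => waveKernel k q p * ((χ p.2 * f p.1 p.2 : ℝ) : ℂ)) cylMeasure :=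
  integrable_of_support_strip (R := R) (continuous_truncFT_integrand hχ hf k q) fun p hp => by
    simp [hχ.zero _ hp]

theorem truncFT_add {g : ℝ → ℝ → ℝ} (hχ : IsCutoff R χ) (hf : Continuous (Function.uncurry f))
    (hg : Continuous (Function.uncurry g)) (k : ℤ) (q : ℝ) :
    truncFT χ k q (fun x y => f x y + g x y) = truncFT χ k q f + truncFT χ k q g := by
  rw [truncFT, truncFT, truncFT, ← mul_add,
    ← integral_add (integrable_truncFT hχ hf k q) (integrable_truncFT hχ hg k q)]
  congr 2
  ext p
  push_cast; ring

theorem truncFT_const_mul (c : ℝ) (k : ℤ) (q : ℝ) :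
    truncFT χ k q (fun x y => c * f x y) = c * truncFT χ k q f := by
  rw [truncFT, truncFT, mul_left_comm]
  congr 1
  rw [← integral_const_mul]
  refine integral_congr_ae (.of_forall fun p => ?_)
  push_cast; ring

/-- Fubini. The double integral is convenient for calculus in `(t,x,y)`, the single integral over
the modes for Plancherel. -/
theorem truncFT_eq_integral_xMode (hχ : IsCutoff R χ) (hf : Continuous (Function.uncurry f))
    (k : ℤ) (q : ℝ) : truncFT χ k q f =
      (2 * Real.pi : ℂ)⁻¹ * ∫ y : ℝ, Complex.exp (-(Complex.I * (q * y))) *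
        (χ y * xMode f k y) := by
  have h := integrable_truncFT hχ hf k q
  rw [truncFT]
  rw [cylMeasure] at h ⊢
  rw [integral_prod_symm _ h]
  congr 2
  ext y
  rw [xMode, intervalIntegral.integral_of_le Real.two_pi_pos.le, ← mul_assoc,
    ← integral_const_mul]
  refine integral_congr_ae (.of_forall fun x => ?_)
  simp only [waveKernel]
  rw [show -(Complex.I * (k * x + q * y)) = -(Complex.I * (q * y)) + -(Complex.I * k * x) by ring,
    Complex.exp_add]
  push_cast; ring

theorem contDiff_dx (hf : ContDiff ℝ ∞ (Function.uncurry f)) :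
    ContDiff ℝ ∞ (Function.uncurry (dx f)) := by
  have h : Function.uncurry (dx f) = fun p => fderiv ℝ (Function.uncurry f) p (1, 0) := by
    ext ⟨x, y⟩
    have h1 := (hf.differentiable (by simp) (x, y)).hasFDerivAt
    have h2 : HasDerivAt (fun s : ℝ => (s, y)) (1, 0) x :=
      (hasDerivAt_id x).prodMk (hasDerivAt_const x y)
    exact (h1.comp_hasDerivAt x h2).deriv
  rw [h]
  exact (hf.fderiv_right (m := ∞) (by simp)).clm_apply contDiff_const

theorem contDiff_dy (hf : ContDiff ℝ ∞ (Function.uncurry f)) :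
    ContDiff ℝ ∞ (Function.uncurry (dy f)) := by
  have h : Function.uncurry (dy f) = fun p => fderiv ℝ (Function.uncurry f) p (0, 1) := by
    ext ⟨x, y⟩
    have h1 := (hf.differentiable (by simp) (x, y)).hasFDerivAt
    have h2 : HasDerivAt (fun s : ℝ => (x, s)) (0, 1) y :=
      (hasDerivAt_const y x).prodMk (hasDerivAt_id y)
    exact (h1.comp_hasDerivAt y h2).deriv
  rw [h]
  exact (hf.fderiv_right (m := ∞) (by simp)).clm_apply contDiff_const

theorem hasDerivAt_dx (hf : ContDiff ℝ ∞ (Function.uncurry f)) (x y : ℝ) :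
    HasDerivAt (fun s => f s y) (dx f x y) x := by
  have h : Differentiable ℝ fun s => f s y :=
    (hf.differentiable (by simp)).comp (differentiable_id.prodMk (differentiable_const y))
  exact (h x).hasDerivAt

theorem hasDerivAt_dy (hf : ContDiff ℝ ∞ (Function.uncurry f)) (x y : ℝ) :
    HasDerivAt (fun s => f x s) (dy f x y) y := by
  have h : Differentiable ℝ fun s => f x s :=
    (hf.differentiable (by simp)).comp ((differentiable_const x).prodMk differentiable_id)
  exact (h y).hasDerivAt

theorem dx_periodic (hf : ∀ x y, f (x + 2 * Real.pi) y = f x y) (x y : ℝ) :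
    dx f (x + 2 * Real.pi) y = dx f x y := by
  rw [dx, dx, ← deriv_comp_add_const]
  simp only [hf]

/-- Integration by parts in `x`: the boundary terms cancel by periodicity, and the cutoff does not
depend on `x`, so there is no commutator. -/
theorem truncFT_dx (hχ : IsCutoff R χ) (hf : ContDiff ℝ ∞ (Function.uncurry f))
    (hper : ∀ x y, f (x + 2 * Real.pi) y = f x y) (k : ℤ) (q : ℝ) :
    truncFT χ k q (dx f) = Complex.I * k * truncFT χ k q f := by
  have h1 := integrable_truncFT hχ (contDiff_dx hf).continuous k q
  have h2 := integrable_truncFT hχ hf.continuous k q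
  rw [truncFT, truncFT, mul_left_comm]
  congr 1
  rw [cylMeasure] at h1 h2 ⊢
  rw [integral_prod_symm _ h1, integral_prod_symm _ h2, ← integral_const_mul]
  congr 1
  ext y
  have hu : ∀ x : ℝ, HasDerivAt (fun x : ℝ => waveKernel k q (x, y))
      (-(Complex.I * k) * waveKernel k q (x, y)) x := by
    intro x
    have : HasDerivAt (fun x : ℝ => -(Complex.I * (k * x + q * y) : ℂ)) (-(Complex.I * (k * 1))) x :=
      ((((hasDerivAt_id x).ofReal_comp.const_mul (k : ℂ)).add_const _).const_mul _).neg
    refine this.cexp.congr_deriv ?_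
    change Complex.exp (-(Complex.I * (k * x + q * y))) * _ =
      _ * Complex.exp (-(Complex.I * (k * x + q * y)))
    ring
  have hv : ∀ x : ℝ, HasDerivAt (fun x : ℝ => ((χ y * f x y : ℝ) : ℂ))
      (((χ y * dx f x y : ℝ) : ℂ)) x := fun x =>
    ((hasDerivAt_dx hf x y).const_mul (χ y)).ofReal_comp
  have hwx : Continuous fun x : ℝ => waveKernel k q (x, y) :=
    (continuous_waveKernel k q).comp (Continuous.prodMk_left y)
  have hdc : Continuous fun x : ℝ => dx f x y :=
    (contDiff_dx hf).continuous.comp (Continuous.prodMk_left y)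
  have h := intervalIntegral.integral_mul_deriv_eq_deriv_mul (a := 0) (b := 2 * Real.pi)
    (fun x _ => hu x) (fun x _ => hv x)
    (Continuous.intervalIntegrable (by fun_prop) _ _)
    (Continuous.intervalIntegrable (by fun_prop) _ _)
  have hb : waveKernel k q (2 * Real.pi, y) * ((χ y * f (2 * Real.pi) y : ℝ) : ℂ) =
      waveKernel k q (0, y) * ((χ y * f 0 y : ℝ) : ℂ) := by
    have e1 : f (2 * Real.pi) y = f 0 y := by simpa using hper 0 y
    have e2 : waveKernel k q (2 * Real.pi, y) = waveKernel k q (0, y) := by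
      simp only [waveKernel]
      rw [Complex.exp_eq_exp_iff_exists_int]
      exact ⟨-k, by push_cast; ring⟩
    rw [e1, e2]
  rw [hb, sub_self, zero_sub, intervalIntegral.integral_of_le Real.two_pi_pos.le,
    intervalIntegral.integral_of_le Real.two_pi_pos.le] at h
  rw [h, ← integral_neg, ← integral_const_mul]
  congr 1
  ext x
  ring

/-- Integration by parts in `y`; the compact support of `χ` removes the boundary terms. The
derivative that falls on `χ` is the whole cost of truncating. -/
theorem truncFT_dy (hχ : IsCutoff R χ) (hf : ContDiff ℝ ∞ (Function.uncurry f))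
    (k : ℤ) (q : ℝ) :
    truncFT χ k q (dy f) = Complex.I * q * truncFT χ k q f - truncFT (deriv χ) k q f := by
  have h1 := integrable_truncFT hχ (contDiff_dy hf).continuous k q
  have h2 := integrable_truncFT hχ hf.continuous k q
  have h3 := integrable_truncFT hχ.deriv hf.continuous k q
  rw [truncFT, truncFT, truncFT, mul_left_comm, ← mul_sub]
  congr 1
  have h4 : Integrable (fun p : ℝ × ℝ =>
      Complex.I * q * (waveKernel k q p * ((χ p.2 * f p.1 p.2 : ℝ) : ℂ)) -
        waveKernel k q p * ((deriv χ p.2 * f p.1 p.2 : ℝ) : ℂ)) cylMeasure :=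
    (h2.const_mul (Complex.I * q)).sub h3
  rw [← integral_const_mul, ← integral_sub (h2.const_mul _) h3]
  rw [cylMeasure] at h1 h4 ⊢
  rw [integral_prod _ h1, integral_prod _ h4]
  congr 1
  ext x
  have hχc := hχ.smooth.continuous
  have hχd := hχ.deriv.smooth.continuous
  have hw : ∀ y : ℝ, HasDerivAt (fun y : ℝ => waveKernel k q (x, y))
      (-(Complex.I * q) * waveKernel k q (x, y)) y := by
    intro y
    have : HasDerivAt (fun y : ℝ => -(Complex.I * (k * x + q * y) : ℂ)) (-(Complex.I * (q * 1))) y :=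
      ((((hasDerivAt_id y).ofReal_comp.const_mul (q : ℂ)).const_add _).const_mul _).neg
    refine this.cexp.congr_deriv ?_
    change Complex.exp (-(Complex.I * (k * x + q * y))) * _ =
      _ * Complex.exp (-(Complex.I * (k * x + q * y)))
    ring
  have hχ' : ∀ y : ℝ, HasDerivAt (fun y : ℝ => (χ y : ℂ)) ((deriv χ y : ℝ) : ℂ) y := fun y =>
    ((hχ.smooth.differentiable (by simp) y).hasDerivAt).ofReal_comp
  have hu := fun y => (hw y).mul (hχ' y)
  have hv : ∀ y : ℝ, HasDerivAt (fun y : ℝ => (f x y : ℂ)) ((dy f x y : ℝ) : ℂ) y := fun y =>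
    (hasDerivAt_dy hf x y).ofReal_comp
  have hwc : Continuous fun y : ℝ => waveKernel k q (x, y) :=
    (continuous_waveKernel k q).comp (Continuous.prodMk_right x)
  have hfc : Continuous fun y : ℝ => f x y := hf.continuous.comp (Continuous.prodMk_right x)
  have hdc : Continuous fun y : ℝ => dy f x y :=
    (contDiff_dy hf).continuous.comp (Continuous.prodMk_right x)
  have hint : ∀ (c : ℝ → ℝ) (g : ℝ → ℂ), Continuous c → HasCompactSupport c → Continuous g →
      Integrable fun y : ℝ => g y * (c y : ℂ) := by
    intro c g hc hcs hg
    refine Continuous.integrable_of_hasCompactSupport (by fun_prop) ?_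
    exact (hcs.comp_left (g := fun x : ℝ => (x : ℂ)) (by simp)).mul_left
  have h := integral_mul_deriv_eq_deriv_mul_of_integrable
    (u := fun y : ℝ => waveKernel k q (x, y) * (χ y : ℂ)) (v := fun y : ℝ => (f x y : ℂ))
    (fun y _ => hu y) (fun y _ => hv y)
    ((hint χ (fun y => waveKernel k q (x, y) * (dy f x y : ℂ)) hχc hχ.hasCompactSupport
      (by fun_prop)).congr (.of_forall fun y => by simp only [Pi.mul_apply]; ring))
    (((hint χ (fun y => -(Complex.I * q) * waveKernel k q (x, y) * (f x y : ℂ)) hχc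
      hχ.hasCompactSupport (by fun_prop)).add
      (hint (deriv χ) (fun y => waveKernel k q (x, y) * (f x y : ℂ)) hχd
      hχ.deriv.hasCompactSupport (by fun_prop))).congr
      (.of_forall fun y => by simp only [Pi.mul_apply, Pi.add_apply]; ring))
    ((hint χ (fun y => waveKernel k q (x, y) * (f x y : ℂ)) hχc hχ.hasCompactSupport
      (by fun_prop)).congr (.of_forall fun y => by simp only [Pi.mul_apply]; ring))
  simp only [Complex.ofReal_mul, ← mul_assoc] at h ⊢
  rw [h, ← integral_neg]
  congr 1
  ext y
  ring

end Slice

end ElectronEP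

/-! ### Truncated transforms in frequency and along characteristics -/

namespace ElectronEP

open scoped ContDiff

theorem continuous_xMode_mul_cutoff {R : ℝ} {χ : ℝ → ℝ} {f : ℝ → ℝ → ℝ} (hχ : IsCutoff R χ)
    (hf : Continuous (Function.uncurry f)) (k : ℤ) :
    Continuous fun y => (χ y : ℂ) * xMode f k y :=
  (Complex.continuous_ofReal.comp hχ.smooth.continuous).mul (continuous_xMode hf k)

theorem hasCompactSupport_xMode_mul_cutoff {R : ℝ} {χ : ℝ → ℝ} (f : ℝ → ℝ → ℝ)
    (hχ : IsCutoff R χ) (k : ℤ) : HasCompactSupport fun y => (χ y : ℂ) * xMode f k y :=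
  (hχ.hasCompactSupport.comp_left (g := fun x : ℝ => (x : ℂ)) (by simp)).mul_right

theorem memLp_xMode_mul_cutoff {R : ℝ} {χ : ℝ → ℝ} {f : ℝ → ℝ → ℝ} (hχ : IsCutoff R χ)
    (hf : Continuous (Function.uncurry f)) (k : ℤ) :
    MemLp (fun y => (χ y : ℂ) * xMode f k y) 2 volume :=
  (continuous_xMode_mul_cutoff hχ hf k).memLp_of_hasCompactSupport
    (hasCompactSupport_xMode_mul_cutoff f hχ k)

theorem truncFT_ae_eq_lpFT {R : ℝ} {χ : ℝ → ℝ} {f : ℝ → ℝ → ℝ} (hχ : IsCutoff R χ)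
    (hf : Continuous (Function.uncurry f)) (k : ℤ) :
    ∀ᵐ ξ : ℝ, truncFT χ k ξ f = lpFT ((memLp_xMode_mul_cutoff hχ hf k).toLp _) ξ := by
  filter_upwards [lpFT_toLp_ae ((continuous_xMode_mul_cutoff hχ hf k).integrable_of_hasCompactSupport
    (hasCompactSupport_xMode_mul_cutoff f hχ k)) (memLp_xMode_mul_cutoff hχ hf k)] with ξ hξ
  rw [hξ, truncFT_eq_integral_xMode hχ hf]

theorem lintegral_truncFT {R : ℝ} {χ : ℝ → ℝ} {f : ℝ → ℝ → ℝ} (hχ : IsCutoff R χ)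
    (hf : Continuous (Function.uncurry f)) (k : ℤ) :
    ∫⁻ ξ, ‖truncFT χ k ξ f‖ₑ ^ (2 : ℕ) = (ENNReal.ofReal (2 * Real.pi))⁻¹ *
      ∫⁻ y, ‖(χ y : ℂ) * xMode f k y‖ₑ ^ (2 : ℕ) := by
  rw [← enorm_toLp_sq (memLp_xMode_mul_cutoff hχ hf k), ← lintegral_lpFT]
  refine lintegral_congr_ae ?_
  filter_upwards [truncFT_ae_eq_lpFT hχ hf k] with ξ hξ
  rw [hξ]

/-- By Plancherel the error in frequency is the tail `(χ - 1)` times the mode in physical space. -/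
theorem lintegral_truncFT_sub_ft {R : ℝ} {χ : ℝ → ℝ} {f : ℝ → ℝ → ℝ} (hχ : IsCutoff R χ)
    (hf : Continuous (Function.uncurry f)) {k : ℤ} (h : MemLp (xMode f k) 2 volume) :
    ∫⁻ ξ, ‖truncFT χ k ξ f - ft f k ξ‖ₑ ^ (2 : ℕ) = (ENNReal.ofReal (2 * Real.pi))⁻¹ *
      ∫⁻ y, ‖((χ y : ℂ) - 1) * xMode f k y‖ₑ ^ (2 : ℕ) := by
  have h1 := memLp_xMode_mul_cutoff hχ hf k
  have h2 : ∫⁻ y, ‖((χ y : ℂ) - 1) * xMode f k y‖ₑ ^ (2 : ℕ) =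
      ‖h1.toLp _ - h.toLp _‖ₑ ^ (2 : ℕ) := by
    rw [← MemLp.toLp_sub, enorm_toLp_sq]
    refine lintegral_congr fun y => ?_
    rw [Pi.sub_apply, sub_one_mul]
  rw [h2, ← lintegral_lpFT]
  refine lintegral_congr_ae ?_
  filter_upwards [truncFT_ae_eq_lpFT hχ hf k, lpFT_sub (h1.toLp _) (h.toLp _)] with ξ h3 h4
  rw [h3, h4, ft_eq_lpFT h]

section TimeDependent

variable {R : ℝ} {χ : ℝ → ℝ} {f : ℝ → ℝ → ℝ → ℝ}

theorem IsSmoothField.contDiff (hf : IsSmoothField f) {t : ℝ} (ht : 0 ≤ t) :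
    ContDiff ℝ ∞ (Function.uncurry (f t)) := by
  have h : ContDiff ℝ ∞ fun p : ℝ × ℝ => (t, p.1, p.2) := by fun_prop
  exact hf.smooth.comp_contDiff h fun p => ⟨ht, trivial⟩

/-- Clamping time at `0` extends the field continuously to all of `ℝ × ℝ × ℝ`, which gives joint
continuity and measurability without restricting to `t ≥ 0`. -/
theorem IsSmoothField.continuous_max (hf : IsSmoothField f) :
    Continuous fun p : ℝ × ℝ × ℝ => f (max p.1 0) p.2.1 p.2.2 := by
  have h : Continuous fun p : ℝ × ℝ × ℝ => (max p.1 0, p.2.1, p.2.2) := by fun_prop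
  exact hf.smooth.continuousOn.comp_continuous h fun p => ⟨Set.mem_Ici.2 (le_max_right _ _), trivial⟩

theorem IsSmoothField.hasDerivAt_time (hf : IsSmoothField f) {t : ℝ} (ht : 0 < t) (x y : ℝ) :
    HasDerivAt (fun s => f s x y) (deriv (fun s => f s x y) t) t := by
  have h1 := (hf.smooth (t, x, y) ⟨ht.le, trivial⟩).contDiffAt
    (prod_mem_nhds (Ici_mem_nhds ht) Filter.univ_mem)
  have h2 : DifferentiableAt ℝ (fun s : ℝ => (s, x, y)) t := by fun_prop
  exact ((h1.differentiableAt (by simp)).comp t h2).hasDerivAt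

theorem IsSmoothField.continuousOn_deriv_time (hf : IsSmoothField f) :
    ContinuousOn (fun p : ℝ × ℝ × ℝ => deriv (fun s => f s p.2.1 p.2.2) p.1)
      (Set.Ioi 0 ×ˢ Set.univ) := by
  set F := fun p : ℝ × ℝ × ℝ => f p.1 p.2.1 p.2.2
  have hsub : Set.Ioi (0 : ℝ) ×ˢ (Set.univ : Set (ℝ × ℝ)) ⊆ Set.Ici 0 ×ˢ Set.univ :=
    Set.prod_mono Set.Ioi_subset_Ici_self le_rfl
  have hop : IsOpen (Set.Ioi (0 : ℝ) ×ˢ (Set.univ : Set (ℝ × ℝ))) := isOpen_Ioi.prod isOpen_univ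
  have h1 := (hf.smooth.mono hsub).continuousOn_fderiv_of_isOpen hop (by simp)
  refine (h1.clm_apply (continuousOn_const (c := ((1 : ℝ), (0 : ℝ), (0 : ℝ))))).congr ?_
  rintro ⟨t, x, y⟩ ht
  have h2 : HasFDerivAt F (fderiv ℝ F (t, x, y)) (t, x, y) :=
    (((hf.smooth.mono hsub).contDiffAt (hop.mem_nhds ht)).differentiableAt (by simp)).hasFDerivAt
  have h3 : HasDerivAt (fun s : ℝ => (s, x, y)) (1, 0, 0) t :=
    (hasDerivAt_id t).prodMk ((hasDerivAt_const t x).prodMk (hasDerivAt_const t y))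
  exact (h2.comp_hasDerivAt t h3).deriv

theorem IsSmoothField.continuous_deriv_time (hf : IsSmoothField f) {t : ℝ} (ht : 0 < t) :
    Continuous (Function.uncurry fun x y => deriv (fun s => f s x y) t) := by
  have h : Continuous fun p : ℝ × ℝ => (t, p.1, p.2) := by fun_prop
  exact hf.continuousOn_deriv_time.comp_continuous h fun p => ⟨ht, trivial⟩

theorem continuous_truncFT (hχ : IsCutoff R χ) (hf : IsSmoothField f) (k : ℤ) :
    Continuous fun z : ℝ × ℝ => truncFT χ k (z.2 - k * max z.1 0) (f (max z.1 0)) := by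
  have h1 : ∀ z : ℝ × ℝ, truncFT χ k (z.2 - k * max z.1 0) (f (max z.1 0)) =
      (2 * Real.pi : ℂ)⁻¹ * ∫ p in cell R, waveKernel k (z.2 - k * max z.1 0) p *
        ((χ p.2 * f (max z.1 0) p.1 p.2 : ℝ) : ℂ) ∂cylMeasure := by
    intro z
    rw [truncFT, integral_cell_eq fun p hp => by simp [hχ.zero _ hp]]
  simp only [h1]
  refine continuous_const.mul (continuous_parametric_integral_of_continuous ?_ (isCompact_cell R))
  have h2 := hχ.smooth.continuous
  have h3 : Continuous fun w : (ℝ × ℝ) × ℝ × ℝ => f (max w.1.1 0) w.2.1 w.2.2 :=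
    hf.continuous_max.comp (f := fun w : (ℝ × ℝ) × ℝ × ℝ => (w.1.1, w.2.1, w.2.2)) (by fun_prop)
  have h4 : Continuous fun w : (ℝ × ℝ) × ℝ × ℝ => waveKernel k (w.1.2 - k * max w.1.1 0) w.2 := by
    unfold waveKernel; fun_prop
  exact h4.mul (Complex.continuous_ofReal.comp
    ((h2.comp (by fun_prop : Continuous fun w : (ℝ × ℝ) × ℝ × ℝ => w.2.2)).mul h3))

theorem continuousOn_truncFT (hχ : IsCutoff R χ) (hf : IsSmoothField f) (k : ℤ) (ξ : ℝ) :
    ContinuousOn (fun t : ℝ => truncFT χ k (ξ - k * t) (f t)) (Set.Ici 0) := by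
  have h := (continuous_truncFT hχ hf k).comp (Continuous.prodMk_left ξ)
  refine h.continuousOn.congr fun t ht => ?_
  simp [max_eq_left (Set.mem_Ici.1 ht)]

/-- Differentiating the kernel at the frequency `ξ - ks` brings down `iky`, and an integration by
parts in `x` identifies this term with the transform of `y∂ₓf`. Moving along characteristics thus
absorbs the transport term exactly, with no error from the cutoff. -/
theorem hasDerivAt_truncFT (hχ : IsCutoff R χ) (hf : IsSmoothField f) (k : ℤ) (ξ : ℝ) {t : ℝ}
    (ht : 0 < t) :
    HasDerivAt (fun s : ℝ => truncFT χ k (ξ - k * s) (f s))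
      (truncFT χ k (ξ - k * t) (fun x y => deriv (fun s => f s x y) t + y * dx (f t) x y)) t := by
  have hχc := hχ.smooth.continuous
  set F : ℝ → ℝ × ℝ → ℂ := fun s p =>
    waveKernel k (ξ - k * s) p * ((χ p.2 * f s p.1 p.2 : ℝ) : ℂ) with hF
  set F' : ℝ → ℝ × ℝ → ℂ := fun s p =>
    Complex.I * k * (waveKernel k (ξ - k * s) p * ((χ p.2 * (p.2 * f s p.1 p.2) : ℝ) : ℂ)) +
    waveKernel k (ξ - k * s) p * ((χ p.2 * deriv (fun s => f s p.1 p.2) s : ℝ) : ℂ) with hF'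
  have hdiff : ∀ p : ℝ × ℝ, ∀ s : ℝ, 0 < s → HasDerivAt (fun s => F s p) (F' s p) s := by
    intro p s hs
    have h1 : HasDerivAt (fun s : ℝ => -(Complex.I * (k * p.1 + ((ξ - k * s : ℝ) : ℂ) * p.2)))
        (-(Complex.I * (((-(k * 1) : ℝ) : ℂ) * p.2))) s :=
      (((((hasDerivAt_id s).const_mul (k : ℝ)).const_sub ξ).ofReal_comp.mul_const
        (p.2 : ℂ)).const_add _ |>.const_mul _).neg
    have h2 := ((hf.hasDerivAt_time hs p.1 p.2).const_mul (χ p.2)).ofReal_comp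
    refine (h1.cexp.mul h2).congr_deriv ?_
    simp only [hF', waveKernel]
    push_cast; ring
  have hzero : ∀ s (p : ℝ × ℝ), R < |p.2| → F' s p = 0 := fun s p hp => by
    simp [hF', hχ.zero _ hp]
  have hsl := fun s (hs : (0 : ℝ) ≤ s) => (hf.contDiff hs).continuous
  have hyf : ∀ s, 0 ≤ s → Continuous (Function.uncurry fun x y => y * f s x y) := fun s hs =>
    continuous_snd.mul (hsl s hs)
  have hcont : ContinuousOn (fun w : ℝ × ℝ × ℝ => F' w.1 w.2) (Set.Ioi 0 ×ˢ Set.univ) := by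
    have h1 := hf.continuousOn_deriv_time
    have h2 : ContinuousOn (fun w : ℝ × ℝ × ℝ => f w.1 w.2.1 w.2.2) (Set.Ioi 0 ×ˢ Set.univ) :=
      hf.smooth.continuousOn.mono (Set.prod_mono Set.Ioi_subset_Ici_self le_rfl)
    have h3 : Continuous fun w : ℝ × ℝ × ℝ => waveKernel k (ξ - k * w.1) w.2 := by
      unfold waveKernel; fun_prop
    have h4 : Continuous fun w : ℝ × ℝ × ℝ => χ w.2.2 := by fun_prop
    refine (continuousOn_const.mul (h3.continuousOn.mul ?_)).add (h3.continuousOn.mul ?_)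
    · exact Complex.continuous_ofReal.comp_continuousOn (h4.continuousOn.mul
        ((by fun_prop : Continuous fun w : ℝ × ℝ × ℝ => w.2.2).continuousOn.mul h2))
    · exact Complex.continuous_ofReal.comp_continuousOn (h4.continuousOn.mul h1)
  -- Domination is sought on `[t/2, 2t]` only, which stays away from `t = 0`, where the two-sided
  -- time derivative is not controlled.
  obtain ⟨M, hM⟩ := ((isCompact_Icc (a := t / 2) (b := 2 * t)).prod
    (isCompact_cell R)).exists_bound_of_continuousOn (hcont.mono (Set.prod_mono
      (fun s hs => Set.mem_Ioi.2 (by have := hs.1; linarith)) (Set.subset_univ _)))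
  have hmem : Set.Ioo (t / 2) (2 * t) ∈ nhds t := Ioo_mem_nhds (by linarith) (by linarith)
  have hpos : ∀ s ∈ Set.Ioo (t / 2) (2 * t), 0 < s := fun s hs => by have := hs.1; linarith
  have hmain := hasDerivAt_integral_of_dominated_loc_of_deriv_le (μ := cylMeasure) (F := F)
    (F' := F') (x₀ := t) (s := Set.Ioo (t / 2) (2 * t))
    (bound := (cell R).indicator fun _ => M) hmem
    (by
      filter_upwards [hmem] with s hs
      exact (integrable_truncFT hχ (hsl s (hpos s hs).le) k _).1)
    (integrable_truncFT hχ (hsl t ht.le) k _)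
    (((integrable_truncFT hχ (hyf t ht.le) k _).1.const_mul _).add
      (integrable_truncFT hχ (hf.continuous_deriv_time ht) k _).1)
    (by
      filter_upwards [ae_cylMeasure_mem] with p hp s hs
      by_cases hpc : p ∈ cell R
      · rw [Set.indicator_of_mem hpc]
        exact hM (s, p) ⟨⟨hs.1.le, hs.2.le⟩, hpc⟩
      · rw [Set.indicator_of_notMem hpc, hzero s p, norm_zero]
        by_contra hlt
        exact hpc ⟨⟨hp.1.le, hp.2⟩, abs_le.1 (not_lt.1 hlt)⟩)
    ((integrable_indicator_iff (isCompact_cell R).measurableSet).2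
      (integrableOn_const (cylMeasure_cell_lt_top R).ne))
    (.of_forall fun p s hs => hdiff p s (hpos s hs))
  refine (hmain.2.const_mul (2 * Real.pi : ℂ)⁻¹).congr_deriv ?_
  have hyd : ContDiff ℝ ∞ (Function.uncurry fun x y => y * f t x y) :=
    contDiff_snd.mul (hf.contDiff ht.le)
  have hdx : dx (fun x y => y * f t x y) = fun x y => y * dx (f t) x y := by
    ext x y
    exact ((hasDerivAt_dx (hf.contDiff ht.le) x y).const_mul y).deriv
  rw [truncFT_add hχ (hf.continuous_deriv_time ht) (by
    rw [← hdx]; exact (contDiff_dx hyd).continuous), ← hdx, truncFT_dx hχ hyd (fun x y => by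
      rw [hf.periodic t ht.le]), integral_add ((integrable_truncFT hχ (hyf t ht.le) k _).const_mul _)
      (integrable_truncFT hχ (hf.continuous_deriv_time ht) k _), integral_const_mul]
  simp only [truncFT]
  ring

end TimeDependent

end ElectronEP

/-! ### The quadratic form of a mode: coercivity and remainders -/

namespace ElectronEP

/-- Quadratic part of the energy of a mode `k ≠ 0`, in terms of the shifted time `τ = t - ξ/k`. -/
noncomputable def modeForm (m β k τ N V : ℝ) : ℝ :=
  V ^ 2 / (1 + τ ^ 2) + ((k ^ 2 * (1 + τ ^ 2) + β) / m + 2 / (1 + τ ^ 2)) / (1 + τ ^ 2) * N ^ 2 -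
    τ / (1 + τ ^ 2) ^ 2 * (N * V)

/-- The part of the derivative of `modeForm` that is integrable in time. -/
noncomputable def modeRem (m β τ N V Γ : ℝ) : ℝ :=
  (-(2 * τ * β) / (m * (1 + τ ^ 2) ^ 2) - 8 * τ / (1 + τ ^ 2) ^ 3) * N ^ 2 +
    (-1 / (1 + τ ^ 2) ^ 2 + 3 * τ ^ 2 / (1 + τ ^ 2) ^ 3) * (N * V) +
    4 / (1 + τ ^ 2) ^ 2 * (V * Γ) - 2 * τ / (1 + τ ^ 2) ^ 3 * (N * Γ)

/-- The contribution of source terms to the derivative of `modeForm`. -/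
noncomputable def modeErr (m β k τ N V r₁ r₃ : ℝ) : ℝ :=
  2 / (1 + τ ^ 2) * (V * r₃) +
    2 * (((k ^ 2 * (1 + τ ^ 2) + β) / m + 2 / (1 + τ ^ 2)) / (1 + τ ^ 2)) * (N * r₁) -
    τ / (1 + τ ^ 2) ^ 2 * (r₁ * V + N * r₃)

/-- `N' = V + r₁`, `Γ' = r₂` and the equation for `V'` at the mode `(k, ξ - kt)`. -/
structure IsModeSolution (m β k ξ T : ℝ) (N V Γ r₁ r₂ r₃ : ℝ → ℝ) : Prop where
  contN : ContinuousOn N (Set.Icc 0 T)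
  contV : ContinuousOn V (Set.Icc 0 T)
  contΓ : ContinuousOn Γ (Set.Icc 0 T)
  cont₁ : ContinuousOn r₁ (Set.Icc 0 T)
  cont₂ : ContinuousOn r₂ (Set.Icc 0 T)
  cont₃ : ContinuousOn r₃ (Set.Icc 0 T)
  derivN : ∀ t ∈ Set.Ioo 0 T, HasDerivAt N (V t + r₁ t) t
  derivΓ : ∀ t ∈ Set.Ioo 0 T, HasDerivAt Γ (r₂ t) t
  derivV : ∀ t ∈ Set.Ioo 0 T, HasDerivAt V
    (-(2 * k * (ξ - k * t) / (k ^ 2 + (ξ - k * t) ^ 2)) * V t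
      - (k ^ 2 + (ξ - k * t) ^ 2 + β) / m * N t
      + 2 * k ^ 2 / (k ^ 2 + (ξ - k * t) ^ 2) * (Γ t - N t) + r₃ t) t

/-- Complete the square in `V`. The term `2/(1+τ²)² N²` of the form pays for the cross term, leaving
the nonnegative coefficient `4(1+τ²) - τ²`; no smallness of `m` or `β` is involved. -/
theorem modeForm_lower {m β k : ℝ} (hm : 0 < m) (hβ : 0 ≤ β) (τ N V : ℝ) :
    V ^ 2 / (2 * (1 + τ ^ 2)) + k ^ 2 / m * N ^ 2 ≤ modeForm m β k τ N V := by
  have hz : 0 < 1 + τ ^ 2 := by positivity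
  have key : modeForm m β k τ N V - (V ^ 2 / (2 * (1 + τ ^ 2)) + k ^ 2 / m * N ^ 2) =
      (((1 + τ ^ 2) * V - τ * N) ^ 2 + (4 * (1 + τ ^ 2) - τ ^ 2) * N ^ 2) / (2 * (1 + τ ^ 2) ^ 3) +
      β / (m * (1 + τ ^ 2)) * N ^ 2 := by
    unfold modeForm; field_simp; ring
  have h1 : 0 ≤ 4 * (1 + τ ^ 2) - τ ^ 2 := by nlinarith [sq_nonneg τ]
  have : 0 ≤ modeForm m β k τ N V - (V ^ 2 / (2 * (1 + τ ^ 2)) + k ^ 2 / m * N ^ 2) := by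
    rw [key]; positivity
  linarith

theorem modeForm_upper {m β k : ℝ} (hm : 0 < m) (hβ : 0 ≤ β) (τ N V : ℝ) :
    modeForm m β k τ N V ≤ 3 / 2 * (V ^ 2 / (1 + τ ^ 2)) + ((k ^ 2 + β) / m + 5 / 2) * N ^ 2 := by
  have hz : 0 < 1 + τ ^ 2 := by positivity
  have key : 3 / 2 * (V ^ 2 / (1 + τ ^ 2)) + ((k ^ 2 + β) / m + 5 / 2) * N ^ 2 -
      modeForm m β k τ N V =
      (((1 + τ ^ 2) * V + τ * N) ^ 2 + (5 * (1 + τ ^ 2) ^ 3 - 4 * (1 + τ ^ 2) - τ ^ 2) * N ^ 2) /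
        (2 * (1 + τ ^ 2) ^ 3) + β * τ ^ 2 / (m * (1 + τ ^ 2)) * N ^ 2 := by
    unfold modeForm; field_simp; ring
  have h1 : 0 ≤ 5 * (1 + τ ^ 2) ^ 3 - 4 * (1 + τ ^ 2) - τ ^ 2 := by
    nlinarith [sq_nonneg τ, mul_nonneg (sq_nonneg τ) (sq_nonneg τ),
      mul_nonneg (mul_nonneg (sq_nonneg τ) (sq_nonneg τ)) (sq_nonneg τ)]
  have : 0 ≤ 3 / 2 * (V ^ 2 / (1 + τ ^ 2)) + ((k ^ 2 + β) / m + 5 / 2) * N ^ 2 -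
      modeForm m β k τ N V := by
    rw [key]; positivity
  linarith

theorem inv_one_add_sq_mem (τ : ℝ) : 0 < (1 + τ ^ 2)⁻¹ ∧ (1 + τ ^ 2)⁻¹ ≤ 1 :=
  ⟨by positivity, inv_le_one_of_one_le₀ (by nlinarith [sq_nonneg τ])⟩

/-- The coefficients of the remainders become polynomials in `i = (1+τ²)⁻¹` and `σ = τi`. This
relation gives `|σ| ≤ 1/2`, so the bounds below treat `i` and `σ` as bounded parameters. -/
theorem sq_mul_inv_one_add_sq (τ : ℝ) :
    (τ * (1 + τ ^ 2)⁻¹) ^ 2 = (1 + τ ^ 2)⁻¹ - (1 + τ ^ 2)⁻¹ ^ 2 := by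
  have hz : 0 < 1 + τ ^ 2 := by positivity
  field_simp; ring

theorem abs_le_half_of_sq_eq {σ i : ℝ} (h : σ ^ 2 = i - i ^ 2) : |σ| ≤ 1 / 2 := by
  refine abs_le_of_sq_le_sq (by nlinarith [sq_nonneg (i - 1 / 2)]) (by norm_num)

theorem modeForm_lower' {m β k : ℝ} (hm : 0 < m) (hβ : 0 ≤ β) (hk : 1 ≤ k ^ 2) (τ N V : ℝ) :
    V ^ 2 * (1 + τ ^ 2)⁻¹ / 2 + N ^ 2 / m ≤ modeForm m β k τ N V := by
  refine le_trans ?_ (modeForm_lower hm hβ τ N V)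
  have h1 : V ^ 2 * (1 + τ ^ 2)⁻¹ / 2 = V ^ 2 / (2 * (1 + τ ^ 2)) := by field_simp
  have h2 : N ^ 2 / m ≤ k ^ 2 / m * N ^ 2 := by
    rw [div_mul_eq_mul_div]
    gcongr
    exact le_mul_of_one_le_left (sq_nonneg N) hk
  linarith

/-- Young's inequality on each product. Every `V²` must keep a factor `i`, because the form controls
`V²` only through `V²i`. -/
theorem rem_bracket_le {i σ b : ℝ} (hi0 : 0 < i) (hi1 : i ≤ 1) (hσ : |σ| ≤ 1 / 2) (hb : 0 ≤ b)
    (N V Γ : ℝ) :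
    (-(2 * σ) * b - 8 * (σ * i)) * N ^ 2 + i * (2 - 3 * i) * (N * V) + 4 * i * (V * Γ) -
      2 * σ * i * (N * Γ) ≤ (b + 6) * N ^ 2 + 3 * (V ^ 2 * i) + 3 * Γ ^ 2 := by
  obtain ⟨hσ2, hσ1⟩ := abs_le.1 hσ
  have hA : (-(2 * σ) * b - 8 * (σ * i)) * N ^ 2 ≤ (b + 4) * N ^ 2 := by
    refine mul_le_mul_of_nonneg_right ?_ (sq_nonneg N)
    nlinarith
  have hB : i * (2 - 3 * i) * (N * V) ≤ N ^ 2 + V ^ 2 * i := by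
    have h1 : (2 - 3 * i) * (N * V) ≤ N ^ 2 + V ^ 2 := by
      nlinarith [sq_nonneg (N + V), sq_nonneg (N - V)]
    have h2 := mul_le_mul_of_nonneg_left h1 hi0.le
    nlinarith [sq_nonneg N]
  have hC : 4 * i * (V * Γ) ≤ 2 * (V ^ 2 * i) + 2 * Γ ^ 2 := by
    have h1 := mul_nonneg hi0.le (sq_nonneg (V - Γ))
    nlinarith [sq_nonneg Γ]
  have hD : -(2 * σ * i * (N * Γ)) ≤ N ^ 2 + Γ ^ 2 := by
    have h1 : -1 ≤ 2 * σ * i := by nlinarith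
    have h2 : 2 * σ * i ≤ 1 := by nlinarith
    nlinarith [sq_nonneg (N + Γ), sq_nonneg (N - Γ)]
  linarith

/-- Young's inequality, with weights such that the terms without sources can be absorbed by `i`
times the form. Here `i₀` is a lower bound for `i` on a bounded time interval; the constant may blow
up as `i₀ → 0`, since it multiplies only sources that will vanish. -/
theorem err_le {i i₀ σ ω W m : ℝ} (hi0 : 0 < i) (hi1 : i ≤ 1) (hσ : |σ| ≤ 1 / 2) (hi₀ : 0 < i₀)
    (hm : 0 < m) (hω : 0 ≤ ω) (hωW : ω ≤ W) (N V r₁ r₃ : ℝ) :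
    2 * i * (V * r₃) + 2 * ω * (N * r₁) - σ * i * (r₁ * V + N * r₃) ≤
      (i * V) ^ 2 / 2 + i₀ / m * N ^ 2 +
        (4 + 2 * m * W ^ 2 / i₀ + m / i₀) * (r₁ ^ 2 + r₃ ^ 2) := by
  obtain ⟨hσ2, hσ1⟩ := abs_le.1 hσ
  have h1 : 2 * i * (V * r₃) ≤ (i * V) ^ 2 / 4 + 4 * r₃ ^ 2 := by
    nlinarith [sq_nonneg (i * V / 2 - 2 * r₃)]
  have h2 : -(σ * (r₁ * (i * V))) ≤ (i * V) ^ 2 / 4 + r₁ ^ 2 := by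
    nlinarith [sq_nonneg (i * V / 2 - r₁), sq_nonneg (i * V / 2 + r₁)]
  have h3 : 2 * ω * (N * r₁) ≤ i₀ / (2 * m) * N ^ 2 + 2 * m * W ^ 2 / i₀ * r₁ ^ 2 := by
    have hs : i₀ / (2 * m) * N ^ 2 + 2 * m * ω ^ 2 / i₀ * r₁ ^ 2 - 2 * ω * (N * r₁) =
        (i₀ * N - 2 * m * ω * r₁) ^ 2 / (2 * m * i₀) := by field_simp; ring
    have hs' : 0 ≤ (i₀ * N - 2 * m * ω * r₁) ^ 2 / (2 * m * i₀) := by positivity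
    have : 2 * m * ω ^ 2 / i₀ * r₁ ^ 2 ≤ 2 * m * W ^ 2 / i₀ * r₁ ^ 2 := by gcongr
    linarith
  have h4 : -(σ * i * (N * r₃)) ≤ i₀ / (2 * m) * N ^ 2 + m / i₀ * r₃ ^ 2 := by
    have hs : i₀ / (2 * m) * N ^ 2 + m / i₀ * r₃ ^ 2 - -(σ * i * (N * r₃)) =
        ((i₀ * N + m * (σ * i) * r₃) ^ 2 + m ^ 2 * (2 - (σ * i) ^ 2) * r₃ ^ 2) / (2 * m * i₀) := by
      field_simp; ring
    have h5 : 0 ≤ 2 - (σ * i) ^ 2 := by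
      have h6 : σ ^ 2 ≤ 1 := by nlinarith
      have h7 : i ^ 2 ≤ 1 := pow_le_one₀ hi0.le hi1
      rw [mul_pow]
      linarith [mul_le_mul h6 h7 (sq_nonneg i) zero_le_one]
    have hs' : 0 ≤ ((i₀ * N + m * (σ * i) * r₃) ^ 2 + m ^ 2 * (2 - (σ * i) ^ 2) * r₃ ^ 2) /
        (2 * m * i₀) := by positivity
    linarith
  have h8 : i₀ / m * N ^ 2 = 2 * (i₀ / (2 * m) * N ^ 2) := by field_simp
  have h9 : 2 * i * (V * r₃) + 2 * ω * (N * r₁) - σ * i * (r₁ * V + N * r₃) =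
      2 * i * (V * r₃) + 2 * ω * (N * r₁) +
      -(σ * (r₁ * (i * V))) + -(σ * i * (N * r₃)) := by ring
  have h10 : (4 + 2 * m * W ^ 2 / i₀ + m / i₀) * (r₁ ^ 2 + r₃ ^ 2) = 4 * r₁ ^ 2 + 4 * r₃ ^ 2 +
      2 * m * W ^ 2 / i₀ * r₁ ^ 2 + m / i₀ * r₃ ^ 2 + 2 * m * W ^ 2 / i₀ * r₃ ^ 2 +
      m / i₀ * r₁ ^ 2 := by ring
  have g1 : 0 ≤ 2 * m * W ^ 2 / i₀ * r₃ ^ 2 := by positivity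
  have g2 : 0 ≤ m / i₀ * r₁ ^ 2 := by positivity
  have g3 := sq_nonneg r₁
  rw [h9, h10]
  linarith

theorem modeRem_eq {m : ℝ} (hm : 0 < m) (β τ N V Γ : ℝ) :
    modeRem m β τ N V Γ = (1 + τ ^ 2)⁻¹ *
      ((-(2 * (τ * (1 + τ ^ 2)⁻¹)) * (β / m) - 8 * (τ * (1 + τ ^ 2)⁻¹ * (1 + τ ^ 2)⁻¹)) * N ^ 2 +
        (1 + τ ^ 2)⁻¹ * (2 - 3 * (1 + τ ^ 2)⁻¹) * (N * V) + 4 * (1 + τ ^ 2)⁻¹ * (V * Γ) -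
        2 * (τ * (1 + τ ^ 2)⁻¹) * (1 + τ ^ 2)⁻¹ * (N * Γ)) := by
  have hz : 0 < 1 + τ ^ 2 := by positivity
  unfold modeRem
  field_simp
  ring

theorem modeErr_eq {m : ℝ} (hm : 0 < m) (β k τ N V r₁ r₃ : ℝ) :
    modeErr m β k τ N V r₁ r₃ = 2 * (1 + τ ^ 2)⁻¹ * (V * r₃) +
      2 * (k ^ 2 / m + β / m * (1 + τ ^ 2)⁻¹ + 2 * (1 + τ ^ 2)⁻¹ ^ 2) * (N * r₁) -
      τ * (1 + τ ^ 2)⁻¹ * (1 + τ ^ 2)⁻¹ * (r₁ * V + N * r₃) := by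
  have hz : 0 < 1 + τ ^ 2 := by positivity
  unfold modeErr
  field_simp

/-- The factor `(1+τ²)⁻¹` is integrable over the whole line, which is what makes the final bound
uniform in time. In the constant, `β + 6m` serves `N²` against `N²/m`, and `6` serves `V²` and `Γ²`.
-/
theorem modeRem_le {m β k : ℝ} (hm : 0 < m) (hβ : 0 ≤ β) (hk : 1 ≤ k ^ 2) (τ N V Γ : ℝ) :
    modeRem m β τ N V Γ ≤
      (β + 6 * m + 6) * (1 + τ ^ 2)⁻¹ * (modeForm m β k τ N V + Γ ^ 2) := by
  have hlow := modeForm_lower' hm hβ hk τ N V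
  obtain ⟨hi0, hi1⟩ := inv_one_add_sq_mem τ
  have hb : 0 ≤ β / m := by positivity
  have hbr := rem_bracket_le hi0 hi1 (abs_le_half_of_sq_eq (sq_mul_inv_one_add_sq τ)) hb N V Γ
  rw [modeRem_eq hm]
  generalize (1 + τ ^ 2)⁻¹ = i at *
  generalize modeForm m β k τ N V = G at *
  refine (mul_le_mul_of_nonneg_left (hbr.trans ?_) hi0.le).trans
    (le_of_eq (by ring : i * ((β + 6 * m + 6) * (G + Γ ^ 2)) = _))
  have hE : (β + 6 * m + 6) * (V ^ 2 * i / 2 + N ^ 2 / m + Γ ^ 2) ≤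
      (β + 6 * m + 6) * (G + Γ ^ 2) := by
    gcongr
  refine le_trans ?_ hE
  have hF : (β + 6 * m + 6) * (V ^ 2 * i / 2 + N ^ 2 / m + Γ ^ 2) =
      (β / m + 6) * N ^ 2 + 6 * (N ^ 2 / m) + 3 * (V ^ 2 * i) + (β + 6 * m) / 2 * (V ^ 2 * i)
        + (β + 6 * m) * Γ ^ 2 + 6 * Γ ^ 2 := by
    field_simp; ring
  rw [hF]
  have hg1 : 0 ≤ (β + 6 * m) / 2 * (V ^ 2 * i) := by positivity
  have hg2 : 0 ≤ (β + 6 * m) * Γ ^ 2 := by positivity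
  have hg3 : 0 ≤ N ^ 2 / m := by positivity
  linarith [sq_nonneg Γ]

theorem modeErr_le {m β k i₀ : ℝ} (hm : 0 < m) (hβ : 0 ≤ β) (hk : 1 ≤ k ^ 2) (hi₀ : 0 < i₀) :
    ∃ K, 0 ≤ K ∧ ∀ τ N V r₁ r₃ : ℝ, i₀ ≤ (1 + τ ^ 2)⁻¹ →
      modeErr m β k τ N V r₁ r₃ ≤ (1 + τ ^ 2)⁻¹ * modeForm m β k τ N V + K * (r₁ ^ 2 + r₃ ^ 2) := by
  set W := k ^ 2 / m + β / m + 2 with hW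
  refine ⟨4 + 2 * m * W ^ 2 / i₀ + m / i₀, by positivity, fun τ N V r₁ r₃ hi₁ => ?_⟩
  have hlow := modeForm_lower' hm hβ hk τ N V
  obtain ⟨hi0, hi1⟩ := inv_one_add_sq_mem τ
  have hσ := abs_le_half_of_sq_eq (sq_mul_inv_one_add_sq τ)
  rw [modeErr_eq hm]
  generalize modeForm m β k τ N V = G at *
  generalize τ * (1 + τ ^ 2)⁻¹ = σ at *
  generalize (1 + τ ^ 2)⁻¹ = i at *
  have hωpos : 0 ≤ k ^ 2 / m + β / m * i + 2 * i ^ 2 := by positivity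
  have hωW : k ^ 2 / m + β / m * i + 2 * i ^ 2 ≤ W := by
    have h1 : β / m * i ≤ β / m := mul_le_of_le_one_right (by positivity) hi1
    have h2 : i ^ 2 ≤ 1 := pow_le_one₀ hi0.le hi1
    linarith
  refine (err_le hi0 hi1 hσ hi₀ hm hωpos hωW N V r₁ r₃).trans ?_
  have h6 := mul_le_mul_of_nonneg_left hlow hi0.le
  have h7 : i₀ / m * N ^ 2 ≤ i * (N ^ 2 / m) := by
    rw [div_mul_eq_mul_div, ← mul_div_assoc]; gcongr
  have h9 : i * (V ^ 2 * i / 2 + N ^ 2 / m) = (i * V) ^ 2 / 2 + i * (N ^ 2 / m) := by ring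
  linarith

end ElectronEP

/-! ### The energy inequality with sources -/

namespace ElectronEP

/-- Differentiating the cross term takes `τ/(1+τ²)² V²` from the kinetic part, which grows at twice
that rate, and gives the same relative rate to the potential part. Both then grow at the common rate
`τ/(1+τ²)`. -/
theorem hasDerivAt_modeForm {m β k a t : ℝ} {N V : ℝ → ℝ} {Γ r₁ r₃ : ℝ} (hm : 0 < m)
    (hN : HasDerivAt N (V t + r₁) t)
    (hV : HasDerivAt V (2 * (t - a) / (1 + (t - a) ^ 2) * V t
      - (k ^ 2 * (1 + (t - a) ^ 2) + β) / m * N t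
      + 2 / (1 + (t - a) ^ 2) * (Γ - N t) + r₃) t) :
    HasDerivAt (fun s => modeForm m β k (s - a) (N s) (V s))
      ((t - a) / (1 + (t - a) ^ 2) * modeForm m β k (t - a) (N t) (V t)
        + modeRem m β (t - a) (N t) (V t) Γ + modeErr m β k (t - a) (N t) (V t) r₁ r₃) t := by
  have hτ : HasDerivAt (fun s : ℝ => s - a) 1 t := (hasDerivAt_id t).sub_const a
  have hz : HasDerivAt (fun s : ℝ => 1 + (s - a) ^ 2) (2 * (t - a)) t := by
    simpa using (hτ.pow 2).const_add 1
  have hz0 : 1 + (t - a) ^ 2 ≠ 0 := by positivity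
  have h1 := (hV.pow 2).div hz hz0
  have h2 := ((((((hz.const_mul (k ^ 2)).add_const β).div_const m).add
    ((hasDerivAt_const t (2 : ℝ)).div hz hz0)).div hz hz0).mul (hN.pow 2))
  have h3 := (hτ.div (hz.pow 2) (pow_ne_zero 2 hz0)).mul (hN.mul hV)
  have h := (h1.add h2).sub h3
  refine h.congr_deriv ?_
  simp only [Pi.add_apply, Pi.pow_apply, Pi.div_apply, Pi.mul_apply]
  generalize V t = v
  generalize N t = n
  generalize t - a = τ at *
  unfold modeForm modeRem modeErr
  field_simp
  ring

/-- The energy of a mode `k ≠ 0`. -/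
noncomputable def modeEnergy (m β k τ N V Γ : ℝ) : ℝ :=
  modeForm m β k τ N V / Real.sqrt (1 + τ ^ 2) + Γ ^ 2

theorem modeForm_nonneg {m β k : ℝ} (hm : 0 < m) (hβ : 0 ≤ β) (τ N V : ℝ) :
    0 ≤ modeForm m β k τ N V :=
  le_trans (by positivity) (modeForm_lower hm hβ τ N V)

theorem le_add_integral_of_hasDerivAt {F F' φ : ℝ → ℝ} {T : ℝ} (hT : 0 ≤ T)
    (hF : ContinuousOn F (Set.Icc 0 T)) (hd : ∀ t ∈ Set.Ioo 0 T, HasDerivAt F (F' t) t)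
    (hφ : ContinuousOn φ (Set.Icc 0 T)) (hle : ∀ t ∈ Set.Ioo 0 T, F' t ≤ φ t) :
    F T ≤ F 0 + ∫ t in (0 : ℝ)..T, φ t := by
  have := intervalIntegral.sub_le_integral_of_hasDeriv_right_of_le hT hF
    (fun t ht => (hd t ht).hasDerivWithinAt) hφ.integrableOn_Icc hle
  linarith

/-- The logarithmic derivative of `√(1+τ²)` is `τ/(1+τ²)`, so the division removes the leading
growth of the form and leaves only remainders. -/
theorem hasDerivAt_modeEnergy {m β k a t : ℝ} {N V Γ : ℝ → ℝ} {r₁ r₂ r₃ : ℝ} (hm : 0 < m)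
    (hN : HasDerivAt N (V t + r₁) t) (hΓ : HasDerivAt Γ r₂ t)
    (hV : HasDerivAt V (2 * (t - a) / (1 + (t - a) ^ 2) * V t
      - (k ^ 2 * (1 + (t - a) ^ 2) + β) / m * N t
      + 2 / (1 + (t - a) ^ 2) * (Γ t - N t) + r₃) t) :
    HasDerivAt (fun s => modeEnergy m β k (s - a) (N s) (V s) (Γ s))
      ((modeRem m β (t - a) (N t) (V t) (Γ t) + modeErr m β k (t - a) (N t) (V t) r₁ r₃) /
        Real.sqrt (1 + (t - a) ^ 2) + 2 * (Γ t * r₂)) t := by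
  have hτ : HasDerivAt (fun s : ℝ => s - a) 1 t := (hasDerivAt_id t).sub_const a
  have hz : HasDerivAt (fun s : ℝ => 1 + (s - a) ^ 2) (2 * (t - a)) t := by
    simpa using (hτ.pow 2).const_add 1
  have hz0 : 0 < 1 + (t - a) ^ 2 := by positivity
  have hs0 : 0 < Real.sqrt (1 + (t - a) ^ 2) := Real.sqrt_pos.2 hz0
  have hss : Real.sqrt (1 + (t - a) ^ 2) ^ 2 = 1 + (t - a) ^ 2 := Real.sq_sqrt hz0.le
  refine (((hasDerivAt_modeForm hm hN hV).div (hz.sqrt hz0.ne') hs0.ne').add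
    (hΓ.pow 2)).congr_deriv ?_
  simp only [Nat.cast_ofNat, Nat.add_one_sub_one, pow_one]
  generalize modeForm m β k (t - a) (N t) (V t) = G
  generalize modeRem m β (t - a) (N t) (V t) (Γ t) = A
  generalize modeErr m β k (t - a) (N t) (V t) r₁ r₃ = B
  generalize Real.sqrt (1 + (t - a) ^ 2) = s at *
  rw [← hss]
  field_simp
  ring

/-- The constant rises from `6` to `7` to absorb what Young's inequality leaves over from the
sources: `i` times the form, and `i₀Γ²` from the product `2Γr₂`. -/
theorem modeEnergy_deriv_le {m β k i₀ : ℝ} (hm : 0 < m) (hβ : 0 ≤ β) (hk : 1 ≤ k ^ 2)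
    (hi₀ : 0 < i₀) : ∃ K, 0 ≤ K ∧ ∀ τ N V Γ r₁ r₂ r₃ : ℝ, i₀ ≤ (1 + τ ^ 2)⁻¹ →
      (modeRem m β τ N V Γ + modeErr m β k τ N V r₁ r₃) / Real.sqrt (1 + τ ^ 2) + 2 * (Γ * r₂) ≤
        (β + 6 * m + 7) * (1 + τ ^ 2)⁻¹ * modeEnergy m β k τ N V Γ +
          K * (r₁ ^ 2 + r₂ ^ 2 + r₃ ^ 2) := by
  obtain ⟨K, hK0, hK⟩ := modeErr_le hm hβ hk hi₀
  refine ⟨K + 1 / i₀, by positivity, fun τ N V Γ r₁ r₂ r₃ hi => ?_⟩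
  have hR := modeRem_le hm hβ hk τ N V Γ
  have hE := hK τ N V r₁ r₃ hi
  have hG := modeForm_nonneg (k := k) hm hβ τ N V
  have hs1 : 1 ≤ Real.sqrt (1 + τ ^ 2) := Real.one_le_sqrt.2 (by nlinarith [sq_nonneg τ])
  have hi0 : 0 < (1 + τ ^ 2)⁻¹ := by positivity
  unfold modeEnergy
  generalize Real.sqrt (1 + τ ^ 2) = s at *
  generalize (1 + τ ^ 2)⁻¹ = i at *
  generalize modeForm m β k τ N V = G at *
  have hs0 : 0 < s := by linarith
  have h1 : (modeRem m β τ N V Γ + modeErr m β k τ N V r₁ r₃) / s ≤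
      ((β + 6 * m + 6) * i * (G + Γ ^ 2) + (i * G + K * (r₁ ^ 2 + r₃ ^ 2))) / s := by
    gcongr
  have h2 : ((β + 6 * m + 6) * i * (G + Γ ^ 2) + (i * G + K * (r₁ ^ 2 + r₃ ^ 2))) / s =
      (β + 6 * m + 7) * i * (G / s) + (β + 6 * m + 6) * i * Γ ^ 2 / s +
        K * (r₁ ^ 2 + r₃ ^ 2) / s := by
    field_simp; ring
  have h3 : (β + 6 * m + 6) * i * Γ ^ 2 / s ≤ (β + 6 * m + 6) * i * Γ ^ 2 :=
    div_le_self (by positivity) hs1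
  have h4 : K * (r₁ ^ 2 + r₃ ^ 2) / s ≤ K * (r₁ ^ 2 + r₃ ^ 2) := div_le_self (by positivity) hs1
  have h5 : 2 * (Γ * r₂) ≤ i₀ * Γ ^ 2 + 1 / i₀ * r₂ ^ 2 := by
    have : i₀ * Γ ^ 2 + 1 / i₀ * r₂ ^ 2 - 2 * (Γ * r₂) = (i₀ * Γ - r₂) ^ 2 / i₀ := by
      field_simp; ring
    have h : 0 ≤ (i₀ * Γ - r₂) ^ 2 / i₀ := by positivity
    linarith
  have h6 : i₀ * Γ ^ 2 ≤ i * Γ ^ 2 := by gcongr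
  have h7 : 0 ≤ K * r₂ ^ 2 := by positivity
  have h8 : 0 ≤ 1 / i₀ * (r₁ ^ 2 + r₃ ^ 2) := by positivity
  have h9 : (β + 6 * m + 7) * i * (G / s + Γ ^ 2) + (K + 1 / i₀) * (r₁ ^ 2 + r₂ ^ 2 + r₃ ^ 2) =
      (β + 6 * m + 7) * i * (G / s) + (β + 6 * m + 6) * i * Γ ^ 2 + i * Γ ^ 2 +
      K * (r₁ ^ 2 + r₃ ^ 2) + K * r₂ ^ 2 + 1 / i₀ * r₂ ^ 2 + 1 / i₀ * (r₁ ^ 2 + r₃ ^ 2) := by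
    ring
  rw [h9]
  linarith

theorem continuous_modeEnergy (m β k : ℝ) :
    Continuous fun p : ℝ × ℝ × ℝ × ℝ => modeEnergy m β k p.1 p.2.1 p.2.2.1 p.2.2.2 := by
  unfold modeEnergy modeForm
  have h1 : ∀ p : ℝ × ℝ × ℝ × ℝ, 1 + p.1 ^ 2 ≠ 0 := fun p => by positivity
  have h2 : ∀ p : ℝ × ℝ × ℝ × ℝ, (1 + p.1 ^ 2) ^ 2 ≠ 0 := fun p => by positivity
  have h3 : ∀ p : ℝ × ℝ × ℝ × ℝ, Real.sqrt (1 + p.1 ^ 2) ≠ 0 := fun p => by positivity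
  fun_prop (disch := assumption)

theorem continuousOn_modeEnergy (m β k a : ℝ) {N V Γ : ℝ → ℝ} {s : Set ℝ}
    (hN : ContinuousOn N s) (hV : ContinuousOn V s) (hΓ : ContinuousOn Γ s) :
    ContinuousOn (fun t => modeEnergy m β k (t - a) (N t) (V t) (Γ t)) s :=
  (continuous_modeEnergy m β k).comp_continuousOn (f := fun t => (t - a, N t, V t, Γ t))
    ((continuous_sub_right a).continuousOn.prodMk (hN.prodMk (hV.prodMk hΓ)))

/-- Energy estimate with source terms for a mode `k ≠ 0`. -/
theorem modeEnergy_le {m β k : ℝ} (hm : 0 < m) (hβ : 0 ≤ β) (hk : 1 ≤ k ^ 2) (ξ : ℝ) {T : ℝ}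
    (hT : 0 ≤ T) : ∃ K, ∀ N V Γ r₁ r₂ r₃ : ℝ → ℝ, IsModeSolution m β k ξ T N V Γ r₁ r₂ r₃ →
      Real.exp (-((β + 6 * m + 7) * Real.arctan (T - ξ / k))) *
          modeEnergy m β k (T - ξ / k) (N T) (V T) (Γ T) ≤
        Real.exp (-((β + 6 * m + 7) * Real.arctan (0 - ξ / k))) *
          modeEnergy m β k (0 - ξ / k) (N 0) (V 0) (Γ 0) +
        K * ∫ t in (0 : ℝ)..T, (r₁ t ^ 2 + r₂ t ^ 2 + r₃ t ^ 2) := by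
  have hk0 : k ≠ 0 := by rintro rfl; norm_num at hk
  set a := ξ / k with ha
  set C := β + 6 * m + 7 with hC
  have hCpos : 0 < C := by positivity
  -- On `[0,T]` the shifted time satisfies `|τ| ≤ T + |a|`. This is how `K` comes to depend on `ξ`
  -- and `T`.
  set i₀ : ℝ := (1 + (T + |a|) ^ 2)⁻¹ with hi₀
  have hi₀pos : 0 < i₀ := by positivity
  obtain ⟨K, hK0, hK⟩ := modeEnergy_deriv_le hm hβ hk hi₀pos
  refine ⟨Real.exp (C * (Real.pi / 2)) * K, fun N V Γ r₁ r₂ r₃ h => ?_⟩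
  have hi : ∀ t ∈ Set.Ioo 0 T, i₀ ≤ (1 + (t - a) ^ 2)⁻¹ := by
    intro t ht
    have h1 : |t - a| ≤ T + |a| := by
      refine (abs_sub t a).trans ?_
      rw [abs_of_pos ht.1]
      linarith [ht.2]
    have h2 : (t - a) ^ 2 ≤ (T + |a|) ^ 2 := sq_le_sq.2 (by rwa [abs_of_nonneg (by positivity : (0 : ℝ) ≤ T + |a|)])
    rw [hi₀]
    gcongr
  have hcont : ContinuousOn (fun t => Real.exp (-(C * Real.arctan (t - a))) *
      modeEnergy m β k (t - a) (N t) (V t) (Γ t)) (Set.Icc 0 T) := by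
    exact ContinuousOn.mul (Continuous.continuousOn (by fun_prop))
      (continuousOn_modeEnergy m β k a h.contN h.contV h.contΓ)
  rw [mul_assoc, ← intervalIntegral.integral_const_mul, ← intervalIntegral.integral_const_mul]
  have hρ : ContinuousOn (fun t => Real.exp (C * (Real.pi / 2)) *
      (K * (r₁ t ^ 2 + r₂ t ^ 2 + r₃ t ^ 2))) (Set.Icc 0 T) :=
    continuousOn_const.mul (continuousOn_const.mul
      (((h.cont₁.pow 2).add (h.cont₂.pow 2)).add (h.cont₃.pow 2)))
  -- The derivative of `exp(-C arctan τ)` supplies `-C(1+τ²)⁻¹` times the energy. It cancels the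
  -- homogeneous part of the differential inequality, so only the sources are integrated.
  refine le_add_integral_of_hasDerivAt hT hcont (F' := fun t =>
    (Real.exp (-(C * Real.arctan (t - a))) * -(C * (1 / (1 + (t - a) ^ 2) * 1))) *
      modeEnergy m β k (t - a) (N t) (V t) (Γ t) + Real.exp (-(C * Real.arctan (t - a))) *
      ((modeRem m β (t - a) (N t) (V t) (Γ t) + modeErr m β k (t - a) (N t) (V t) (r₁ t) (r₃ t)) /
        Real.sqrt (1 + (t - a) ^ 2) + 2 * (Γ t * r₂ t))) (fun t ht => ?_) hρ (fun t ht => ?_)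
  · have hq : ξ - k * t = -(k * (t - a)) := by rw [ha]; field_simp; ring
    have hV := h.derivV t ht
    rw [hq] at hV
    have hp : k ^ 2 + (-(k * (t - a))) ^ 2 = k ^ 2 * (1 + (t - a) ^ 2) := by ring
    rw [hp] at hV
    have hz : 0 < 1 + (t - a) ^ 2 := by positivity
    have e1 : -(2 * k * -(k * (t - a)) / (k ^ 2 * (1 + (t - a) ^ 2))) =
        2 * (t - a) / (1 + (t - a) ^ 2) := by field_simp
    have e2 : 2 * k ^ 2 / (k ^ 2 * (1 + (t - a) ^ 2)) = 2 / (1 + (t - a) ^ 2) := by field_simp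
    rw [e1, e2] at hV
    have hτ : HasDerivAt (fun s : ℝ => s - a) 1 t := (hasDerivAt_id t).sub_const a
    exact ((hτ.arctan.const_mul C).neg.exp).mul
      (hasDerivAt_modeEnergy hm (h.derivN t ht) (h.derivΓ t ht) hV)
  · have h1 := hK (t - a) (N t) (V t) (Γ t) (r₁ t) (r₂ t) (r₃ t) (hi t ht)
    have h2 : Real.exp (-(C * Real.arctan (t - a))) ≤ Real.exp (C * (Real.pi / 2)) := by
      refine Real.exp_le_exp.2 ?_
      have := Real.neg_pi_div_two_lt_arctan (t - a)
      nlinarith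
    have h3 : 0 < Real.exp (-(C * Real.arctan (t - a))) := Real.exp_pos _
    have h4 : 0 ≤ K * (r₁ t ^ 2 + r₂ t ^ 2 + r₃ t ^ 2) := by positivity
    have h5 := mul_le_mul_of_nonneg_left h1 h3.le
    have h6 := mul_le_mul_of_nonneg_right h2 h4
    simp only [one_div, mul_one]
    linarith

/-- Energy estimate with source terms for the mode `k = 0`. -/
theorem zeroModeEnergy_le {m β : ℝ} (hm : 0 < m) (hβ : 0 ≤ β) (ξ : ℝ) {T : ℝ}
    (hT : 0 ≤ T) : ∃ K, ∀ N V Γ r₁ r₂ r₃ : ℝ → ℝ, IsModeSolution m β 0 ξ T N V Γ r₁ r₂ r₃ →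
      Real.exp (-T) * (V T ^ 2 + (ξ ^ 2 + β) / m * N T ^ 2 + Γ T ^ 2) ≤
        (V 0 ^ 2 + (ξ ^ 2 + β) / m * N 0 ^ 2 + Γ 0 ^ 2) +
        K * ∫ t in (0 : ℝ)..T, (r₁ t ^ 2 + r₂ t ^ 2 + r₃ t ^ 2) := by
  set ω := (ξ ^ 2 + β) / m with hω
  have hω0 : 0 ≤ ω := by positivity
  refine ⟨1 + ω, fun N V Γ r₁ r₂ r₃ h => ?_⟩
  have hcont : ContinuousOn (fun t => Real.exp (-t) * (V t ^ 2 + ω * N t ^ 2 + Γ t ^ 2))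
      (Set.Icc 0 T) :=
    ContinuousOn.mul (Continuous.continuousOn (by fun_prop))
      (((h.contV.pow 2).add (continuousOn_const.mul (h.contN.pow 2))).add (h.contΓ.pow 2))
  have hρ : ContinuousOn (fun t => (1 + ω) * (r₁ t ^ 2 + r₂ t ^ 2 + r₃ t ^ 2)) (Set.Icc 0 T) :=
    (continuousOn_const.mul (((h.cont₁.pow 2).add (h.cont₂.pow 2)).add (h.cont₃.pow 2)))
  rw [← intervalIntegral.integral_const_mul]
  -- For `k = 0` the frequency does not move and, without sources, `V² + ωN² + Γ²` is conserved. The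
  -- factor `exp(-t)` absorbs the products of the unknowns with the sources.
  have hmain := le_add_integral_of_hasDerivAt hT hcont (F' := fun t =>
    Real.exp (-t) * -1 * (V t ^ 2 + ω * N t ^ 2 + Γ t ^ 2) + Real.exp (-t) *
      (2 * V t * (-(ω * N t) + r₃ t) + ω * (2 * N t * (V t + r₁ t)) + 2 * Γ t * r₂ t))
    (fun t ht => ?_) hρ (fun t ht => ?_)
  · simpa using hmain
  · have hV : HasDerivAt V (-(ω * N t) + r₃ t) t := by
      refine (h.derivV t ht).congr_deriv ?_
      simp [hω]
    have h1 := (((hV.pow 2).add (((h.derivN t ht).pow 2).const_mul ω)).add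
      ((h.derivΓ t ht).pow 2))
    refine ((hasDerivAt_neg t).exp.mul h1).congr_deriv ?_
    simp only [Nat.cast_ofNat, Nat.add_one_sub_one, pow_one, Pi.add_apply, Pi.pow_apply]
  · have h1 : Real.exp (-t) ≤ 1 := Real.exp_le_one_iff.2 (by linarith [ht.1])
    have h2 : 0 < Real.exp (-t) := Real.exp_pos _
    have h3 : 2 * V t * r₃ t + ω * (2 * N t * r₁ t) + 2 * Γ t * r₂ t -
        (V t ^ 2 + ω * N t ^ 2 + Γ t ^ 2) ≤ (1 + ω) * (r₁ t ^ 2 + r₂ t ^ 2 + r₃ t ^ 2) := by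
      have g1 := mul_nonneg hω0 (sq_nonneg (N t - r₁ t))
      have g2 := mul_nonneg hω0 (sq_nonneg (r₂ t))
      have g3 := mul_nonneg hω0 (sq_nonneg (r₃ t))
      nlinarith [sq_nonneg (V t - r₃ t), sq_nonneg (Γ t - r₂ t), sq_nonneg (r₁ t)]
    have h4 : 0 ≤ (1 + ω) * (r₁ t ^ 2 + r₂ t ^ 2 + r₃ t ^ 2) := by positivity
    have h5 := mul_le_mul_of_nonneg_left h3 h2.le
    have h6 := mul_le_mul_of_nonneg_right h1 h4
    linarith

end ElectronEP

/-! ### Limits of mode solutions with vanishing sources -/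

namespace ElectronEP

open Filter Topology

/-- A sequence of mode solutions with vanishing sources and convergent data at times `0`, `T`. -/
structure IsModeLimit (m β k ξ T : ℝ) (N V Γ r₁ r₂ r₃ : ℕ → ℝ → ℝ) (N₀ V₀ Γ₀ N₁ V₁ Γ₁ : ℝ) :
    Prop where
  sol : ∀ n, IsModeSolution m β k ξ T (N n) (V n) (Γ n) (r₁ n) (r₂ n) (r₃ n)
  source : Tendsto (fun n => ∫ t in (0 : ℝ)..T, (r₁ n t ^ 2 + r₂ n t ^ 2 + r₃ n t ^ 2))
    atTop (𝓝 0)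
  tendN₀ : Tendsto (fun n => N n 0) atTop (𝓝 N₀)
  tendV₀ : Tendsto (fun n => V n 0) atTop (𝓝 V₀)
  tendΓ₀ : Tendsto (fun n => Γ n 0) atTop (𝓝 Γ₀)
  tendN₁ : Tendsto (fun n => N n T) atTop (𝓝 N₁)
  tendV₁ : Tendsto (fun n => V n T) atTop (𝓝 V₁)
  tendΓ₁ : Tendsto (fun n => Γ n T) atTop (𝓝 Γ₁)

variable {m β k ξ T : ℝ} {N V Γ r₁ r₂ r₃ : ℕ → ℝ → ℝ} {N₀ V₀ Γ₀ N₁ V₁ Γ₁ : ℝ}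

theorem tendsto_modeEnergy (m β k τ : ℝ) {N V Γ : ℕ → ℝ} {N₀ V₀ Γ₀ : ℝ}
    (hN : Tendsto N atTop (𝓝 N₀)) (hV : Tendsto V atTop (𝓝 V₀)) (hΓ : Tendsto Γ atTop (𝓝 Γ₀)) :
    Tendsto (fun n => modeEnergy m β k τ (N n) (V n) (Γ n)) atTop
      (𝓝 (modeEnergy m β k τ N₀ V₀ Γ₀)) :=
  ((continuous_modeEnergy m β k).tendsto (τ, N₀, V₀, Γ₀)).comp
    (f := fun n => (τ, N n, V n, Γ n))
    (tendsto_const_nhds.prodMk_nhds (hN.prodMk_nhds (hV.prodMk_nhds hΓ)))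

theorem IsModeLimit.modeEnergy_le (h : IsModeLimit m β k ξ T N V Γ r₁ r₂ r₃ N₀ V₀ Γ₀ N₁ V₁ Γ₁)
    (hm : 0 < m) (hβ : 0 ≤ β) (hk : 1 ≤ k ^ 2) (hT : 0 ≤ T) :
    Real.exp (-((β + 6 * m + 7) * Real.arctan (T - ξ / k))) *
        modeEnergy m β k (T - ξ / k) N₁ V₁ Γ₁ ≤
      Real.exp (-((β + 6 * m + 7) * Real.arctan (0 - ξ / k))) *
        modeEnergy m β k (0 - ξ / k) N₀ V₀ Γ₀ := by
  obtain ⟨K, hK⟩ := ElectronEP.modeEnergy_le hm hβ hk ξ hT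
  have h1 := tendsto_modeEnergy m β k (T - ξ / k) h.tendN₁ h.tendV₁ h.tendΓ₁
  have h0 := tendsto_modeEnergy m β k (0 - ξ / k) h.tendN₀ h.tendV₀ h.tendΓ₀
  have h2 := (h0.const_mul (Real.exp (-((β + 6 * m + 7) * Real.arctan (0 - ξ / k))))).add
    (h.source.const_mul K)
  rw [mul_zero, add_zero] at h2
  exact le_of_tendsto_of_tendsto' (h1.const_mul _) h2 fun n => hK _ _ _ _ _ _ (h.sol n)

/-- Since `β > 0`, the coefficient of `N²` in the conserved energy is positive even at `ξ = 0`, so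
zero energy forces all three components to vanish. -/
theorem IsModeLimit.zero_of_zero (h : IsModeLimit m β 0 ξ T N V Γ r₁ r₂ r₃ 0 0 0 N₁ V₁ Γ₁)
    (hm : 0 < m) (hβ : 0 < β) (hT : 0 ≤ T) : N₁ = 0 ∧ V₁ = 0 ∧ Γ₁ = 0 := by
  obtain ⟨K, hK⟩ := zeroModeEnergy_le hm hβ.le ξ hT
  have h1 := ((h.tendV₁.pow 2).add ((h.tendN₁.pow 2).const_mul ((ξ ^ 2 + β) / m))).add
    (h.tendΓ₁.pow 2)
  have h0 := ((h.tendV₀.pow 2).add ((h.tendN₀.pow 2).const_mul ((ξ ^ 2 + β) / m))).add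
    (h.tendΓ₀.pow 2)
  have h3 := le_of_tendsto_of_tendsto' (h1.const_mul (Real.exp (-T)))
    (h0.add (h.source.const_mul K)) fun n => hK _ _ _ _ _ _ (h.sol n)
  have h4 : V₁ ^ 2 + (ξ ^ 2 + β) / m * N₁ ^ 2 + Γ₁ ^ 2 ≤ 0 := by
    have h5 := Real.exp_pos (-T)
    by_contra hlt
    have h6 := mul_pos h5 (not_le.1 hlt)
    norm_num at h3
    linarith
  have hω : 0 < (ξ ^ 2 + β) / m := by positivity
  have g1 := mul_nonneg hω.le (sq_nonneg N₁)
  have g2 := sq_nonneg V₁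
  have g3 := sq_nonneg Γ₁
  refine ⟨?_, ?_, ?_⟩
  · have : (ξ ^ 2 + β) / m * N₁ ^ 2 = 0 := by linarith
    simpa [hω.ne'] using this
  · have : V₁ ^ 2 = 0 := by linarith
    simpa using this
  · have : Γ₁ ^ 2 = 0 := by linarith
    simpa using this

/-- The sources are known to vanish only through the integral of their squares. Hence `cr₂ ≤ d +
r₂²/d` is used: the second term disappears in the limit for fixed `d`, and `d = δ/(T+1)` keeps the
first below `δ` after integration. -/
theorem IsModeLimit.le_of_sign (h : IsModeLimit m β k ξ T N V Γ r₁ r₂ r₃ N₀ V₀ Γ₀ N₁ V₁ Γ₁)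
    (hT : 0 ≤ T) {c : ℝ} (hc : c ^ 2 = 1) : c * Γ₁ ≤ c * Γ₀ := by
  refine le_of_forall_pos_le_add fun δ hδ => ?_
  have hδ' : 0 < δ / (T + 1) := by positivity
  set d := δ / (T + 1) with hd
  have key : ∀ n, c * Γ n T ≤ c * Γ n 0 +
      (d * T + 1 / d * ∫ t in (0 : ℝ)..T, (r₁ n t ^ 2 + r₂ n t ^ 2 + r₃ n t ^ 2)) := by
    intro n
    have hs := h.sol n
    have hρ : ContinuousOn (fun t => (r₁ n t ^ 2 + r₂ n t ^ 2 + r₃ n t ^ 2)) (Set.Icc 0 T) :=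
      ((hs.cont₁.pow 2).add (hs.cont₂.pow 2)).add (hs.cont₃.pow 2)
    have h1 := le_add_integral_of_hasDerivAt (F := fun t => c * Γ n t)
      (φ := fun t => d + 1 / d * (r₁ n t ^ 2 + r₂ n t ^ 2 + r₃ n t ^ 2)) hT
      (continuousOn_const.mul hs.contΓ)
      (fun t ht => (hs.derivΓ t ht).const_mul c)
      ((continuousOn_const (c := d)).add ((continuousOn_const (c := 1 / d)).mul hρ))
      (fun t ht => by
        have : d + 1 / d * r₂ n t ^ 2 - c * r₂ n t =
            ((2 * d - c * r₂ n t) ^ 2 + (4 - c ^ 2) * r₂ n t ^ 2) / (4 * d) := by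
          field_simp; ring
        have h2 : 0 ≤ ((2 * d - c * r₂ n t) ^ 2 + (4 - c ^ 2) * r₂ n t ^ 2) / (4 * d) := by
          rw [hc]; positivity
        have h3 : 0 ≤ 1 / d * (r₁ n t ^ 2 + r₃ n t ^ 2) := by positivity
        have h4 : 1 / d * (r₁ n t ^ 2 + r₂ n t ^ 2 + r₃ n t ^ 2) =
          1 / d * (r₁ n t ^ 2 + r₃ n t ^ 2) + 1 / d * r₂ n t ^ 2 := by ring
        rw [h4]
        linarith)
    have hI : IntervalIntegrable
        (fun t => 1 / d * (r₁ n t ^ 2 + r₂ n t ^ 2 + r₃ n t ^ 2)) volume 0 T :=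
      ContinuousOn.intervalIntegrable_of_Icc hT (continuousOn_const.mul hρ)
    rw [intervalIntegral.integral_add intervalIntegrable_const hI,
      intervalIntegral.integral_const_mul, intervalIntegral.integral_const, sub_zero,
      smul_eq_mul, mul_comm T] at h1
    exact h1
  have h1 := le_of_tendsto_of_tendsto' (h.tendΓ₁.const_mul c)
    ((h.tendΓ₀.const_mul c).add ((h.source.const_mul (1 / d)).const_add (d * T))) key
  have h2 : d * T ≤ δ := by
    rw [hd, div_mul_eq_mul_div, div_le_iff₀ (by positivity)]
    nlinarith
  linarith

theorem IsModeLimit.eq_of_limit (h : IsModeLimit m β k ξ T N V Γ r₁ r₂ r₃ N₀ V₀ Γ₀ N₁ V₁ Γ₁)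
    (hT : 0 ≤ T) : Γ₁ = Γ₀ := by
  have h1 := h.le_of_sign hT (c := 1) (by norm_num)
  have h2 := h.le_of_sign hT (c := -1) (by norm_num)
  linarith

/-- The growth estimate for a mode `k ≠ 0`. -/
theorem exists_mode_bound (hm : 0 < m) (hβ : 0 ≤ β) : ∃ C : ℝ, 0 ≤ C ∧
    ∀ {k ξ T : ℝ} {N V Γ r₁ r₂ r₃ : ℕ → ℝ → ℝ} {N₀ V₀ Γ₀ N₁ V₁ Γ₁ : ℝ}, 1 ≤ k ^ 2 → 0 ≤ T →
      IsModeLimit m β k ξ T N V Γ r₁ r₂ r₃ N₀ V₀ Γ₀ N₁ V₁ Γ₁ →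
      N₁ ^ 2 + V₁ ^ 2 / (k ^ 2 * (1 + (T - ξ / k) ^ 2)) ≤
        C * (Real.sqrt (1 + (T - ξ / k) ^ 2) / Real.sqrt (1 + (ξ / k) ^ 2) *
          (N₀ ^ 2 + V₀ ^ 2 / (k ^ 2 * (1 + (ξ / k) ^ 2)) +
            Real.sqrt (1 + (ξ / k) ^ 2) / k ^ 2 * Γ₀ ^ 2)) := by
  set c := β + 6 * m + 7 with hc
  have hc0 : 0 < c := by positivity
  set A := (1 + β) / m + 5 / 2 with hA
  -- `m + 2` comes from the lower bound of the form, `exp(cπ)` from the total variation `π` of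
  -- `arctan`, and `A` from the upper bound of the form by `V²/z + k²N²`, where `1 ≤ k²` is used.
  refine ⟨(m + 2) * (Real.exp (c * Real.pi) * A), by positivity, ?_⟩
  intro k ξ T N V Γ r₁ r₂ r₃ N₀ V₀ Γ₀ N₁ V₁ Γ₁ hk hT h
  have h1 := h.modeEnergy_le hm hβ hk hT
  rw [zero_sub, ← hc] at h1
  have hG1 := modeForm_lower (k := k) hm hβ (T - ξ / k) N₁ V₁
  have hG0 := modeForm_upper (k := k) hm hβ (-(ξ / k)) N₀ V₀
  have ha1 := (Real.arctan_lt_pi_div_two (T - ξ / k)).le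
  have ha0 := (Real.neg_pi_div_two_lt_arctan (-(ξ / k))).le
  unfold modeEnergy at h1
  rw [neg_sq] at h1 hG0
  have hz1 : 0 < 1 + (T - ξ / k) ^ 2 := by positivity
  have hz0 : 0 < 1 + (ξ / k) ^ 2 := by positivity
  have hs1 := Real.sqrt_pos.2 hz1
  have hs0 := Real.sqrt_pos.2 hz0
  generalize modeForm m β k (T - ξ / k) N₁ V₁ = G₁ at *
  generalize modeForm m β k (-(ξ / k)) N₀ V₀ = G₀ at *
  generalize Real.arctan (T - ξ / k) = a₁ at *
  generalize Real.arctan (-(ξ / k)) = a₀ at *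
  generalize Real.sqrt (1 + (T - ξ / k) ^ 2) = s₁ at *
  generalize Real.sqrt (1 + (ξ / k) ^ 2) = s₀ at *
  generalize 1 + (T - ξ / k) ^ 2 = z₁ at *
  generalize 1 + (ξ / k) ^ 2 = z₀ at *
  have hk0 : 0 < k ^ 2 := by linarith
  have hG1' : 0 ≤ G₁ := le_trans (by positivity) hG1
  have hA1 : 5 / 2 ≤ A := by
    have : 0 ≤ (1 + β) / m := by positivity
    rw [hA]; linarith
  have hG0' : G₀ ≤ A * (V₀ ^ 2 / z₀ + k ^ 2 * N₀ ^ 2) := by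
    refine hG0.trans ?_
    have g1 : (k ^ 2 + β) / m + 5 / 2 ≤ A * k ^ 2 := by
      have : k ^ 2 + β ≤ (1 + β) * k ^ 2 := by nlinarith
      have : (k ^ 2 + β) / m ≤ (1 + β) * k ^ 2 / m := by gcongr
      have e : A * k ^ 2 = (1 + β) * k ^ 2 / m + 5 / 2 * k ^ 2 := by rw [hA]; ring
      rw [e]; linarith
    have g2 := mul_le_mul_of_nonneg_right g1 (sq_nonneg N₀)
    have g3 : 0 ≤ V₀ ^ 2 / z₀ := by positivity
    have g4 := mul_le_mul_of_nonneg_right (by linarith : 3 / 2 ≤ A) g3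
    linarith
  have hmain : G₁ ≤ Real.exp (c * Real.pi) * A * (s₁ / s₀) *
      (V₀ ^ 2 / z₀ + k ^ 2 * N₀ ^ 2 + s₀ * Γ₀ ^ 2) := by
    have g0 : G₀ / s₀ + Γ₀ ^ 2 ≤ A * (V₀ ^ 2 / z₀ + k ^ 2 * N₀ ^ 2 + s₀ * Γ₀ ^ 2) / s₀ := by
      rw [le_div_iff₀ hs0, add_mul, div_mul_cancel₀ _ hs0.ne']
      have : 0 ≤ s₀ * Γ₀ ^ 2 := by positivity
      nlinarith
    have g1 : Real.exp (-(c * (Real.pi / 2))) * (G₁ / s₁) ≤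
        Real.exp (c * (Real.pi / 2)) * (G₀ / s₀ + Γ₀ ^ 2) := by
      have e1 : Real.exp (-(c * (Real.pi / 2))) ≤ Real.exp (-(c * a₁)) := by
        gcongr
      have e0 : Real.exp (-(c * a₀)) ≤ Real.exp (c * (Real.pi / 2)) := by
        rw [← mul_neg]
        gcongr
        linarith
      have p1 : 0 ≤ G₁ / s₁ := by positivity
      have p2 : 0 ≤ Real.exp (-(c * a₁)) * (G₁ / s₁ + Γ₁ ^ 2) := by positivity
      -- The initial energy is nonnegative because the energy inequality `h1` bounds a nonnegative
      -- quantity by a positive multiple of it.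
      have p0 : 0 ≤ G₀ / s₀ + Γ₀ ^ 2 := by
        by_contra hlt
        have := mul_neg_of_pos_of_neg (Real.exp_pos (-(c * a₀))) (not_le.1 hlt)
        linarith
      calc _ ≤ Real.exp (-(c * a₁)) * (G₁ / s₁ + Γ₁ ^ 2) :=
            mul_le_mul e1 (by nlinarith [sq_nonneg Γ₁]) p1 (Real.exp_pos _).le
        _ ≤ _ := h1
        _ ≤ _ := mul_le_mul_of_nonneg_right e0 p0
    have g2 : Real.exp (c * Real.pi) * Real.exp (-(c * (Real.pi / 2))) =
        Real.exp (c * (Real.pi / 2)) := by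
      rw [← Real.exp_add]; congr 1; ring
    have g3 : Real.exp (-(c * (Real.pi / 2))) * Real.exp (c * (Real.pi / 2)) = 1 := by
      rw [← Real.exp_add]; simp
    have g4 := mul_le_mul_of_nonneg_left (g1.trans (mul_le_mul_of_nonneg_left g0
      (Real.exp_pos (c * (Real.pi / 2))).le)) (Real.exp_pos (c * (Real.pi / 2))).le
    have g5 : Real.exp (c * (Real.pi / 2)) * Real.exp (c * (Real.pi / 2)) =
        Real.exp (c * Real.pi) := by
      rw [← Real.exp_add]; congr 1; ring
    rw [← mul_assoc, mul_comm (Real.exp (c * (Real.pi / 2))) (Real.exp (-(c * (Real.pi / 2)))),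
      g3, one_mul, ← mul_assoc, g5, div_le_iff₀ hs1] at g4
    refine g4.trans (le_of_eq ?_)
    field_simp
  have hl : k ^ 2 * N₁ ^ 2 + V₁ ^ 2 / z₁ ≤ (m + 2) * G₁ := by
    have e : (m + 2) * (V₁ ^ 2 / (2 * z₁) + k ^ 2 / m * N₁ ^ 2) = k ^ 2 * N₁ ^ 2 + V₁ ^ 2 / z₁ +
        (m * (V₁ ^ 2 / (2 * z₁)) + 2 * (k ^ 2 / m * N₁ ^ 2)) := by field_simp; ring
    have p : 0 ≤ m * (V₁ ^ 2 / (2 * z₁)) + 2 * (k ^ 2 / m * N₁ ^ 2) := by positivity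
    have := mul_le_mul_of_nonneg_left hG1 (by positivity : 0 ≤ m + 2)
    linarith
  have e1 : N₁ ^ 2 + V₁ ^ 2 / (k ^ 2 * z₁) = (k ^ 2 * N₁ ^ 2 + V₁ ^ 2 / z₁) / k ^ 2 := by
    have hk' : k ≠ 0 := by rintro rfl; simp at hk0
    field_simp
  rw [e1, div_le_iff₀ hk0]
  refine hl.trans ((mul_le_mul_of_nonneg_left hmain (by positivity)).trans (le_of_eq ?_))
  have hk' : k ≠ 0 := by rintro rfl; simp at hk0
  field_simp
  ring

end ElectronEP

/-! ### Cutoffs at scale `n + 1` and their convergence -/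

namespace ElectronEP

open scoped ContDiff
open Filter Topology

/-- A smooth bump function equal to `1` on `[-1,1]` and supported in `[-2,2]`. -/
noncomputable def bump : ContDiffBump (0 : ℝ) := ⟨1, 2, one_pos, one_lt_two⟩

/-- The cutoff at scale `n + 1`. -/
noncomputable def cutoff (n : ℕ) (y : ℝ) : ℝ := bump ((n + 1 : ℝ)⁻¹ * y)

theorem isCutoff_cutoff (n : ℕ) : IsCutoff (2 * (n + 1)) (cutoff n) := by
  refine ⟨bump.contDiff.comp (by fun_prop), fun y hy => bump.zero_of_le_dist ?_⟩
  have hn : (0 : ℝ) < n + 1 := by positivity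
  rw [dist_zero_right, norm_mul, norm_inv, Real.norm_of_nonneg hn.le, Real.norm_eq_abs,
    inv_mul_eq_div, le_div_iff₀ hn]
  exact hy.le

theorem abs_cutoff_le_one (n : ℕ) (y : ℝ) : |cutoff n y| ≤ 1 :=
  abs_le.2 ⟨neg_one_lt_zero.le.trans bump.nonneg, bump.le_one⟩

theorem tendsto_cutoff (y : ℝ) : Tendsto (fun n => cutoff n y) atTop (𝓝 1) := by
  have h1 : Tendsto (fun n : ℕ => (n + 1 : ℝ)⁻¹ * y) atTop (𝓝 (0 * y)) := by
    have := tendsto_one_div_add_atTop_nhds_zero_nat (𝕜 := ℝ)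
    simp only [one_div] at this
    exact this.mul_const y
  rw [zero_mul] at h1
  have h2 := (bump.continuous.tendsto 0).comp h1
  rwa [bump.one_of_mem_closedBall (by simp [bump])] at h2

theorem deriv_cutoff (n : ℕ) :
    deriv (cutoff n) = fun y => (n + 1 : ℝ)⁻¹ * deriv bump ((n + 1 : ℝ)⁻¹ * y) := by
  ext y
  exact deriv_comp_mul_left _ _ _

theorem deriv_deriv_cutoff (n : ℕ) : deriv (deriv (cutoff n)) = fun y =>
    (n + 1 : ℝ)⁻¹ * ((n + 1 : ℝ)⁻¹ * deriv (deriv bump) ((n + 1 : ℝ)⁻¹ * y)) := by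
  ext y
  rw [deriv_cutoff, deriv_const_mul_field]
  congr 1
  exact deriv_comp_mul_left _ _ _

/-- Each derivative gains a factor `1/(n+1)` by scaling. The second derivative gains two, one of
which is dropped so that both errors share a single rate. -/
theorem exists_deriv_cutoff_bound : ∃ K : ℝ, 0 ≤ K ∧ ∀ n y,
    |deriv (cutoff n) y| ≤ K * (n + 1 : ℝ)⁻¹ ∧ |deriv (deriv (cutoff n)) y| ≤ K * (n + 1 : ℝ)⁻¹ := by
  have hb : ContDiff ℝ ∞ (bump : ℝ → ℝ) := bump.contDiff
  have hd := (contDiff_infty_iff_deriv.1 hb).2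
  have hdd := (contDiff_infty_iff_deriv.1 hd).2
  have hs : HasCompactSupport (bump : ℝ → ℝ) := bump.hasCompactSupport
  obtain ⟨K₁, h1⟩ := hd.continuous.bounded_above_of_compact_support hs.deriv
  obtain ⟨K₂, h2⟩ := hdd.continuous.bounded_above_of_compact_support hs.deriv.deriv
  refine ⟨max K₁ K₂, (norm_nonneg _).trans ((h1 0).trans (le_max_left _ _)), fun n y => ?_⟩
  have hn : (0 : ℝ) < (n + 1 : ℝ)⁻¹ := by positivity
  have hn1 : (n + 1 : ℝ)⁻¹ ≤ 1 := inv_le_one_of_one_le₀ (by norm_cast; omega)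
  have g1 : |deriv bump ((n + 1 : ℝ)⁻¹ * y)| ≤ max K₁ K₂ := (h1 _).trans (le_max_left _ _)
  have g2 : |deriv (deriv bump) ((n + 1 : ℝ)⁻¹ * y)| ≤ max K₁ K₂ := (h2 _).trans (le_max_right _ _)
  have hK : 0 ≤ max K₁ K₂ := (abs_nonneg _).trans g1
  rw [deriv_deriv_cutoff, deriv_cutoff]
  simp only [abs_mul, abs_of_pos hn]
  constructor
  · rw [mul_comm]; gcongr
  · rw [mul_comm]
    gcongr
    exact (mul_le_of_le_one_left (abs_nonneg _) hn1).trans g2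

theorem lintegral_xMode_le_l2Norm {f : ℝ → ℝ → ℝ} (hf : Continuous (Function.uncurry f)) (k : ℤ) :
    (ENNReal.ofReal (2 * Real.pi))⁻¹ * ∫⁻ y, ‖xMode f k y‖ₑ ^ (2 : ℕ) ≤ l2Norm f ^ (2 : ℕ) := by
  rw [l2Norm_sq_eq_tsum_xMode hf]
  exact ENNReal.le_tsum k

theorem lintegral_truncFT_le {R δ : ℝ} {χ : ℝ → ℝ} {f : ℝ → ℝ → ℝ} (hχ : IsCutoff R χ)
    (hδ : ∀ y, |χ y| ≤ δ) (hf : Continuous (Function.uncurry f)) (k : ℤ) (c : ℝ) :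
    ∫⁻ ξ, ‖truncFT χ k (ξ - c) f‖ₑ ^ (2 : ℕ) ≤ ENNReal.ofReal δ ^ (2 : ℕ) * l2Norm f ^ (2 : ℕ) := by
  rw [lintegral_sub_right_eq_self (fun ξ => ‖truncFT χ k ξ f‖ₑ ^ (2 : ℕ)) c,
    lintegral_truncFT hχ hf]
  have h1 : ∫⁻ y, ‖(χ y : ℂ) * xMode f k y‖ₑ ^ (2 : ℕ) ≤
      ENNReal.ofReal δ ^ (2 : ℕ) * ∫⁻ y, ‖xMode f k y‖ₑ ^ (2 : ℕ) := by
    rw [← lintegral_const_mul' _ _ (ENNReal.pow_ne_top ENNReal.ofReal_ne_top)]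
    refine lintegral_mono fun y => ?_
    rw [enorm_mul, mul_pow]
    gcongr
    rw [← ofReal_norm, Complex.norm_real, Real.norm_eq_abs]
    exact ENNReal.ofReal_le_ofReal (hδ y)
  calc _ ≤ (ENNReal.ofReal (2 * Real.pi))⁻¹ * (ENNReal.ofReal δ ^ (2 : ℕ) *
        ∫⁻ y, ‖xMode f k y‖ₑ ^ (2 : ℕ)) := by gcongr
    _ = ENNReal.ofReal δ ^ (2 : ℕ) * ((ENNReal.ofReal (2 * Real.pi))⁻¹ *
        ∫⁻ y, ‖xMode f k y‖ₑ ^ (2 : ℕ)) := by ring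
    _ ≤ _ := by gcongr; exact lintegral_xMode_le_l2Norm hf k

/-- By Plancherel this is the convergence of `(χₙ - 1)` times the mode to `0` in `L²(ℝ)`. Dominated
convergence applies with the majorant `4 |xMode|²`, since `|χₙ - 1| ≤ 2`. -/
theorem tendsto_lintegral_truncFT_sub_ft {f : ℝ → ℝ → ℝ} (hf : Continuous (Function.uncurry f))
    {k : ℤ} (h : MemLp (xMode f k) 2 volume) (c : ℝ) :
    Tendsto (fun n => ∫⁻ ξ, ‖truncFT (cutoff n) k (ξ - c) f - ft f k (ξ - c)‖ₑ ^ (2 : ℕ)) atTop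
      (𝓝 0) := by
  have e : ∀ n, ∫⁻ ξ, ‖truncFT (cutoff n) k (ξ - c) f - ft f k (ξ - c)‖ₑ ^ (2 : ℕ) =
      (ENNReal.ofReal (2 * Real.pi))⁻¹ *
        ∫⁻ y, ‖((cutoff n y : ℂ) - 1) * xMode f k y‖ₑ ^ (2 : ℕ) := fun n => by
    rw [lintegral_sub_right_eq_self (fun ξ => ‖truncFT (cutoff n) k ξ f - ft f k ξ‖ₑ ^ (2 : ℕ)) c,
      lintegral_truncFT_sub_ft (isCutoff_cutoff n) hf h]
  simp only [e]
  rw [← mul_zero (ENNReal.ofReal (2 * Real.pi))⁻¹]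
  refine ENNReal.Tendsto.const_mul ?_ (Or.inr (by simp [Real.pi_pos]))
  have hx := continuous_xMode hf k
  have hfin : ∫⁻ y, ‖xMode f k y‖ₑ ^ (2 : ℕ) ≠ ⊤ := by
    rw [← eLpNorm_two_sq]
    exact ENNReal.pow_ne_top h.2.ne
  have := tendsto_lintegral_of_dominated_convergence (μ := (volume : Measure ℝ))
    (F := fun n y => ‖((cutoff n y : ℂ) - 1) * xMode f k y‖ₑ ^ (2 : ℕ)) (f := fun _ => 0)
    (fun y => 4 * ‖xMode f k y‖ₑ ^ (2 : ℕ))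
    (fun n => by
      have : Continuous fun y => ((cutoff n y : ℂ) - 1) * xMode f k y :=
        ((Complex.continuous_ofReal.comp (isCutoff_cutoff n).smooth.continuous).sub
          continuous_const).mul hx
      exact ((ENNReal.continuous_pow 2).comp this.enorm).measurable)
    (fun n => .of_forall fun y => by
      simp only [enorm_mul, mul_pow]
      gcongr
      have : ‖(cutoff n y : ℂ) - 1‖ₑ ≤ 2 := by
        rw [← ofReal_norm, show (cutoff n y : ℂ) - 1 = ((cutoff n y - 1 : ℝ) : ℂ) by push_cast; rfl,
          Complex.norm_real, Real.norm_eq_abs]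
        refine ENNReal.ofReal_le_of_le_toReal ?_
        have := abs_le.1 (abs_cutoff_le_one n y)
        simp only [ENNReal.toReal_ofNat]
        exact abs_le.2 ⟨by linarith, by linarith⟩
      calc _ ≤ (2 : ℝ≥0∞) ^ 2 := by gcongr
        _ = 4 := by norm_num)
    (by rw [lintegral_const_mul' _ _ (by norm_num)]; exact ENNReal.mul_ne_top (by norm_num) hfin)
    (.of_forall fun y => by
      have h1 : Tendsto (fun n => ((cutoff n y : ℂ) - 1) * xMode f k y) atTop
          (𝓝 (((1 : ℝ) - 1 : ℂ) * xMode f k y)) :=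
        ((Complex.continuous_ofReal.tendsto 1).comp (tendsto_cutoff y) |>.sub_const 1).mul_const _
      have h2 := ((ENNReal.continuous_pow 2).comp continuous_enorm).continuousAt.tendsto.comp h1
      simpa [Function.comp_def, mul_pow] using! h2)
  simpa using this

/-- An `L¹`-null sequence of `ℝ≥0∞`-valued functions has an a.e. null subsequence. -/
theorem exists_subseq_tendsto_zero_ae {α : Type*} [MeasurableSpace α] {μ : Measure α}
    {u : ℕ → α → ℝ≥0∞} (hm : ∀ n, AEMeasurable (u n) μ)
    (hu : Tendsto (fun n => ∫⁻ x, u n x ∂μ) atTop (𝓝 0)) :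
    ∃ ns : ℕ → ℕ, StrictMono ns ∧ ∀ᵐ x ∂μ, Tendsto (fun j => u (ns j) x) atTop (𝓝 0) := by
  -- With integrals below `2⁻ʲ` the sum of the subsequence is integrable, hence finite almost
  -- everywhere, and the terms of a finite sum tend to `0`.
  have h1 : ∀ j : ℕ, ∀ᶠ n in atTop, ∫⁻ x, u n x ∂μ < (2 : ℝ≥0∞)⁻¹ ^ j := fun j =>
    hu.eventually_lt_const (by simp [pos_iff_ne_zero])
  obtain ⟨ns, hns, hlt⟩ := extraction_forall_of_eventually h1
  refine ⟨ns, hns, ?_⟩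
  have h2 : ∫⁻ x, ∑' j, u (ns j) x ∂μ ≠ ⊤ := by
    rw [lintegral_tsum fun j => hm (ns j)]
    refine ne_top_of_le_ne_top ?_ (ENNReal.tsum_le_tsum fun j => (hlt j).le)
    rw [ENNReal.tsum_geometric]
    simp
  filter_upwards [ae_lt_top' (AEMeasurable.tsum fun j => hm (ns j)) h2] with x hx
  exact ENNReal.tendsto_atTop_zero_of_tsum_ne_top hx.ne

end ElectronEP

/-! ### The linearized system for truncated transforms -/

namespace ElectronEP

open scoped ContDiff
open Filter Topology

/-- The truncated Fourier transform of `∇ · u`, up to boundary terms of the cutoff. -/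
noncomputable def truncDiv (χ : ℝ → ℝ) (k : ℤ) (q : ℝ) (ux uy : ℝ → ℝ → ℝ) : ℂ :=
  Complex.I * k * truncFT χ k q ux + Complex.I * q * truncFT χ k q uy

/-- The truncated Fourier transform of `∇^⊥ · u`, up to boundary terms of the cutoff. -/
noncomputable def truncCurl (χ : ℝ → ℝ) (k : ℤ) (q : ℝ) (ux uy : ℝ → ℝ → ℝ) : ℂ :=
  -(Complex.I * q * truncFT χ k q ux) + Complex.I * k * truncFT χ k q uy

theorem map_ofReal_mul (L : ℂ →L[ℝ] ℝ) (c : ℝ) (z : ℂ) : L (c * z) = c * L z := by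
  rw [← Complex.real_smul, L.map_smul, smul_eq_mul]

theorem hasDerivAt_map (L : ℂ →L[ℝ] ℝ) {f : ℝ → ℂ} {f' : ℂ} {t : ℝ} (h : HasDerivAt f f' t) :
    HasDerivAt (fun s => L (f s)) (L f') t :=
  L.hasFDerivAt.comp_hasDerivAt t h

section System

variable {e m R : ℝ} {η ux uy φ : ℝ → ℝ → ℝ → ℝ} {χ : ℝ → ℝ}

theorem hasDerivAt_truncFT_density (hs : IsSmoothSolution e m η ux uy φ) (hχ : IsCutoff R χ)
    (k : ℤ) (ξ : ℝ) {t : ℝ} (ht : 0 < t) :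
    HasDerivAt (fun s : ℝ => truncFT χ k (ξ - k * s) (η s))
      (-truncDiv χ k (ξ - k * t) (ux t) (uy t) + truncFT (deriv χ) k (ξ - k * t) (uy t)) t := by
  refine (hasDerivAt_truncFT hχ hs.density k ξ ht).congr_deriv ?_
  have hx := hs.velocity_x.contDiff ht.le
  have hy := hs.velocity_y.contDiff ht.le
  have h1 : (fun x y => deriv (fun s => η s x y) t + y * dx (η t) x y) =
      fun x y => (-1 : ℝ) * (dx (ux t) x y + dy (uy t) x y) := by
    ext x y
    have := hs.continuity_eq t ht x y
    rw [divergence] at this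
    linarith
  rw [h1, truncFT_const_mul, truncFT_add hχ (contDiff_dx hx).continuous (contDiff_dy hy).continuous,
    truncFT_dx hχ hx (hs.velocity_x.periodic t ht.le), truncFT_dy hχ hy, truncDiv]
  push_cast; ring

theorem hasDerivAt_truncFT_velocity_x (hs : IsSmoothSolution e m η ux uy φ) (hχ : IsCutoff R χ)
    (k : ℤ) (ξ : ℝ) {t : ℝ} (ht : 0 < t) :
    HasDerivAt (fun s : ℝ => truncFT χ k (ξ - k * s) (ux s))
      (-truncFT χ k (ξ - k * t) (uy t) - (m : ℂ)⁻¹ * (Complex.I * k * truncFT χ k (ξ - k * t) (η t))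
        + e / m * (Complex.I * k * truncFT χ k (ξ - k * t) (φ t))) t := by
  refine (hasDerivAt_truncFT hχ hs.velocity_x k ξ ht).congr_deriv ?_
  have hy := hs.velocity_y.contDiff ht.le
  have hη := hs.density.contDiff ht.le
  have hφ := hs.potential.contDiff ht.le
  have h1 : (fun x y => deriv (fun s => ux s x y) t + y * dx (ux t) x y) =
      fun x y => ((-1 : ℝ) * uy t x y + (-m⁻¹) * dx (η t) x y) + (e / m) * dx (φ t) x y := by
    ext x y
    have := hs.momentum_x t ht x y
    rw [one_div] at this
    linarith
  have c1 : Continuous (Function.uncurry fun x y => (-1 : ℝ) * uy t x y) :=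
    continuous_const.mul hy.continuous
  have c2 : Continuous (Function.uncurry fun x y => (-m⁻¹) * dx (η t) x y) :=
    continuous_const.mul (contDiff_dx hη).continuous
  have c3 : Continuous (Function.uncurry fun x y => (e / m) * dx (φ t) x y) :=
    continuous_const.mul (contDiff_dx hφ).continuous
  have c12 : Continuous (Function.uncurry fun x y => (-1 : ℝ) * uy t x y + (-m⁻¹) * dx (η t) x y) :=
    c1.add c2
  rw [h1, truncFT_add hχ c12 c3, truncFT_add hχ c1 c2, truncFT_const_mul, truncFT_const_mul,
    truncFT_const_mul, truncFT_dx hχ hη (hs.density.periodic t ht.le),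
    truncFT_dx hχ hφ (hs.potential.periodic t ht.le)]
  push_cast; ring

theorem hasDerivAt_truncFT_velocity_y (hs : IsSmoothSolution e m η ux uy φ) (hχ : IsCutoff R χ)
    (k : ℤ) (ξ : ℝ) {t : ℝ} (ht : 0 < t) :
    HasDerivAt (fun s : ℝ => truncFT χ k (ξ - k * s) (uy s))
      (-(m : ℂ)⁻¹ * (Complex.I * (ξ - k * t : ℝ) * truncFT χ k (ξ - k * t) (η t)
          - truncFT (deriv χ) k (ξ - k * t) (η t))
        + e / m * (Complex.I * (ξ - k * t : ℝ) * truncFT χ k (ξ - k * t) (φ t)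
          - truncFT (deriv χ) k (ξ - k * t) (φ t))) t := by
  refine (hasDerivAt_truncFT hχ hs.velocity_y k ξ ht).congr_deriv ?_
  have hη := hs.density.contDiff ht.le
  have hφ := hs.potential.contDiff ht.le
  have h1 : (fun x y => deriv (fun s => uy s x y) t + y * dx (uy t) x y) =
      fun x y => (-m⁻¹) * dy (η t) x y + (e / m) * dy (φ t) x y := by
    ext x y
    have := hs.momentum_y t ht x y
    rw [one_div] at this
    linarith
  have c2 : Continuous (Function.uncurry fun x y => (-m⁻¹) * dy (η t) x y) :=
    continuous_const.mul (contDiff_dy hη).continuous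
  have c3 : Continuous (Function.uncurry fun x y => (e / m) * dy (φ t) x y) :=
    continuous_const.mul (contDiff_dy hφ).continuous
  rw [h1, truncFT_add hχ c2 c3, truncFT_const_mul, truncFT_const_mul, truncFT_dy hχ hη,
    truncFT_dy hχ hφ]
  push_cast; ring

theorem truncFT_poisson (hs : IsSmoothSolution e m η ux uy φ) (hχ : IsCutoff R χ)
    (k : ℤ) (q : ℝ) {t : ℝ} (ht : 0 ≤ t) :
    -((k : ℂ) ^ 2 + (q : ℂ) ^ 2) * truncFT χ k q (φ t)
        - 2 * (Complex.I * q * truncFT (deriv χ) k q (φ t)) + truncFT (deriv (deriv χ)) k q (φ t) =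
      4 * Real.pi * e * truncFT χ k q (η t) := by
  have hφ := hs.potential.contDiff ht
  have hper := hs.potential.periodic t ht
  have h1 : (fun x y => dx (dx (φ t)) x y + dy (dy (φ t)) x y) =
      fun x y => (4 * Real.pi * e) * η t x y := by
    ext x y
    exact hs.poisson t ht x y
  have h2 := congrArg (truncFT χ k q) h1
  rw [truncFT_const_mul, truncFT_add hχ (contDiff_dx (contDiff_dx hφ)).continuous
    (contDiff_dy (contDiff_dy hφ)).continuous] at h2
  change truncFT χ k q (dx (dx (φ t))) + truncFT χ k q (dy (dy (φ t))) = _ at h2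
  rw [truncFT_dx hχ (contDiff_dx hφ) (dx_periodic hper), truncFT_dx hχ hφ hper,
    truncFT_dy hχ (contDiff_dy hφ), truncFT_dy hχ hφ, truncFT_dy hχ.deriv hφ] at h2
  push_cast at h2
  rw [← h2]
  linear_combination (((k : ℂ) ^ 2 + (q : ℂ) ^ 2) * truncFT χ k q (φ t)) * (-Complex.I_sq)

/-- Helmholtz decomposition at one frequency: `u^y` is recovered from divergence and curl. The
factor `2` is the one in `2∂ₓu^y` in the equation for `ψ`, of which one half comes from the term
`(u^y, 0)` and the other from the commutator of `∂_y` with `y∂ₓ`. At zero frequency both sides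
vanish. -/
theorem mode_velocity_identity (k q : ℝ) (b c : ℂ) :
    2 * (Complex.I * k * c) =
      -((2 * k * q / (k ^ 2 + q ^ 2) : ℝ) : ℂ) * -(Complex.I * k * b + Complex.I * q * c) +
      ((2 * k ^ 2 / (k ^ 2 + q ^ 2) : ℝ) : ℂ) * (-(Complex.I * q * b) + Complex.I * k * c) := by
  by_cases hp : k ^ 2 + q ^ 2 = 0
  · have hk : k = 0 := by nlinarith [sq_nonneg k, sq_nonneg q]
    have hq : q = 0 := by nlinarith [sq_nonneg k, sq_nonneg q]
    simp [hk, hq]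
  · have hp' : (k : ℂ) ^ 2 + (q : ℂ) ^ 2 ≠ 0 := by exact_mod_cast hp
    push_cast
    field_simp
    ring

/-- Sum of the squares of the errors caused by the cutoff. -/
noncomputable def cutoffError (χ : ℝ → ℝ) (k : ℤ) (q : ℝ) (η uy φ : ℝ → ℝ → ℝ) : ℝ :=
  ‖truncFT (deriv χ) k q uy‖ ^ 2 + ‖truncFT (deriv χ) k q η‖ ^ 2 + ‖truncFT (deriv χ) k q φ‖ ^ 2 +
    ‖truncFT (deriv (deriv χ)) k q φ‖ ^ 2

/-- Source in the equation for `Γ`. -/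
noncomputable def sourceΓ (χ : ℝ → ℝ) (e m : ℝ) (k : ℤ) (q : ℝ) (η uy φ : ℝ → ℝ → ℝ) : ℂ :=
  truncFT (deriv χ) k q uy + (m : ℂ)⁻¹ * (Complex.I * k * truncFT (deriv χ) k q η) -
    e / m * (Complex.I * k * truncFT (deriv χ) k q φ)

/-- Source in the equation for `V`. -/
noncomputable def sourceV (χ : ℝ → ℝ) (e m : ℝ) (k : ℤ) (q : ℝ) (η φ : ℝ → ℝ → ℝ) : ℂ :=
  -(e / m * (Complex.I * q * truncFT (deriv χ) k q φ - truncFT (deriv (deriv χ)) k q φ) +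
    (m : ℂ)⁻¹ * (Complex.I * q * truncFT (deriv χ) k q η))

/-- The coefficients of the mode equations are real, so any real linear functional `L` carries the
complex solution to a real one; the real and imaginary parts are used later. -/
theorem isModeSolution_truncFT (hs : IsSmoothSolution e m η ux uy φ) (hm : 0 < m)
    (hχ : IsCutoff R χ) (k : ℤ) (ξ T : ℝ) (L : ℂ →L[ℝ] ℝ) :
    IsModeSolution m (4 * Real.pi * e ^ 2) k ξ T
      (fun t => L (truncFT χ k (ξ - k * t) (η t)))
      (fun t => L (-truncDiv χ k (ξ - k * t) (ux t) (uy t)))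
      (fun t => L (truncFT χ k (ξ - k * t) (η t) + truncCurl χ k (ξ - k * t) (ux t) (uy t)))
      (fun t => L (truncFT (deriv χ) k (ξ - k * t) (uy t)))
      (fun t => L (sourceΓ χ e m k (ξ - k * t) (η t) (uy t) (φ t)))
      (fun t => L (sourceV χ e m k (ξ - k * t) (η t) (φ t))) := by
  have hsub : Set.Icc 0 T ⊆ Set.Ici 0 := Set.Icc_subset_Ici_self
  have cη := (continuousOn_truncFT hχ hs.density k ξ).mono hsub
  have cx := (continuousOn_truncFT hχ hs.velocity_x k ξ).mono hsub
  have cy := (continuousOn_truncFT hχ hs.velocity_y k ξ).mono hsub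
  have cy' := (continuousOn_truncFT hχ.deriv hs.velocity_y k ξ).mono hsub
  have cη' := (continuousOn_truncFT hχ.deriv hs.density k ξ).mono hsub
  have cφ' := (continuousOn_truncFT hχ.deriv hs.potential k ξ).mono hsub
  have cφ'' := (continuousOn_truncFT hχ.deriv.deriv hs.potential k ξ).mono hsub
  have cq : ContinuousOn (fun t : ℝ => Complex.I * ((ξ - k * t : ℝ) : ℂ)) (Set.Icc 0 T) :=
    Continuous.continuousOn (by fun_prop)
  have ck : ContinuousOn (fun _ : ℝ => Complex.I * (k : ℂ)) (Set.Icc 0 T) := continuousOn_const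
  have hdiv : ∀ t ∈ Set.Ioo 0 T, HasDerivAt
      (fun s : ℝ => -truncDiv χ k (ξ - k * s) (ux s) (uy s))
      (2 * (Complex.I * (k : ℝ) * truncFT χ k (ξ - k * t) (uy t))
        - (((k ^ 2 + (ξ - k * t) ^ 2 + 4 * Real.pi * e ^ 2) / m : ℝ) : ℂ) *
          truncFT χ k (ξ - k * t) (η t)
        + sourceV χ e m k (ξ - k * t) (η t) (φ t)) t := by
    intro t ht
    have hq : HasDerivAt (fun s : ℝ => Complex.I * ((ξ - k * s : ℝ) : ℂ)) (Complex.I * (-k : ℝ)) t := by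
      have := (((hasDerivAt_id t).const_mul (k : ℝ)).const_sub ξ).ofReal_comp.const_mul Complex.I
      simpa using this
    refine (((hasDerivAt_truncFT_velocity_x hs hχ k ξ ht.1).const_mul (Complex.I * (k : ℂ))).add
      (hq.mul (hasDerivAt_truncFT_velocity_y hs hχ k ξ ht.1))).neg.congr_deriv ?_
    have hp := truncFT_poisson hs hχ k (ξ - k * t) ht.1.le
    have hm' : (m : ℂ) ≠ 0 := by exact_mod_cast hm.ne'
    simp only [sourceV]
    generalize truncFT χ k (ξ - k * t) (η t) = A at *
    generalize truncFT χ k (ξ - k * t) (uy t) = C at *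
    generalize truncFT χ k (ξ - k * t) (φ t) = P at *
    generalize truncFT (deriv χ) k (ξ - k * t) (η t) = A1 at *
    generalize truncFT (deriv χ) k (ξ - k * t) (φ t) = P1 at *
    generalize truncFT (deriv (deriv χ)) k (ξ - k * t) (φ t) = P2 at *
    push_cast at hp ⊢
    generalize (ξ : ℂ) - k * t = q at *
    have hI := Complex.I_sq
    field_simp
    -- Poisson's equation trades `(k² + q²)φ̂` for the density, which produces `β = 4πe²`; its
    -- cutoff errors are part of `sourceV`.
    linear_combination (-e) * hp + (-(e : ℂ) * ((k : ℂ) ^ 2 + q ^ 2) * P +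
      ((k : ℂ) ^ 2 + q ^ 2) * A) * hI
  refine ⟨L.continuous.comp_continuousOn cη,
    L.continuous.comp_continuousOn ((ck.mul cx).add (cq.mul cy)).neg,
    L.continuous.comp_continuousOn (cη.add ((cq.mul cx).neg.add (ck.mul cy))),
    L.continuous.comp_continuousOn cy',
    L.continuous.comp_continuousOn ((cy'.add (continuousOn_const.mul (ck.mul cη'))).sub
      (continuousOn_const.mul (ck.mul cφ'))),
    L.continuous.comp_continuousOn ((continuousOn_const.mul ((cq.mul cφ').sub cφ'')).add
      (continuousOn_const.mul (cq.mul cη'))).neg, ?_, ?_, ?_⟩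
  · intro t ht
    refine (hasDerivAt_map L (hasDerivAt_truncFT_density hs hχ k ξ ht.1)).congr_deriv ?_
    rw [map_add]
  · intro t ht
    have hq : HasDerivAt (fun s : ℝ => Complex.I * ((ξ - k * s : ℝ) : ℂ)) (Complex.I * (-k : ℝ)) t := by
      have := (((hasDerivAt_id t).const_mul (k : ℝ)).const_sub ξ).ofReal_comp.const_mul Complex.I
      simpa using this
    refine hasDerivAt_map L ?_
    refine ((hasDerivAt_truncFT_density hs hχ k ξ ht.1).add
      ((hq.mul (hasDerivAt_truncFT_velocity_x hs hχ k ξ ht.1)).neg.add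
      ((hasDerivAt_truncFT_velocity_y hs hχ k ξ ht.1).const_mul
        (Complex.I * (k : ℂ))))).congr_deriv ?_
    -- The gradients of `η` and `φ` are curl-free up to cutoff errors, and the two shear terms add
    -- up to `+ψ` in the equation for `ω`, which cancels the `-ψ` of the continuity equation.
    simp only [sourceΓ, truncDiv]
    push_cast
    ring
  · intro t ht
    refine (hasDerivAt_map L (hdiv t ht)).congr_deriv ?_
    rw [mode_velocity_identity k (ξ - k * t) (truncFT χ k (ξ - k * t) (ux t)), map_add, map_sub,
      map_add, map_ofReal_mul, map_ofReal_mul, ← Complex.ofReal_neg, map_ofReal_mul, map_add L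
      (truncFT χ k (ξ - k * t) (η t))]
    simp only [truncDiv, truncCurl, Complex.ofReal_intCast]
    ring

end System

end ElectronEP

/-! ### Size of the sources -/

namespace ElectronEP

open scoped ContDiff
open Filter Topology

theorem continuousOn_cutoffError {R : ℝ} {χ : ℝ → ℝ} (hχ : IsCutoff R χ)
    {η uy φ : ℝ → ℝ → ℝ → ℝ} (hη : IsSmoothField η) (huy : IsSmoothField uy)
    (hφ : IsSmoothField φ) (k : ℤ) (ξ : ℝ) :
    ContinuousOn (fun t : ℝ => cutoffError χ k (ξ - k * t) (η t) (uy t) (φ t)) (Set.Ici 0) :=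
  (((((continuousOn_truncFT hχ.deriv huy k ξ).norm.pow 2).add
    ((continuousOn_truncFT hχ.deriv hη k ξ).norm.pow 2)).add
    ((continuousOn_truncFT hχ.deriv hφ k ξ).norm.pow 2)).add
    ((continuousOn_truncFT hχ.deriv.deriv hφ k ξ).norm.pow 2))

theorem sq_map_le (L : ℂ →L[ℝ] ℝ) (M : ℝ) (z : ℂ) {a b c d : ℝ}
    (hz : ‖z‖ ≤ M * (a + b + c + d)) :
    L z ^ 2 ≤ (‖L‖ * M) ^ 2 * 4 * (a ^ 2 + b ^ 2 + c ^ 2 + d ^ 2) := by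
  have h1 : ‖L z‖ ≤ ‖L‖ * (M * (a + b + c + d)) :=
    (L.le_opNorm z).trans (mul_le_mul_of_nonneg_left hz (norm_nonneg _))
  rw [Real.norm_eq_abs] at h1
  have h2 : L z ^ 2 ≤ (‖L‖ * (M * (a + b + c + d))) ^ 2 :=
    sq_le_sq' (neg_le_of_abs_le h1) (le_of_abs_le h1)
  have h3 : (a + b + c + d) ^ 2 ≤ 4 * (a ^ 2 + b ^ 2 + c ^ 2 + d ^ 2) := by
    have e1 : a + b + c + d = (a + b) + (c + d) := by ring
    rw [e1]
    linarith [add_sq_le (a := a + b) (b := c + d), add_sq_le (a := a) (b := b),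
      add_sq_le (a := c) (b := d)]
  have h4 := mul_le_mul_of_nonneg_left h3 (sq_nonneg (‖L‖ * M))
  calc _ ≤ _ := h2
    _ = (‖L‖ * M) ^ 2 * (a + b + c + d) ^ 2 := by ring
    _ ≤ _ := h4
    _ = _ := by ring

/-- The sources are linear in the cutoff errors, with coefficients that involve `q`. On a bounded
time interval `q = ξ - kt` is bounded, and one constant serves for all cutoffs. -/
theorem exists_source_bound (e m : ℝ) (k : ℤ) (Q : ℝ) (L : ℂ →L[ℝ] ℝ) :
    ∃ K : ℝ, 0 ≤ K ∧ ∀ (χ : ℝ → ℝ) (q : ℝ) (η uy φ : ℝ → ℝ → ℝ), |q| ≤ Q →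
      L (truncFT (deriv χ) k q uy) ^ 2 + L (sourceΓ χ e m k q η uy φ) ^ 2 +
        L (sourceV χ e m k q η φ) ^ 2 ≤ K * cutoffError χ k q η uy φ := by
  set M := 1 + |k| * |m|⁻¹ + |e / m| * |k| + |e / m| * (|Q| + 1) + |m|⁻¹ * |Q| with hM
  have hM0 : 0 ≤ M := by positivity
  refine ⟨3 * (‖L‖ * M) ^ 2 * 4, by positivity, fun χ q η uy φ hq => ?_⟩
  unfold cutoffError
  have hq' : |q| ≤ |Q| := hq.trans (le_abs_self Q)
  have hA : 0 ≤ |k| * |m|⁻¹ := by positivity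
  have hB : 0 ≤ |e / m| * |k| := by positivity
  have hC : 0 ≤ |e / m| * |Q| := by positivity
  have hD : 0 ≤ |m|⁻¹ * |Q| := by positivity
  have hE := abs_nonneg (e / m)
  have key := fun z => sq_map_le L M z (a := ‖truncFT (deriv χ) k q uy‖)
    (b := ‖truncFT (deriv χ) k q η‖) (c := ‖truncFT (deriv χ) k q φ‖)
    (d := ‖truncFT (deriv (deriv χ)) k q φ‖)
  have n1 : ∀ z : ℂ, ‖Complex.I * k * z‖ = |k| * ‖z‖ := fun z => by
    rw [norm_mul, norm_mul, Complex.norm_I, one_mul, Complex.norm_intCast]; norm_cast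
  have n2 : ∀ z : ℂ, ‖Complex.I * q * z‖ = |q| * ‖z‖ := fun z => by
    rw [norm_mul, norm_mul, Complex.norm_I, one_mul, Complex.norm_real, Real.norm_eq_abs]
  have n3 : ∀ z : ℂ, ‖(m : ℂ)⁻¹ * z‖ = |m|⁻¹ * ‖z‖ := fun z => by
    rw [norm_mul, norm_inv, Complex.norm_real, Real.norm_eq_abs]
  have n4 : ∀ z : ℂ, ‖(e / m : ℂ) * z‖ = |e / m| * ‖z‖ := fun z => by
    rw [norm_mul, ← Complex.ofReal_div, Complex.norm_real, Real.norm_eq_abs]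
  have h1 := key (truncFT (deriv χ) k q uy)
  have h2 := key (sourceΓ χ e m k q η uy φ)
  have h3 := key (sourceV χ e m k q η φ)
  have b2 : ‖sourceΓ χ e m k q η uy φ‖ ≤ ‖truncFT (deriv χ) k q uy‖ +
      |m|⁻¹ * (|k| * ‖truncFT (deriv χ) k q η‖) + |e / m| * (|k| * ‖truncFT (deriv χ) k q φ‖) := by
    rw [← n1, ← n1, ← n3, ← n4]
    exact (norm_sub_le _ _).trans (add_le_add_left (norm_add_le _ _) _)
  have b3 : ‖sourceV χ e m k q η φ‖ ≤ |e / m| * (|q| * ‖truncFT (deriv χ) k q φ‖ +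
      ‖truncFT (deriv (deriv χ)) k q φ‖) + |m|⁻¹ * (|q| * ‖truncFT (deriv χ) k q η‖) := by
    rw [sourceV, norm_neg, ← n2, ← n2, ← n3]
    refine (norm_add_le _ _).trans (add_le_add_left ?_ _)
    rw [n4]
    exact mul_le_mul_of_nonneg_left (norm_sub_le _ _) hE
  have p1 := norm_nonneg (truncFT (deriv χ) k q uy)
  have p2 := norm_nonneg (truncFT (deriv χ) k q η)
  have p3 := norm_nonneg (truncFT (deriv χ) k q φ)
  have p4 := norm_nonneg (truncFT (deriv (deriv χ)) k q φ)
  generalize ‖truncFT (deriv χ) k q uy‖ = a at *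
  generalize ‖truncFT (deriv χ) k q η‖ = b at *
  generalize ‖truncFT (deriv χ) k q φ‖ = c at *
  generalize ‖truncFT (deriv (deriv χ)) k q φ‖ = d at *
  have hMa : a ≤ M * a := le_mul_of_one_le_left p1 (by rw [hM]; linarith)
  have hMb : |k| * |m|⁻¹ * b ≤ M * b := mul_le_mul_of_nonneg_right (by rw [hM]; linarith) p2
  have hMb' : |m|⁻¹ * |Q| * b ≤ M * b := mul_le_mul_of_nonneg_right (by rw [hM]; linarith) p2
  have hMc : |e / m| * |k| * c ≤ M * c := mul_le_mul_of_nonneg_right (by rw [hM]; linarith) p3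
  have hMc' : |e / m| * |Q| * c ≤ M * c := mul_le_mul_of_nonneg_right (by rw [hM]; linarith) p3
  have hMd' : |e / m| * d ≤ M * d := mul_le_mul_of_nonneg_right (by rw [hM]; linarith) p4
  have m1 : 0 ≤ M * a := mul_nonneg hM0 p1
  have m2 : 0 ≤ M * b := mul_nonneg hM0 p2
  have m3 : 0 ≤ M * c := mul_nonneg hM0 p3
  have m4 : 0 ≤ M * d := mul_nonneg hM0 p4
  have hsum : M * (a + b + c + d) = M * a + M * b + M * c + M * d := by ring
  rw [hsum] at h1 h2 h3
  replace h1 := h1 (by linarith)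
  replace h2 := h2 (b2.trans (by linarith))
  replace h3 := h3 (b3.trans (by
    have q1 : |e / m| * (|q| * c) ≤ |e / m| * (|Q| * c) := by gcongr
    have q2 : |m|⁻¹ * (|q| * b) ≤ |m|⁻¹ * (|Q| * b) := by gcongr
    linarith))
  linarith

end ElectronEP

/-! ### Null sequences in `L¹` of the frequency variable -/

namespace ElectronEP

open scoped ContDiff
open Filter Topology

/-- A sequence of measurable functions tending to `0` in `L¹(ℝ)`. -/
structure IsL1Null (u : ℕ → ℝ → ℝ≥0∞) : Prop where
  aemeasurable : ∀ n, AEMeasurable (u n) volume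
  tendsto : Tendsto (fun n => ∫⁻ ξ, u n ξ) atTop (𝓝 0)

theorem IsL1Null.add {u v : ℕ → ℝ → ℝ≥0∞} (hu : IsL1Null u) (hv : IsL1Null v) :
    IsL1Null fun n ξ => u n ξ + v n ξ := by
  refine ⟨fun n => (hu.1 n).add (hv.1 n), ?_⟩
  have h := hu.2.add hv.2
  rw [add_zero] at h
  refine h.congr fun n => ?_
  rw [lintegral_add_left' (hu.1 n)]

theorem tendsto_zero_of_add {u v : ℕ → ℝ≥0∞} (h : Tendsto (fun n => u n + v n) atTop (𝓝 0)) :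
    Tendsto u atTop (𝓝 0) ∧ Tendsto v atTop (𝓝 0) :=
  ⟨tendsto_of_tendsto_of_tendsto_of_le_of_le tendsto_const_nhds h (fun _ => zero_le)
    fun _ => le_self_add,
   tendsto_of_tendsto_of_tendsto_of_le_of_le tendsto_const_nhds h (fun _ => zero_le)
    fun _ => le_add_self⟩

theorem tendsto_of_enorm_sub_sq {a : ℕ → ℂ} {b : ℂ}
    (h : Tendsto (fun n => ‖a n - b‖ₑ ^ (2 : ℕ)) atTop (𝓝 0)) : Tendsto a atTop (𝓝 b) := by
  have h1 := (ENNReal.continuous_rpow_const (y := (1 / 2 : ℝ))).tendsto 0 |>.comp h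
  rw [ENNReal.zero_rpow_of_pos (by norm_num)] at h1
  have h2 : Tendsto (fun n => ‖a n - b‖ₑ) atTop (𝓝 0) := by
    refine h1.congr fun n => ?_
    simp only [Function.comp_apply]
    rw [← ENNReal.rpow_natCast, ← ENNReal.rpow_mul]
    norm_num
  rw [tendsto_iff_edist_tendsto_0]
  simpa only [edist_eq_enorm_sub] using h2

section OneTime

variable {f : ℝ → ℝ → ℝ}

theorem continuous_truncFT_freq {R : ℝ} {χ : ℝ → ℝ} (hχ : IsCutoff R χ)
    (hf : Continuous (Function.uncurry f)) (k : ℤ) (c : ℝ) :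
    Continuous fun ξ => truncFT χ k (ξ - c) f := by
  have h : (fun ξ : ℝ => truncFT χ k (ξ - c) f) = fun ξ : ℝ => (2 * Real.pi : ℂ)⁻¹ *
      ∫ p in cell R, waveKernel k (ξ - c) p * ((χ p.2 * f p.1 p.2 : ℝ) : ℂ) ∂cylMeasure := by
    ext ξ
    rw [truncFT, integral_cell_eq fun p hp => by simp [hχ.zero _ hp]]
  rw [h]
  refine continuous_const.mul (continuous_parametric_integral_of_continuous ?_ (isCompact_cell R))
  have h2 := hχ.smooth.continuous
  have h3 : Continuous fun w : ℝ × ℝ × ℝ => f w.2.1 w.2.2 := hf.comp continuous_snd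
  have h4 : Continuous fun w : ℝ × ℝ × ℝ => waveKernel k (w.1 - c) w.2 := by
    unfold waveKernel; fun_prop
  exact h4.mul (Complex.continuous_ofReal.comp
    ((h2.comp (by fun_prop : Continuous fun w : ℝ × ℝ × ℝ => w.2.2)).mul h3))

theorem aestronglyMeasurable_ft_sub (f : ℝ → ℝ → ℝ) (k : ℤ) (c : ℝ) :
    AEStronglyMeasurable (fun ξ => ft f k (ξ - c)) volume :=
  (aestronglyMeasurable_ft f k).comp_measurePreserving (measurePreserving_sub_right volume c)

theorem isL1Null_truncFT_sub_ft (hf : Continuous (Function.uncurry f)) {k : ℤ}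
    (h : MemLp (xMode f k) 2 volume) (c : ℝ) :
    IsL1Null fun n ξ => ‖truncFT (cutoff n) k (ξ - c) f - ft f k (ξ - c)‖ₑ ^ (2 : ℕ) :=
  ⟨fun n => (((continuous_truncFT_freq (isCutoff_cutoff n) hf k c).aestronglyMeasurable.sub
    (aestronglyMeasurable_ft_sub f k c)).enorm.pow_const 2),
    tendsto_lintegral_truncFT_sub_ft hf h c⟩

theorem tendsto_const_mul_inv_succ_sq (K : ℝ) {B : ℝ≥0∞} (hB : B ≠ ⊤) :
    Tendsto (fun n : ℕ => ENNReal.ofReal (K * (n + 1 : ℝ)⁻¹) ^ (2 : ℕ) * B) atTop (𝓝 0) := by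
  have h1 : Tendsto (fun n : ℕ => K * (n + 1 : ℝ)⁻¹) atTop (𝓝 (K * 0)) := by
    have := tendsto_one_div_add_atTop_nhds_zero_nat (𝕜 := ℝ)
    simp only [one_div] at this
    exact this.const_mul K
  rw [mul_zero] at h1
  have h2 := ((ENNReal.continuous_pow 2).tendsto _).comp (ENNReal.tendsto_ofReal h1)
  have h3 := ENNReal.Tendsto.mul_const h2 (Or.inr hB)
  simpa using h3

theorem isL1Null_truncFT_deriv (hf : Continuous (Function.uncurry f)) (h : l2Norm f ≠ ⊤) (k : ℤ)
    (c : ℝ) : IsL1Null fun n ξ => ‖truncFT (deriv (cutoff n)) k (ξ - c) f‖ₑ ^ (2 : ℕ) := by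
  obtain ⟨K, hK0, hK⟩ := exists_deriv_cutoff_bound
  refine ⟨fun n => ((continuous_truncFT_freq (isCutoff_cutoff n).deriv hf k
    c).aestronglyMeasurable.enorm.pow_const 2), ?_⟩
  exact tendsto_of_tendsto_of_tendsto_of_le_of_le tendsto_const_nhds
    (tendsto_const_mul_inv_succ_sq K (ENNReal.pow_ne_top (n := 2) h)) (fun _ => zero_le)
    fun n => lintegral_truncFT_le (isCutoff_cutoff n).deriv (fun y => (hK n y).1) hf k c

theorem isL1Null_truncFT_deriv_deriv (hf : Continuous (Function.uncurry f)) (h : l2Norm f ≠ ⊤)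
    (k : ℤ) (c : ℝ) :
    IsL1Null fun n ξ => ‖truncFT (deriv (deriv (cutoff n))) k (ξ - c) f‖ₑ ^ (2 : ℕ) := by
  obtain ⟨K, hK0, hK⟩ := exists_deriv_cutoff_bound
  refine ⟨fun n => ((continuous_truncFT_freq (isCutoff_cutoff n).deriv.deriv hf k
    c).aestronglyMeasurable.enorm.pow_const 2), ?_⟩
  exact tendsto_of_tendsto_of_tendsto_of_le_of_le tendsto_const_nhds
    (tendsto_const_mul_inv_succ_sq K (ENNReal.pow_ne_top (n := 2) h)) (fun _ => zero_le)
    fun n => lintegral_truncFT_le (isCutoff_cutoff n).deriv.deriv (fun y => (hK n y).2) hf k c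

end OneTime

theorem ofReal_cutoffError (χ : ℝ → ℝ) (k : ℤ) (q : ℝ) (η uy φ : ℝ → ℝ → ℝ) :
    ENNReal.ofReal (cutoffError χ k q η uy φ) = ‖truncFT (deriv χ) k q uy‖ₑ ^ (2 : ℕ) +
      ‖truncFT (deriv χ) k q η‖ₑ ^ (2 : ℕ) + ‖truncFT (deriv χ) k q φ‖ₑ ^ (2 : ℕ) +
      ‖truncFT (deriv (deriv χ)) k q φ‖ₑ ^ (2 : ℕ) := by
  rw [cutoffError, ENNReal.ofReal_add (by positivity) (by positivity),
    ENNReal.ofReal_add (by positivity) (by positivity),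
    ENNReal.ofReal_add (by positivity) (by positivity)]
  simp only [ENNReal.ofReal_pow (norm_nonneg _), ofReal_norm]

theorem continuous_cutoffError {R : ℝ} {χ : ℝ → ℝ} (hχ : IsCutoff R χ)
    {η uy φ : ℝ → ℝ → ℝ → ℝ} (hη : IsSmoothField η) (huy : IsSmoothField uy)
    (hφ : IsSmoothField φ) (k : ℤ) :
    Continuous fun z : ℝ × ℝ => cutoffError χ k (z.2 - k * max z.1 0) (η (max z.1 0))
      (uy (max z.1 0)) (φ (max z.1 0)) :=
  (((((continuous_truncFT hχ.deriv huy k).norm.pow 2).add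
    ((continuous_truncFT hχ.deriv hη k).norm.pow 2)).add
    ((continuous_truncFT hχ.deriv hφ k).norm.pow 2)).add
    ((continuous_truncFT hχ.deriv.deriv hφ k).norm.pow 2))

theorem lintegral_add_four {a b c d : ℝ → ℝ≥0∞} (ha : AEMeasurable a) (hb : AEMeasurable b)
    (hc : AEMeasurable c) :
    ∫⁻ x, a x + b x + c x + d x = (∫⁻ x, a x) + (∫⁻ x, b x) + (∫⁻ x, c x) + ∫⁻ x, d x := by
  have hab : AEMeasurable fun x => a x + b x := ha.add hb
  have habc : AEMeasurable fun x => a x + b x + c x := hab.add hc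
  rw [lintegral_add_left' habc, lintegral_add_left' hab, lintegral_add_left' ha]

/-- Exchange the integrals by Tonelli. At each time the integral over `ξ` is `O((n+1)⁻²)` by
Plancherel, uniformly on `[0,T]` because the `L²` norms of the fields are bounded there. -/
theorem isL1Null_cutoffError {η uy φ : ℝ → ℝ → ℝ → ℝ} (hη : IsSmoothField η)
    (huy : IsSmoothField uy) (hφ : IsSmoothField φ) (k : ℤ) (T : ℝ) :
    IsL1Null fun n ξ => ∫⁻ t in Set.Ioc 0 T, ENNReal.ofReal
      (cutoffError (cutoff n) k (ξ - k * max t 0) (η (max t 0)) (uy (max t 0)) (φ (max t 0))) := by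
  obtain ⟨K, hK0, hK⟩ := exists_deriv_cutoff_bound
  obtain ⟨M₁, h1⟩ := hη.bounded T
  obtain ⟨M₂, h2⟩ := huy.bounded T
  obtain ⟨M₃, h3⟩ := hφ.bounded T
  have hmeas : ∀ n, Measurable (Function.uncurry fun ξ t : ℝ => ENNReal.ofReal
      (cutoffError (cutoff n) k (ξ - k * max t 0) (η (max t 0)) (uy (max t 0)) (φ (max t 0)))) :=
    fun n => (((continuous_cutoffError (isCutoff_cutoff n) hη huy hφ k).comp
      continuous_swap).measurable).ennreal_ofReal
  refine ⟨fun n => ((hmeas n).lintegral_prod_right (ν := volume.restrict (Set.Ioc 0 T))).aemeasurable,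
    ?_⟩
  set B : ℝ≥0∞ := (M₂ : ℝ≥0∞) ^ (2 : ℕ) + (M₁ : ℝ≥0∞) ^ (2 : ℕ) + (M₃ : ℝ≥0∞) ^ (2 : ℕ) +
    (M₃ : ℝ≥0∞) ^ (2 : ℕ) with hB
  have hBtop : ENNReal.ofReal T * B ≠ ⊤ := by
    simp [hB, ENNReal.mul_eq_top]
  refine tendsto_of_tendsto_of_tendsto_of_le_of_le tendsto_const_nhds
    (tendsto_const_mul_inv_succ_sq K hBtop) (fun _ => zero_le) fun n => ?_
  simp only
  rw [lintegral_lintegral_swap (hmeas n).aemeasurable]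
  have hin : ∀ t ∈ Set.Ioc 0 T, ∫⁻ ξ, ENNReal.ofReal
      (cutoffError (cutoff n) k (ξ - k * max t 0) (η (max t 0)) (uy (max t 0)) (φ (max t 0))) ≤
      ENNReal.ofReal (K * (n + 1 : ℝ)⁻¹) ^ (2 : ℕ) * B := by
    intro t ht
    have htm : t ∈ Set.Icc 0 T := ⟨ht.1.le, ht.2⟩
    rw [max_eq_left ht.1.le]
    simp only [ofReal_cutoffError]
    have hd := (isCutoff_cutoff n).deriv
    have m1 := fun {f : ℝ → ℝ → ℝ} (hf : Continuous (Function.uncurry f)) =>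
      (continuous_truncFT_freq hd hf k (k * t)).aestronglyMeasurable (μ := volume) |>.enorm.pow_const 2
    have c1 := (hη.contDiff ht.1.le).continuous
    have c2 := (huy.contDiff ht.1.le).continuous
    have c3 := (hφ.contDiff ht.1.le).continuous
    rw [lintegral_add_four (m1 c2) (m1 c1) (m1 c3), hB, mul_add, mul_add, mul_add]
    gcongr
    · refine (lintegral_truncFT_le hd (fun y => (hK n y).1) c2 k _).trans ?_
      gcongr; exact h2 t htm
    · refine (lintegral_truncFT_le hd (fun y => (hK n y).1) c1 k _).trans ?_
      gcongr; exact h1 t htm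
    · refine (lintegral_truncFT_le hd (fun y => (hK n y).1) c3 k _).trans ?_
      gcongr; exact h3 t htm
    · refine (lintegral_truncFT_le hd.deriv (fun y => (hK n y).2) c3 k _).trans ?_
      gcongr; exact h3 t htm
  calc _ ≤ ∫⁻ _ in Set.Ioc 0 T, ENNReal.ofReal (K * (n + 1 : ℝ)⁻¹) ^ (2 : ℕ) * B :=
        setLIntegral_mono measurable_const hin
    _ = _ := by
        rw [lintegral_const, Measure.restrict_apply_univ, Real.volume_Ioc, sub_zero]
        ring

end ElectronEP

/-! ### From truncated transforms to the Fourier transform of the solution -/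

namespace ElectronEP

open scoped ContDiff
open Filter Topology

theorem IsSmoothField.l2Norm_ne_top {f : ℝ → ℝ → ℝ → ℝ} (hf : IsSmoothField f) {t : ℝ}
    (ht : 0 ≤ t) : l2Norm (f t) ≠ ⊤ := by
  obtain ⟨M, hM⟩ := hf.bounded t
  exact ne_top_of_le_ne_top ENNReal.coe_ne_top (hM t ⟨ht, le_rfl⟩)

theorem IsSmoothField.hasL2Modes {f : ℝ → ℝ → ℝ → ℝ} (hf : IsSmoothField f) {t : ℝ}
    (ht : 0 ≤ t) : HasL2Modes (f t) :=
  hasL2Modes_of_l2Norm_lt_top (hf.contDiff ht).continuous (hf.l2Norm_ne_top ht).lt_top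

theorem tendsto_truncDiv {χ : ℕ → ℝ → ℝ} {k : ℤ} {q : ℝ} {ux uy : ℝ → ℝ → ℝ}
    (hx : Tendsto (fun n => truncFT (χ n) k q ux) atTop (𝓝 (ft ux k q)))
    (hy : Tendsto (fun n => truncFT (χ n) k q uy) atTop (𝓝 (ft uy k q))) :
    Tendsto (fun n => truncDiv (χ n) k q ux uy) atTop (𝓝 (divHat ux uy k q)) :=
  (hx.const_mul _).add (hy.const_mul _)

theorem tendsto_truncCurl {χ : ℕ → ℝ → ℝ} {k : ℤ} {q : ℝ} {ux uy : ℝ → ℝ → ℝ}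
    (hx : Tendsto (fun n => truncFT (χ n) k q ux) atTop (𝓝 (ft ux k q)))
    (hy : Tendsto (fun n => truncFT (χ n) k q uy) atTop (𝓝 (ft uy k q))) :
    Tendsto (fun n => truncCurl (χ n) k q ux uy) atTop (𝓝 (curlHat ux uy k q)) :=
  (hx.const_mul _).neg.add (hy.const_mul _)

section Limit

variable {e m : ℝ} {η ux uy φ : ℝ → ℝ → ℝ → ℝ}

theorem tendsto_integral_source (hs : IsSmoothSolution e m η ux uy φ) (hm : 0 < m) (k : ℤ) {T : ℝ} (hT : 0 ≤ T)
    (ξ : ℝ) (ns : ℕ → ℕ) (L : ℂ →L[ℝ] ℝ)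
    (h : Tendsto (fun j => ∫⁻ t in Set.Ioc 0 T, ENNReal.ofReal (cutoffError (cutoff (ns j)) k
      (ξ - k * max t 0) (η (max t 0)) (uy (max t 0)) (φ (max t 0)))) atTop (𝓝 0)) :
    Tendsto (fun j => ∫ t in (0 : ℝ)..T,
      (L (truncFT (deriv (cutoff (ns j))) k (ξ - k * t) (uy t)) ^ 2 +
        L (sourceΓ (cutoff (ns j)) e m k (ξ - k * t) (η t) (uy t) (φ t)) ^ 2 +
        L (sourceV (cutoff (ns j)) e m k (ξ - k * t) (η t) (φ t)) ^ 2)) atTop (𝓝 0) := by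
  obtain ⟨K, hK0, hK⟩ := exists_source_bound e m k (|ξ| + |(k : ℝ)| * T) L
  have hnn : ∀ (χ : ℝ → ℝ) (q : ℝ) (a b c : ℝ → ℝ → ℝ), 0 ≤ cutoffError χ k q a b c :=
    fun χ q a b c => by unfold cutoffError; positivity
  have hq : ∀ t ∈ Set.Ioc 0 T, |ξ - k * t| ≤ |ξ| + |(k : ℝ)| * T := fun t ht => by
    refine (abs_sub _ _).trans ?_
    rw [abs_mul, abs_of_pos ht.1]
    gcongr
    exact ht.2
  have hcont : ∀ j, ContinuousOn (fun t : ℝ => cutoffError (cutoff (ns j)) k (ξ - k * t) (η t)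
      (uy t) (φ t)) (Set.Icc 0 T) := fun j =>
    (continuousOn_cutoffError (isCutoff_cutoff (ns j)) hs.density hs.velocity_y hs.potential k
      ξ).mono Set.Icc_subset_Ici_self
  have h1 : ∀ j, (∫⁻ t in Set.Ioc 0 T, ENNReal.ofReal (cutoffError (cutoff (ns j)) k
      (ξ - k * max t 0) (η (max t 0)) (uy (max t 0)) (φ (max t 0)))).toReal =
      ∫ t in (0 : ℝ)..T, cutoffError (cutoff (ns j)) k (ξ - k * t) (η t) (uy t) (φ t) := by
    intro j
    rw [intervalIntegral.integral_of_le hT, integral_eq_lintegral_of_nonneg_ae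
      (.of_forall fun t => hnn _ _ _ _ _)
      (((hcont j).mono Set.Ioc_subset_Icc_self).aestronglyMeasurable measurableSet_Ioc)]
    congr 1
    refine setLIntegral_congr_fun measurableSet_Ioc fun t ht => ?_
    simp only [max_eq_left ht.1.le]
  have h2 := (ENNReal.tendsto_toReal ENNReal.zero_ne_top).comp h
  simp only [Function.comp_def, h1, ENNReal.toReal_zero] at h2
  have h3 := h2.const_mul K
  rw [mul_zero] at h3
  refine squeeze_zero (fun j => ?_) (fun j => ?_) h3
  · refine intervalIntegral.integral_nonneg hT fun t _ => by positivity
  · rw [← intervalIntegral.integral_const_mul]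
    refine intervalIntegral.integral_mono_on_of_le_Ioo hT ?_ ?_ fun t ht =>
      hK _ _ _ _ _ (hq t ⟨ht.1, ht.2.le⟩)
    · have h := isModeSolution_truncFT hs hm (isCutoff_cutoff (ns j)) k ξ T L
      exact ContinuousOn.intervalIntegrable_of_Icc hT
        (((h.cont₁.pow 2).add (h.cont₂.pow 2)).add (h.cont₃.pow 2))
    · exact ContinuousOn.intervalIntegrable_of_Icc hT (continuousOn_const.mul (hcont j))

/-- Seven null sequences (the cutoff error, and the truncation errors of `η`, `u^x`, `u^y` at the
times `0` and `T`) are added, so that one subsequence converges for all of them. The exceptional set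
of `ξ` does not depend on `L`, hence real and imaginary parts can be treated at the same `ξ`. -/
theorem ae_exists_isModeLimit (hs : IsSmoothSolution e m η ux uy φ) (hm : 0 < m) (k : ℤ) {T : ℝ}
    (hT : 0 ≤ T) : ∀ᵐ ξ : ℝ, ∀ L : ℂ →L[ℝ] ℝ, ∃ N V Γ r₁ r₂ r₃ : ℕ → ℝ → ℝ,
      IsModeLimit m (4 * Real.pi * e ^ 2) k ξ T N V Γ r₁ r₂ r₃
        (L (ft (η 0) k ξ)) (L (-divHat (ux 0) (uy 0) k ξ))
        (L (ft (η 0) k ξ + curlHat (ux 0) (uy 0) k ξ))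
        (L (ft (η T) k (ξ - k * T))) (L (-divHat (ux T) (uy T) k (ξ - k * T)))
        (L (ft (η T) k (ξ - k * T) + curlHat (ux T) (uy T) k (ξ - k * T))) := by
  have hnull := fun {f : ℝ → ℝ → ℝ → ℝ} (hf : IsSmoothField f) {t : ℝ} (ht : 0 ≤ t) =>
    isL1Null_truncFT_sub_ft (hf.contDiff ht).continuous (hf.hasL2Modes ht k) (k * t)
  obtain ⟨ns, hns, hae⟩ := exists_subseq_tendsto_zero_ae
    (((((((isL1Null_cutoffError hs.density hs.velocity_y hs.potential k T).add
      (hnull hs.density le_rfl)).add (hnull hs.velocity_x le_rfl)).add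
      (hnull hs.velocity_y le_rfl)).add (hnull hs.density hT)).add (hnull hs.velocity_x hT)).add
      (hnull hs.velocity_y hT)).1
    (((((((isL1Null_cutoffError hs.density hs.velocity_y hs.potential k T).add
      (hnull hs.density le_rfl)).add (hnull hs.velocity_x le_rfl)).add
      (hnull hs.velocity_y le_rfl)).add (hnull hs.density hT)).add (hnull hs.velocity_x hT)).add
      (hnull hs.velocity_y hT)).2
  filter_upwards [hae] with ξ hξ L
  obtain ⟨hξ, hyT⟩ := tendsto_zero_of_add hξ
  obtain ⟨hξ, hxT⟩ := tendsto_zero_of_add hξ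
  obtain ⟨hξ, hηT⟩ := tendsto_zero_of_add hξ
  obtain ⟨hξ, hy0⟩ := tendsto_zero_of_add hξ
  obtain ⟨hξ, hx0⟩ := tendsto_zero_of_add hξ
  obtain ⟨hξ, hη0⟩ := tendsto_zero_of_add hξ
  replace hyT := tendsto_of_enorm_sub_sq hyT
  replace hxT := tendsto_of_enorm_sub_sq hxT
  replace hηT := tendsto_of_enorm_sub_sq hηT
  replace hy0 := tendsto_of_enorm_sub_sq hy0
  replace hx0 := tendsto_of_enorm_sub_sq hx0
  replace hη0 := tendsto_of_enorm_sub_sq hη0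
  have e0 : ξ - k * 0 = ξ := by ring
  rw [e0] at hy0 hx0 hη0
  have hL := fun z => L.continuous.tendsto z
  refine ⟨_, _, _, _, _, _, fun j => isModeSolution_truncFT hs hm (isCutoff_cutoff (ns j)) k ξ T L,
    tendsto_integral_source hs hm k hT ξ ns L hξ, ?_, ?_, ?_, (hL _).comp hηT,
    (hL _).comp (tendsto_truncDiv hxT hyT).neg,
    (hL _).comp (hηT.add (tendsto_truncCurl hxT hyT))⟩
  · simp only [e0]
    exact (hL _).comp hη0
  · simp only [e0]
    exact (hL _).comp (tendsto_truncDiv hx0 hy0).neg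
  · simp only [e0]
    exact (hL _).comp (hη0.add (tendsto_truncCurl hx0 hy0))

/-- The transport of `η + ω` along the characteristics. -/
theorem ae_density_add_curl (hs : IsSmoothSolution e m η ux uy φ) (hm : 0 < m) (k : ℤ) {T : ℝ}
    (hT : 0 ≤ T) : ∀ᵐ ξ : ℝ,
      ft (η T) k (ξ - k * T) + curlHat (ux T) (uy T) k (ξ - k * T) =
        ft (η 0) k ξ + curlHat (ux 0) (uy 0) k ξ := by
  filter_upwards [ae_exists_isModeLimit hs hm k hT] with ξ hξ
  obtain ⟨N, V, Γ, r₁, r₂, r₃, h⟩ := hξ Complex.reCLM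
  obtain ⟨N, V, Γ, r₁, r₂, r₃, h'⟩ := hξ Complex.imCLM
  exact Complex.ext (h.eq_of_limit hT) (h'.eq_of_limit hT)

/-- For `k = 0` there is no mixing and hence no decay; what saves the theorem is that this mode
vanishes for all time when its data vanish. -/
theorem ae_zero_mode (hs : IsSmoothSolution e m η ux uy φ) (hm : 0 < m) (he : 0 < e) {T : ℝ}
    (hT : 0 ≤ T) : ∀ᵐ ξ : ℝ, ft (η 0) 0 ξ = 0 → divHat (ux 0) (uy 0) 0 ξ = 0 →
      curlHat (ux 0) (uy 0) 0 ξ = 0 →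
      ft (η T) 0 ξ = 0 ∧ divHat (ux T) (uy T) 0 ξ = 0 ∧ curlHat (ux T) (uy T) 0 ξ = 0 := by
  filter_upwards [ae_exists_isModeLimit hs hm 0 hT] with ξ hξ h1 h2 h3
  have hβ : 0 < 4 * Real.pi * e ^ 2 := by positivity
  have key : ∀ L : ℂ →L[ℝ] ℝ, L (ft (η T) 0 ξ) = 0 ∧ L (-divHat (ux T) (uy T) 0 ξ) = 0 ∧
      L (ft (η T) 0 ξ + curlHat (ux T) (uy T) 0 ξ) = 0 := by
    intro L
    obtain ⟨N, V, Γ, r₁, r₂, r₃, h⟩ := hξ L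
    simp only [h1, h2, h3, neg_zero, add_zero, map_zero, Int.cast_zero, zero_mul, sub_zero] at h
    exact h.zero_of_zero hm hβ hT
  obtain ⟨a1, b1, c1⟩ := key Complex.reCLM
  obtain ⟨a2, b2, c2⟩ := key Complex.imCLM
  have g1 : ft (η T) 0 ξ = 0 := Complex.ext a1 a2
  have g2 : -divHat (ux T) (uy T) 0 ξ = 0 := Complex.ext b1 b2
  have g3 : ft (η T) 0 ξ + curlHat (ux T) (uy T) 0 ξ = 0 := Complex.ext c1 c2
  rw [g1, zero_add] at g3
  exact ⟨g1, neg_eq_zero.1 g2, g3⟩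

end Limit

/-- The growth estimate for the Fourier transform of a solution at a frequency `k ≠ 0`. -/
theorem exists_ae_mode_bound {e m : ℝ} (hm : 0 < m) : ∃ C : ℝ, 0 ≤ C ∧
    ∀ {η ux uy φ : ℝ → ℝ → ℝ → ℝ}, IsSmoothSolution e m η ux uy φ → ∀ {k : ℤ}, k ≠ 0 →
      ∀ {T : ℝ}, 0 ≤ T → ∀ᵐ ξ : ℝ,
        ‖ft (η T) k (ξ - k * T)‖ ^ 2 +
            ‖divHat (ux T) (uy T) k (ξ - k * T)‖ ^ 2 / (k ^ 2 * (1 + (T - ξ / k) ^ 2)) ≤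
          C * (Real.sqrt (1 + (T - ξ / k) ^ 2) / Real.sqrt (1 + (ξ / k) ^ 2) *
            (‖ft (η 0) k ξ‖ ^ 2 +
              ‖divHat (ux 0) (uy 0) k ξ‖ ^ 2 / (k ^ 2 * (1 + (ξ / k) ^ 2)) +
              Real.sqrt (1 + (ξ / k) ^ 2) / k ^ 2 *
                ‖ft (η 0) k ξ + curlHat (ux 0) (uy 0) k ξ‖ ^ 2)) := by
  obtain ⟨C, hC0, hC⟩ := exists_mode_bound hm (β := 4 * Real.pi * e ^ 2) (by positivity)
  refine ⟨C, hC0, fun {η ux uy φ} hs {k} hk {T} hT => ?_⟩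
  have hk1 : 1 ≤ (k : ℝ) ^ 2 := by
    have : 1 ≤ k ^ 2 := by nlinarith [Int.one_le_abs hk, sq_abs k]
    exact_mod_cast this
  filter_upwards [ae_exists_isModeLimit hs hm k hT] with ξ hξ
  obtain ⟨N, V, Γ, r₁, r₂, r₃, h⟩ := hξ Complex.reCLM
  obtain ⟨N', V', Γ', r₁', r₂', r₃', h'⟩ := hξ Complex.imCLM
  -- Both sides of the bound are sums of squares with the same coefficients for real and imaginary
  -- parts, so adding the two instances gives it for moduli.
  have h1 := hC hk1 hT h
  have h2 := hC hk1 hT h'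
  simp only [Complex.reCLM_apply, Complex.imCLM_apply, Complex.neg_re, Complex.neg_im, neg_sq]
    at h1 h2
  simp only [← Complex.normSq_eq_norm_sq, Complex.normSq_apply, ← sq]
  refine le_trans (le_of_eq ?_) ((add_le_add h1 h2).trans (le_of_eq ?_)) <;> ring

end ElectronEP

/-! ### Fourier form of Poisson's equation, of divergence and curl, and linearity -/

namespace ElectronEP

open scoped ContDiff
open Filter Topology

theorem tendsto_zero_of_enorm_sq {a : ℕ → ℂ}
    (h : Tendsto (fun n => ‖a n‖ₑ ^ (2 : ℕ)) atTop (𝓝 0)) : Tendsto a atTop (𝓝 0) :=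
  tendsto_of_enorm_sub_sq (by simpa only [sub_zero] using h)

/-- The derivatives of `φ` need not be in `L²`: the truncated identity is passed to the limit, where
the terms with `χ'` and `χ''` disappear. -/
theorem ae_ft_poisson {e m : ℝ} {η ux uy φ : ℝ → ℝ → ℝ → ℝ}
    (hs : IsSmoothSolution e m η ux uy φ) (k : ℤ) {t : ℝ} (ht : 0 ≤ t) : ∀ᵐ ξ : ℝ,
      -((k : ℂ) ^ 2 + (ξ : ℂ) ^ 2) * ft (φ t) k ξ = 4 * Real.pi * e * ft (η t) k ξ := by
  have cφ := (hs.potential.contDiff ht).continuous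
  have lφ := hs.potential.l2Norm_ne_top ht
  have h := ((((isL1Null_truncFT_sub_ft (hs.density.contDiff ht).continuous
    (hs.density.hasL2Modes ht k) 0).add
    (isL1Null_truncFT_sub_ft cφ (hs.potential.hasL2Modes ht k) 0)).add
    (isL1Null_truncFT_deriv cφ lφ k 0)).add (isL1Null_truncFT_deriv_deriv cφ lφ k 0))
  obtain ⟨ns, -, hae⟩ := exists_subseq_tendsto_zero_ae h.1 h.2
  filter_upwards [hae] with ξ hξ
  simp only [sub_zero] at hξ
  obtain ⟨hξ, h4⟩ := tendsto_zero_of_add hξ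
  obtain ⟨hξ, h3⟩ := tendsto_zero_of_add hξ
  obtain ⟨h1, h2⟩ := tendsto_zero_of_add hξ
  replace h1 := tendsto_of_enorm_sub_sq h1
  replace h2 := tendsto_of_enorm_sub_sq h2
  replace h3 := tendsto_zero_of_enorm_sq h3
  replace h4 := tendsto_zero_of_enorm_sq h4
  have hl := ((h2.const_mul (-((k : ℂ) ^ 2 + (ξ : ℂ) ^ 2))).sub
    ((h3.const_mul (Complex.I * ξ)).const_mul 2)).add h4
  simp only [truncFT_poisson hs (isCutoff_cutoff _) k ξ ht, mul_zero, sub_zero, add_zero] at hl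
  exact tendsto_nhds_unique hl (h1.const_mul _)

section Data

variable {ux uy : ℝ → ℝ → ℝ}

/-- The norms of the data use the transform of the function `∇ · u`, the mode equations the symbol
applied to the transform of `u`. Both are limits of the same truncated quantity once the divergence
has square integrable modes. The lemma on the curl plays the same role. -/
theorem ae_ft_divergence (hx : ContDiff ℝ ∞ (Function.uncurry ux))
    (hy : ContDiff ℝ ∞ (Function.uncurry uy)) (hper : ∀ x y, ux (x + 2 * Real.pi) y = ux x y)
    (lx : l2Norm ux ≠ ⊤) (ly : l2Norm uy ≠ ⊤) (h : HasL2Modes (divergence ux uy)) (k : ℤ) :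
    ∀ᵐ ξ : ℝ, ft (divergence ux uy) k ξ = divHat ux uy k ξ := by
  have cx := (contDiff_dx hx).continuous
  have cy := (contDiff_dy hy).continuous
  have hn := (((isL1Null_truncFT_sub_ft hx.continuous
    (hasL2Modes_of_l2Norm_lt_top hx.continuous lx.lt_top k) 0).add
    (isL1Null_truncFT_sub_ft hy.continuous
      (hasL2Modes_of_l2Norm_lt_top hy.continuous ly.lt_top k) 0)).add
    (isL1Null_truncFT_deriv hy.continuous ly k 0)).add
    (isL1Null_truncFT_sub_ft (f := divergence ux uy) (cx.add cy) (h k) 0)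
  obtain ⟨ns, -, hae⟩ := exists_subseq_tendsto_zero_ae hn.1 hn.2
  filter_upwards [hae] with ξ hξ
  simp only [sub_zero] at hξ
  obtain ⟨hξ, h4⟩ := tendsto_zero_of_add hξ
  obtain ⟨hξ, h3⟩ := tendsto_zero_of_add hξ
  obtain ⟨h1, h2⟩ := tendsto_zero_of_add hξ
  replace h1 := tendsto_of_enorm_sub_sq h1
  replace h2 := tendsto_of_enorm_sub_sq h2
  replace h3 := tendsto_zero_of_enorm_sq h3
  replace h4 := tendsto_of_enorm_sub_sq h4
  have hl := (tendsto_truncDiv h1 h2).sub h3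
  rw [sub_zero] at hl
  refine tendsto_nhds_unique (h4.congr fun j => ?_) hl
  have hχ := isCutoff_cutoff (ns j)
  rw [show divergence ux uy = fun x y => dx ux x y + dy uy x y from rfl, truncFT_add hχ cx cy,
    truncFT_dx hχ hx hper, truncFT_dy hχ hy, truncDiv]
  ring

theorem ae_ft_curl (hx : ContDiff ℝ ∞ (Function.uncurry ux))
    (hy : ContDiff ℝ ∞ (Function.uncurry uy)) (hper : ∀ x y, uy (x + 2 * Real.pi) y = uy x y)
    (lx : l2Norm ux ≠ ⊤) (ly : l2Norm uy ≠ ⊤) (h : HasL2Modes (curl ux uy)) (k : ℤ) :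
    ∀ᵐ ξ : ℝ, ft (curl ux uy) k ξ = curlHat ux uy k ξ := by
  have cx := (contDiff_dy hx).continuous
  have cy := (contDiff_dx hy).continuous
  have cx' : Continuous (Function.uncurry fun x y => (-1 : ℝ) * dy ux x y) :=
    continuous_const.mul cx
  have hn := (((isL1Null_truncFT_sub_ft hx.continuous
    (hasL2Modes_of_l2Norm_lt_top hx.continuous lx.lt_top k) 0).add
    (isL1Null_truncFT_sub_ft hy.continuous
      (hasL2Modes_of_l2Norm_lt_top hy.continuous ly.lt_top k) 0)).add
    (isL1Null_truncFT_deriv hx.continuous lx k 0)).add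
    (isL1Null_truncFT_sub_ft (f := curl ux uy) (cx.neg.add cy) (h k) 0)
  obtain ⟨ns, -, hae⟩ := exists_subseq_tendsto_zero_ae hn.1 hn.2
  filter_upwards [hae] with ξ hξ
  simp only [sub_zero] at hξ
  obtain ⟨hξ, h4⟩ := tendsto_zero_of_add hξ
  obtain ⟨hξ, h3⟩ := tendsto_zero_of_add hξ
  obtain ⟨h1, h2⟩ := tendsto_zero_of_add hξ
  replace h1 := tendsto_of_enorm_sub_sq h1
  replace h2 := tendsto_of_enorm_sub_sq h2
  replace h3 := tendsto_zero_of_enorm_sq h3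
  replace h4 := tendsto_of_enorm_sub_sq h4
  have hl := (tendsto_truncCurl h1 h2).add h3
  rw [add_zero] at hl
  refine tendsto_nhds_unique (h4.congr fun j => ?_) hl
  have hχ := isCutoff_cutoff (ns j)
  rw [show curl ux uy = fun x y => (-1 : ℝ) * dy ux x y + dx uy x y by
      ext x y; rw [curl]; ring, truncFT_add hχ cx' cy, truncFT_const_mul,
    truncFT_dx hχ hy hper, truncFT_dy hχ hx, truncCurl]
  push_cast
  ring

end Data

theorem continuous_curl {ux uy : ℝ → ℝ → ℝ} (hx : ContDiff ℝ ∞ (Function.uncurry ux))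
    (hy : ContDiff ℝ ∞ (Function.uncurry uy)) : Continuous (Function.uncurry (curl ux uy)) :=
  (contDiff_dy hx).continuous.neg.add (contDiff_dx hy).continuous

section Linear

variable {f g : ℝ → ℝ → ℝ}

theorem intervalIntegrable_xMode (hf : Continuous (Function.uncurry f)) (k : ℤ) (y : ℝ) :
    IntervalIntegrable (fun x : ℝ => Complex.exp (-(Complex.I * k * x)) * (f x y : ℂ)) volume 0
      (2 * Real.pi) := by
  have h1 : Continuous fun x => f x y := hf.comp (Continuous.prodMk_left y)
  have h2 : Continuous fun x => (f x y : ℂ) := Complex.continuous_ofReal.comp h1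
  exact Continuous.intervalIntegrable (by fun_prop) _ _

theorem xMode_add (hf : Continuous (Function.uncurry f)) (hg : Continuous (Function.uncurry g))
    (k : ℤ) : xMode (fun x y => f x y + g x y) k = xMode f k + xMode g k := by
  ext y
  rw [Pi.add_apply, xMode, xMode, xMode, ← intervalIntegral.integral_add
    (intervalIntegrable_xMode hf k y) (intervalIntegrable_xMode hg k y)]
  refine intervalIntegral.integral_congr fun x _ => ?_
  push_cast; ring

theorem ae_ft_add (hf : Continuous (Function.uncurry f)) (hg : Continuous (Function.uncurry g))
    {k : ℤ} (h1 : MemLp (xMode f k) 2 volume) (h2 : MemLp (xMode g k) 2 volume) :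
    ∀ᵐ ξ : ℝ, ft (fun x y => f x y + g x y) k ξ = ft f k ξ + ft g k ξ := by
  have e := xMode_add hf hg k
  have h3 : MemLp (xMode (fun x y => f x y + g x y) k) 2 volume := by rw [e]; exact h1.add h2
  have h4 : h3.toLp _ = h1.toLp _ + h2.toLp _ := by
    rw [← MemLp.toLp_add]; congr
  filter_upwards [lpFT_add (h1.toLp _) (h2.toLp _)] with ξ hξ
  rw [ft_eq_lpFT h1, ft_eq_lpFT h2, ft_eq_lpFT h3, h4, hξ]

theorem xMode_const_mul (c : ℝ) (f : ℝ → ℝ → ℝ) (k : ℤ) :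
    xMode (fun x y => c * f x y) k = (c : ℂ) • xMode f k := by
  ext y
  rw [Pi.smul_apply, smul_eq_mul, xMode, xMode, ← intervalIntegral.integral_const_mul]
  refine intervalIntegral.integral_congr fun x _ => ?_
  push_cast; ring

theorem ae_ft_const_mul (c : ℝ) {k : ℤ} (h : MemLp (xMode f k) 2 volume) :
    ∀ᵐ ξ : ℝ, ft (fun x y => c * f x y) k ξ = c * ft f k ξ := by
  have h3 : MemLp (xMode (fun x y => c * f x y) k) 2 volume := by
    rw [xMode_const_mul]; exact h.const_smul _
  have h4 : h3.toLp _ = (c : ℂ) • h.toLp _ := by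
    rw [← MemLp.toLp_const_smul]; congr; exact xMode_const_mul c f k
  filter_upwards [lpFT_smul (c : ℂ) (h.toLp _)] with ξ hξ
  rw [ft_eq_lpFT h, ft_eq_lpFT h3, h4, hξ]

theorem ae_ft_zero_of_xAverage (hf : ∀ y, xAverage f y = 0) : ∀ᵐ ξ : ℝ, ft f 0 ξ = 0 := by
  have h0 : xMode f 0 = 0 := by
    ext y
    have h := hf y
    rw [xAverage, mul_eq_zero, or_iff_right (inv_ne_zero Real.two_pi_pos.ne')] at h
    simp [xMode, intervalIntegral.integral_ofReal, h]
  have h1 : MemLp (xMode f 0) 2 volume := by rw [h0]; exact MemLp.zero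
  have h2 := lintegral_ft h1
  simp only [h0, Pi.zero_apply, enorm_zero, ne_eq, OfNat.ofNat_ne_zero, not_false_eq_true,
    zero_pow, lintegral_zero, mul_zero] at h2
  rw [lintegral_eq_zero_iff' ((aestronglyMeasurable_ft f 0).enorm.pow_const 2)] at h2
  filter_upwards [h2] with ξ hξ
  simpa using hξ

end Linear

end ElectronEP

/-! ### Algebra of the frequency weights -/

namespace ElectronEP

theorem one_add_sq_le_mul (t a : ℝ) : 1 + t ^ 2 ≤ 2 * ((1 + (t - a) ^ 2) * (1 + a ^ 2)) := by
  nlinarith [sq_nonneg (t - 2 * a), sq_nonneg (t - a), sq_nonneg a, sq_nonneg ((t - a) * a)]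

theorem one_add_sub_sq_le_mul (t a : ℝ) : 1 + (t - a) ^ 2 ≤ 2 * ((1 + t ^ 2) * (1 + a ^ 2)) := by
  nlinarith [sq_nonneg (t + a), sq_nonneg t, sq_nonneg a, sq_nonneg (t * a)]

/-- In the next estimates `k2 = k²`, `κ = ⟨k⟩`, `x = ⟨ξ⟩`, `j = ⟨t⟩`, `J = ⟨k,ξ⟩`,
`s = ⟨ξ/k⟩`, `r = ⟨t - ξ/k⟩`. -/
structure IsFrequencyData (k2 κ x j J s r : ℝ) : Prop where
  one_le_k2 : 1 ≤ k2
  one_le_κ : 1 ≤ κ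
  one_le_x : 1 ≤ x
  one_le_j : 1 ≤ j
  one_le_s : 1 ≤ s
  one_le_r : 1 ≤ r
  κ_sq_le : κ ^ 2 ≤ 2 * k2
  s_le : s ≤ x
  x_sq_le : x ^ 2 ≤ k2 * s ^ 2
  j_le : j ≤ 2 * (r * s)
  r_le : r ≤ 2 * (j * s)
  J_sq_le : J ^ 2 ≤ 2 * (k2 * s ^ 2)
  le_J_sq : k2 * s ^ 2 ≤ J ^ 2

section Weights

variable {k2 κ x j J s r A C N D G : ℝ}

/-- Passes from the weights natural for the oscillator to powers of `⟨ξ⟩`, using `x² ≤ k²s²` and `s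
≤ x`. -/
theorem IsFrequencyData.source_le (h : IsFrequencyData k2 κ x j J s r) (hD : 0 ≤ D)
    (hG : 0 ≤ G) : N + D / (k2 * s ^ 2) + s / k2 * G ≤ N + D / x ^ 2 + x * G := by
  have := h.one_le_x
  have := h.one_le_k2
  have := h.one_le_s
  gcongr
  · exact h.x_sq_le
  · exact (div_le_self (by linarith) h.one_le_k2).trans h.s_le

theorem IsFrequencyData.inv_k2_le (h : IsFrequencyData k2 κ x j J s r) :
    1 / k2 ≤ 2 * (1 / κ ^ 2) := by
  have := h.one_le_κ
  have := h.one_le_k2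
  rw [← mul_div_assoc, mul_one, div_le_div_iff₀ (by linarith) (by positivity)]
  linarith [h.κ_sq_le]

theorem IsFrequencyData.inv_k2_le' (h : IsFrequencyData k2 κ x j J s r) :
    1 / k2 ≤ 2 * (1 / κ) := by
  refine h.inv_k2_le.trans ?_
  have := h.one_le_κ
  gcongr
  nlinarith

/-- The source of decay: `t` is the sum of `t - ξ/k` and `ξ/k`, so for large `t` the weights `r` and
`s` cannot both be small. -/
theorem IsFrequencyData.inv_rs_le (h : IsFrequencyData k2 κ x j J s r) :
    1 / (r * s) ≤ 2 * (1 / j) := by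
  have := h.one_le_r
  have := h.one_le_s
  have := h.one_le_j
  rw [← mul_div_assoc, mul_one, div_le_div_iff₀ (by positivity) (by linarith)]
  linarith [h.j_le]

/-- The factor `r/s` divided by `k²r²` is `1/(k²rs)`, which decays like `1/⟨t⟩` and costs no weight
in `ξ` beyond those in the source. The conserved part has no gain `1/s`: there `1/r² = s²/(rs)²`
decays faster at the price of two powers of `⟨ξ⟩`. -/
theorem IsFrequencyData.density_decay (h : IsFrequencyData k2 κ x j J s r) (hC : 0 ≤ C)
    (hN : 0 ≤ N) (hD : 0 ≤ D) (hG : 0 ≤ G)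
    (hA : A ≤ C * (r / s * (N + D / (k2 * s ^ 2) + s / k2 * G))) :
    (A + G) / (k2 * r ^ 2) ≤ (4 * C + 8) * (1 / j * (1 / κ * N) + 1 / j * (x / κ * G) +
      1 / j ^ 2 * (x ^ 2 / κ ^ 2 * G) + 1 / j * (1 / (κ * x ^ 2) * D)) := by
  have hr := h.one_le_r
  have hs := h.one_le_s
  have hj := h.one_le_j
  have hk := h.one_le_k2
  have hκ := h.one_le_κ
  have hx := h.one_le_x
  have e1 : A / (k2 * r ^ 2) ≤ 4 * C * (1 / j * (1 / κ) * (N + D / x ^ 2 + x * G)) := by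
    calc A / (k2 * r ^ 2) ≤ C * (r / s * (N + D / (k2 * s ^ 2) + s / k2 * G)) / (k2 * r ^ 2) := by
          gcongr
      _ = C * ((1 / (r * s)) * (1 / k2) * (N + D / (k2 * s ^ 2) + s / k2 * G)) := by field_simp
      _ ≤ C * ((2 * (1 / j)) * (2 * (1 / κ)) * (N + D / x ^ 2 + x * G)) := by
          gcongr ?_ * (?_ * ?_ * ?_)
          · exact h.inv_rs_le
          · exact h.inv_k2_le'
          · exact h.source_le hD hG
      _ = _ := by ring
  have e2 : G / (k2 * r ^ 2) ≤ 8 * (1 / j ^ 2 * (x ^ 2 / κ ^ 2 * G)) := by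
    calc G / (k2 * r ^ 2) = (1 / k2) * ((1 / (r * s)) ^ 2 * s ^ 2 * G) := by field_simp
      _ ≤ (2 * (1 / κ ^ 2)) * ((2 * (1 / j)) ^ 2 * x ^ 2 * G) := by
          gcongr ?_ * (?_ ^ 2 * ?_ ^ 2 * _)
          · exact h.inv_k2_le
          · exact h.inv_rs_le
          · exact h.s_le
      _ = _ := by ring
  have p1 : 0 ≤ 1 / j * (1 / κ) * (N + D / x ^ 2 + x * G) := by positivity
  have p2 : 0 ≤ C * (1 / j ^ 2 * (x ^ 2 / κ ^ 2 * G)) := by positivity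
  have e3 : 1 / j * (1 / κ * N) + 1 / j * (x / κ * G) +
      1 / j ^ 2 * (x ^ 2 / κ ^ 2 * G) + 1 / j * (1 / (κ * x ^ 2) * D) =
      1 / j * (1 / κ) * (N + D / x ^ 2 + x * G) + 1 / j ^ 2 * (x ^ 2 / κ ^ 2 * G) := by
    field_simp; ring
  rw [e3, add_div]
  linarith

/-- Now the weight is `k²/(k²r²)² = 1/(k²r⁴)`. Writing `(r/s)/r⁴ = s²/(rs)³` gives the faster rate,
and the factor `s²` is the extra `y`-derivative in the norms. -/
theorem IsFrequencyData.curl_decay (h : IsFrequencyData k2 κ x j J s r) (hC : 0 ≤ C)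
    (hN : 0 ≤ N) (hD : 0 ≤ D) (hG : 0 ≤ G)
    (hA : A ≤ C * (r / s * (N + D / (k2 * s ^ 2) + s / k2 * G))) :
    k2 * (A + G) / (k2 * r ^ 2) ^ 2 ≤ (16 * C + 32) * (1 / j ^ 3 * (x ^ 2 / κ * N) +
      1 / j ^ 3 * (x ^ 3 / κ * G) + 1 / j ^ 4 * (x ^ 4 / κ ^ 2 * G) + 1 / j ^ 3 * (1 / κ * D)) := by
  have hr := h.one_le_r
  have hs := h.one_le_s
  have hj := h.one_le_j
  have hk := h.one_le_k2
  have hκ := h.one_le_κ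
  have hx := h.one_le_x
  have e0 : s ^ 2 * (N + D / (k2 * s ^ 2) + s / k2 * G) ≤ x ^ 2 * N + D + x ^ 3 * G := by
    calc s ^ 2 * (N + D / (k2 * s ^ 2) + s / k2 * G) = s ^ 2 * N + D / k2 + s ^ 3 / k2 * G := by
          field_simp
      _ ≤ _ := by
          have := h.s_le
          gcongr
          · exact div_le_self hD hk
          · exact (div_le_self (by positivity) hk).trans (by gcongr)
  have e1 : k2 * A / (k2 * r ^ 2) ^ 2 ≤
      16 * C * (1 / j ^ 3 * (1 / κ) * (x ^ 2 * N + D + x ^ 3 * G)) := by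
    calc k2 * A / (k2 * r ^ 2) ^ 2
        ≤ k2 * (C * (r / s * (N + D / (k2 * s ^ 2) + s / k2 * G))) / (k2 * r ^ 2) ^ 2 := by
          gcongr
      _ = C * ((1 / (r * s)) ^ 3 * (1 / k2) *
            (s ^ 2 * (N + D / (k2 * s ^ 2) + s / k2 * G))) := by field_simp
      _ ≤ C * ((2 * (1 / j)) ^ 3 * (2 * (1 / κ)) * (x ^ 2 * N + D + x ^ 3 * G)) := by
          gcongr ?_ * (?_ ^ 3 * ?_ * ?_)
          · exact h.inv_rs_le
          · exact h.inv_k2_le'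
      _ = _ := by ring
  have e2 : k2 * G / (k2 * r ^ 2) ^ 2 ≤ 32 * (1 / j ^ 4 * (x ^ 4 / κ ^ 2 * G)) := by
    calc k2 * G / (k2 * r ^ 2) ^ 2 = (1 / k2) * ((1 / (r * s)) ^ 4 * s ^ 4 * G) := by field_simp
      _ ≤ (2 * (1 / κ ^ 2)) * ((2 * (1 / j)) ^ 4 * x ^ 4 * G) := by
          gcongr ?_ * (?_ ^ 4 * ?_ ^ 4 * _)
          · exact h.inv_k2_le
          · exact h.inv_rs_le
          · exact h.s_le
      _ = _ := by ring
  have p1 : 0 ≤ 1 / j ^ 3 * (1 / κ) * (x ^ 2 * N + D + x ^ 3 * G) := by positivity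
  have p2 : 0 ≤ C * (1 / j ^ 4 * (x ^ 4 / κ ^ 2 * G)) := by positivity
  have e3 : 1 / j ^ 3 * (x ^ 2 / κ * N) + 1 / j ^ 3 * (x ^ 3 / κ * G) +
      1 / j ^ 4 * (x ^ 4 / κ ^ 2 * G) + 1 / j ^ 3 * (1 / κ * D) =
      1 / j ^ 3 * (1 / κ) * (x ^ 2 * N + D + x ^ 3 * G) + 1 / j ^ 4 * (x ^ 4 / κ ^ 2 * G) := by
    field_simp; ring
  rw [e3, mul_add, add_div]
  linarith

/-- Here `r/s ≤ 2⟨t⟩` is the only use of time. Since `J²` is comparable to `k²s²`, the divergence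
enters through its `H⁻¹` norm; the conserved part is estimated generously by `s/k² ≤ J²`. -/
theorem IsFrequencyData.energy_growth (h : IsFrequencyData k2 κ x j J s r) (hC : 0 ≤ C)
    (hN : 0 ≤ N) (hD : 0 ≤ D) (hG : 0 ≤ G)
    (hA : A ≤ C * (r / s * (N + D / (k2 * s ^ 2) + s / k2 * G))) :
    A ≤ 4 * C * (j * N + j * (1 / J ^ 2 * D) + j * (J ^ 2 * G)) := by
  have hr := h.one_le_r
  have hs := h.one_le_s
  have hj := h.one_le_j
  have hk := h.one_le_k2
  have hJ : 0 < J ^ 2 := lt_of_lt_of_le (by positivity) h.le_J_sq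
  have e1 : D / (k2 * s ^ 2) ≤ 2 * (1 / J ^ 2 * D) := by
    rw [div_le_iff₀ (by positivity)]
    calc D = (1 / J ^ 2 * D) * J ^ 2 := by rw [mul_right_comm, one_div_mul_cancel hJ.ne', one_mul]
      _ ≤ (1 / J ^ 2 * D) * (2 * (k2 * s ^ 2)) := by gcongr; exact h.J_sq_le
      _ = _ := by ring
  have e2 : s / k2 * G ≤ J ^ 2 * G := by
    gcongr
    exact (div_le_self (by linarith) hk).trans (le_trans (by nlinarith [sq_nonneg s]) h.le_J_sq)
  have e3 : r / s ≤ 2 * j := by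
    rw [div_le_iff₀ (by linarith)]
    linarith [h.r_le]
  have e4 : 0 ≤ 1 / J ^ 2 * D := by positivity
  have e5 : 0 ≤ J ^ 2 * G := by positivity
  calc A ≤ C * (r / s * (N + D / (k2 * s ^ 2) + s / k2 * G)) := hA
    _ ≤ C * ((2 * j) * (2 * N + 2 * (1 / J ^ 2 * D) + 2 * (J ^ 2 * G))) := by
        gcongr C * (?_ * ?_)
        linarith
    _ = _ := by ring

end Weights

theorem one_le_jap (a : ℝ) : 1 ≤ jap a := Real.one_le_sqrt.2 (by nlinarith [sq_nonneg a])

theorem jap_pos (a : ℝ) : 0 < jap a := one_pos.trans_le (one_le_jap a)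

theorem jap_sq (a : ℝ) : jap a ^ 2 = 1 + a ^ 2 := Real.sq_sqrt (by positivity)

theorem jap₂_sq (a b : ℝ) : jap₂ a b ^ 2 = 1 + a ^ 2 + b ^ 2 := Real.sq_sqrt (by positivity)

theorem jap₂_pos (a b : ℝ) : 0 < jap₂ a b := Real.sqrt_pos.2 (by positivity)

theorem isFrequencyData_jap {k : ℝ} (hk : 1 ≤ k ^ 2) (ξ t : ℝ) :
    IsFrequencyData (k ^ 2) (jap k) (jap ξ) (jap t) (jap₂ k ξ) (jap (ξ / k))
      (jap (t - ξ / k)) := by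
  have h0 : k ≠ 0 := by rintro rfl; norm_num at hk
  have e : k ^ 2 * jap (ξ / k) ^ 2 = k ^ 2 + ξ ^ 2 := by
    rw [jap_sq, div_pow]; field_simp
  refine ⟨hk, one_le_jap _, one_le_jap _, one_le_jap _, one_le_jap _, one_le_jap _, ?_, ?_, ?_,
    ?_, ?_, ?_, ?_⟩
  · rw [jap_sq]; linarith
  · refine Real.sqrt_le_sqrt ?_
    rw [div_pow]
    gcongr
    exact div_le_self (sq_nonneg _) hk
  · rw [e, jap_sq]; linarith
  · refine abs_le_of_sq_le_sq' ?_ (by have := jap_pos (t - ξ / k); have := jap_pos (ξ / k); positivity)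
      |>.2
    rw [mul_pow, mul_pow, jap_sq, jap_sq, jap_sq]
    nlinarith [one_add_sq_le_mul t (ξ / k), sq_nonneg t]
  · refine abs_le_of_sq_le_sq' ?_ (by have := jap_pos t; have := jap_pos (ξ / k); positivity) |>.2
    rw [mul_pow, mul_pow, jap_sq, jap_sq, jap_sq]
    nlinarith [one_add_sub_sq_le_mul t (ξ / k), sq_nonneg (t - ξ / k)]
  · rw [e, jap₂_sq]; nlinarith [sq_nonneg ξ]
  · rw [e, jap₂_sq]; linarith

end ElectronEP

/-! ### Weighted norms and summation over frequencies -/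

namespace ElectronEP

/-- The norm `(∑ₖ ∫ w(k,ξ) |f̂(k,ξ)|² dξ)^{1/2}`. -/
noncomputable def weightedNorm (w : ℤ → ℝ → ℝ) (f : ℝ → ℝ → ℝ) : ℝ≥0∞ :=
  (∑' k : ℤ, ∫⁻ ξ : ℝ, ENNReal.ofReal (w k ξ) * ‖ft f k ξ‖ₑ ^ (2 : ℕ)) ^ (1 / 2 : ℝ)

theorem sq_rpow_half (x : ℝ≥0∞) : (x ^ (1 / 2 : ℝ)) ^ (2 : ℕ) = x := by
  rw [← ENNReal.rpow_natCast, ← ENNReal.rpow_mul]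
  norm_num

theorem le_of_sq_le_sq {x y : ℝ≥0∞} (h : x ^ (2 : ℕ) ≤ y ^ (2 : ℕ)) : x ≤ y :=
  (ENNReal.pow_le_pow_left_iff two_ne_zero).1 h

theorem ofReal_sqrt_sq {K : ℝ} (hK : 0 ≤ K) :
    ENNReal.ofReal (Real.sqrt K) ^ (2 : ℕ) = ENNReal.ofReal K := by
  rw [← ENNReal.ofReal_pow (Real.sqrt_nonneg _), Real.sq_sqrt hK]

/-- Integration and summation of a pointwise bound in Fourier variables, along characteristics. -/
theorem le_sum_weightedNorm {n : ℕ} {X : ℝ≥0∞} {g : ℤ → ℝ → ℂ}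
    (hX : X ^ (2 : ℕ) ≤ ∑' k : ℤ, ∫⁻ ξ, ‖g k ξ‖ₑ ^ (2 : ℕ)) {K T : ℝ} (hK : 0 ≤ K)
    {b : Fin n → ℝ} (hb : ∀ i, 0 ≤ b i) {w : Fin n → ℤ → ℝ → ℝ}
    (hw : ∀ i k, Measurable (w i k)) (hw0 : ∀ i k ξ, 0 ≤ w i k ξ) {f : Fin n → ℝ → ℝ → ℝ}
    (h : ∀ k : ℤ, ∀ᵐ ξ : ℝ, ‖g k (ξ - k * T)‖ ^ 2 ≤
      K * ∑ i, b i ^ 2 * (w i k ξ * ‖ft (f i) k ξ‖ ^ 2)) :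
    X ≤ ENNReal.ofReal (Real.sqrt K) * ∑ i, ENNReal.ofReal (b i) * weightedNorm (w i) (f i) := by
  have hpt : ∀ k : ℤ, ∀ᵐ ξ : ℝ, ‖g k (ξ - k * T)‖ₑ ^ (2 : ℕ) ≤ ENNReal.ofReal K *
      ∑ i, ENNReal.ofReal (b i) ^ (2 : ℕ) *
        (ENNReal.ofReal (w i k ξ) * ‖ft (f i) k ξ‖ₑ ^ (2 : ℕ)) := fun k => by
    filter_upwards [h k] with ξ hξ
    have h1 := ENNReal.ofReal_le_ofReal hξ
    rw [ENNReal.ofReal_mul hK, ENNReal.ofReal_sum_of_nonneg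
      fun i _ => by have := hw0 i k ξ; positivity] at h1
    simp only [ENNReal.ofReal_mul (sq_nonneg _), ENNReal.ofReal_mul (hw0 _ _ _),
      ENNReal.ofReal_pow (norm_nonneg _), ENNReal.ofReal_pow (hb _), ofReal_norm] at h1
    exact h1
  have hmeas : ∀ i (k : ℤ), AEMeasurable (fun ξ => ENNReal.ofReal (w i k ξ) *
      ‖ft (f i) k ξ‖ₑ ^ (2 : ℕ)) volume := fun i k =>
    (hw i k).ennreal_ofReal.aemeasurable.mul ((aestronglyMeasurable_ft (f i) k).enorm.pow_const 2)
  have hsum : ∑' k : ℤ, ∫⁻ ξ, ‖g k ξ‖ₑ ^ (2 : ℕ) ≤ ENNReal.ofReal K *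
      ∑ i, (ENNReal.ofReal (b i) * weightedNorm (w i) (f i)) ^ (2 : ℕ) := by
    -- At fixed `k` the passage to characteristics is a translation in `ξ`, which preserves Lebesgue
    -- measure.
    calc ∑' k : ℤ, ∫⁻ ξ, ‖g k ξ‖ₑ ^ (2 : ℕ)
        = ∑' k : ℤ, ∫⁻ ξ, ‖g k (ξ - k * T)‖ₑ ^ (2 : ℕ) := tsum_congr fun k =>
          (lintegral_sub_right_eq_self (fun ξ => ‖g k ξ‖ₑ ^ (2 : ℕ)) (k * T)).symm
      _ ≤ ∑' k : ℤ, ∫⁻ ξ, ENNReal.ofReal K * ∑ i, ENNReal.ofReal (b i) ^ (2 : ℕ) *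
            (ENNReal.ofReal (w i k ξ) * ‖ft (f i) k ξ‖ₑ ^ (2 : ℕ)) :=
          ENNReal.tsum_le_tsum fun k => lintegral_mono_ae (hpt k)
      _ = ∑' k : ℤ, ENNReal.ofReal K * ∑ i, ENNReal.ofReal (b i) ^ (2 : ℕ) *
            ∫⁻ ξ, (ENNReal.ofReal (w i k ξ) * ‖ft (f i) k ξ‖ₑ ^ (2 : ℕ)) := by
          refine tsum_congr fun k => ?_
          rw [lintegral_const_mul' _ _ ENNReal.ofReal_ne_top,
            lintegral_finsetSum' _ fun i _ => (hmeas i k).const_mul _]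
          simp only [lintegral_const_mul' _ _ (ENNReal.pow_ne_top ENNReal.ofReal_ne_top)]
      _ = _ := by
          rw [ENNReal.tsum_mul_left, Summable.tsum_finsetSum fun i _ => ENNReal.summable]
          simp only [ENNReal.tsum_mul_left, mul_pow, weightedNorm, sq_rpow_half]
  refine le_of_sq_le_sq (hX.trans (hsum.trans ?_))
  rw [mul_pow, ofReal_sqrt_sq hK]
  gcongr
  -- A sum of squares of nonnegative terms is at most the square of the sum, so a bound on squares
  -- yields one on norms with the same constant.
  exact Finset.sum_sq_le_sq_sum_of_nonneg fun _ _ => zero_le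

theorem continuous_jap : Continuous jap := by unfold jap; fun_prop

theorem weightedNorm_one {f : ℝ → ℝ → ℝ} (hf : Continuous (Function.uncurry f))
    (h : HasL2Modes f) : weightedNorm (fun _ _ => 1) f = l2Norm f := by
  have h1 : weightedNorm (fun _ _ => 1) f ^ (2 : ℕ) = l2Norm f ^ (2 : ℕ) := by
    rw [weightedNorm, sq_rpow_half, l2Norm_sq_eq_tsum_ft hf h]
    simp only [ENNReal.ofReal_one, one_mul]
  exact le_antisymm (le_of_sq_le_sq h1.le) (le_of_sq_le_sq h1.ge)

/-- The weight of the norm of `H^r_x H^s_y`. -/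
noncomputable def anisoWeight (r s : ℝ) (k : ℤ) (ξ : ℝ) : ℝ := jap k ^ (2 * r) * jap ξ ^ (2 * s)

/-- The weight of the norm of `H^s`. -/
noncomputable def sobWeight (s : ℝ) (k : ℤ) (ξ : ℝ) : ℝ := jap₂ k ξ ^ (2 * s)

theorem measurable_anisoWeight (r s : ℝ) (k : ℤ) : Measurable (anisoWeight r s k) := by
  have := continuous_jap.measurable
  unfold anisoWeight; fun_prop

theorem anisoWeight_nonneg (r s : ℝ) (k : ℤ) (ξ : ℝ) : 0 ≤ anisoWeight r s k ξ := by
  have := jap_pos k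
  have := jap_pos ξ
  unfold anisoWeight; positivity

theorem measurable_sobWeight (s : ℝ) (k : ℤ) : Measurable (sobWeight s k) := by
  unfold sobWeight jap₂; fun_prop

theorem sobWeight_nonneg (s : ℝ) (k : ℤ) (ξ : ℝ) : 0 ≤ sobWeight s k ξ := by
  have := jap₂_pos k ξ
  unfold sobWeight; positivity

theorem anisoNorm_eq (r s : ℝ) (f : ℝ → ℝ → ℝ) :
    anisoNorm r s f = weightedNorm (anisoWeight r s) f := rfl

theorem sobNorm_eq (s : ℝ) (f : ℝ → ℝ → ℝ) : sobNorm s f = weightedNorm (sobWeight s) f := rfl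

section Values

variable (k : ℤ) (ξ : ℝ)

theorem anisoWeight_eq {r s : ℝ} {a b : ℕ} (hr : 2 * r = -a) (hs : 2 * s = b) :
    anisoWeight r s k ξ = jap ξ ^ b / jap k ^ a := by
  rw [anisoWeight, hr, hs, Real.rpow_neg (jap_pos _).le, Real.rpow_natCast, Real.rpow_natCast,
    div_eq_inv_mul]

theorem anisoWeight_neg_eq {r s : ℝ} {a b : ℕ} (hr : 2 * r = -a) (hs : 2 * s = -b) :
    anisoWeight r s k ξ = 1 / (jap k ^ a * jap ξ ^ b) := by
  rw [anisoWeight, hr, hs, Real.rpow_neg (jap_pos _).le, Real.rpow_neg (jap_pos _).le,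
    Real.rpow_natCast, Real.rpow_natCast, one_div, mul_inv]

theorem sobWeight_one : sobWeight 1 k ξ = jap₂ k ξ ^ 2 := by
  rw [sobWeight, mul_one, Real.rpow_ofNat]

theorem sobWeight_neg_one : sobWeight (-1) k ξ = 1 / jap₂ k ξ ^ 2 := by
  rw [sobWeight, mul_neg_one, Real.rpow_neg (jap₂_pos _ _).le, Real.rpow_ofNat, one_div]

end Values

end ElectronEP

/-! ### Rates, weights and data in the three estimates -/

namespace ElectronEP

/-- The combinations of the data that enter the decay estimates. -/
noncomputable def decayField (m : ℝ) (η ψ ω : ℝ → ℝ → ℝ) : Fin 4 → ℝ → ℝ → ℝ :=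
  ![fun x y => Real.sqrt (1 / m) * η x y, fun x y => η x y + ω x y, fun x y => η x y + ω x y, ψ]

/-- The combinations of the data that enter the growth estimate. -/
noncomputable def growthField (m : ℝ) (η ψ ω : ℝ → ℝ → ℝ) : Fin 3 → ℝ → ℝ → ℝ :=
  ![fun x y => Real.sqrt (1 / m) * η x y, ψ, fun x y => η x y + ω x y]

/-- The weights in the decay estimate of `ℙ[u]^x` and `φ`. -/
noncomputable def slowWeight : Fin 4 → ℤ → ℝ → ℝ :=
  ![anisoWeight (-1 / 2) 0, anisoWeight (-1 / 2) (1 / 2), anisoWeight (-1) 1,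
    anisoWeight (-1 / 2) (-1)]

/-- The weights in the decay estimate of `ℙ[u]^y`. -/
noncomputable def fastWeight : Fin 4 → ℤ → ℝ → ℝ :=
  ![anisoWeight (-1 / 2) 1, anisoWeight (-1 / 2) (3 / 2), anisoWeight (-1) 2,
    anisoWeight (-1 / 2) 0]

/-- The weights in the growth estimate. -/
noncomputable def growthWeight : Fin 3 → ℤ → ℝ → ℝ :=
  ![fun _ _ => 1, sobWeight (-1), sobWeight 1]

/-- The decay rates of `ℙ[u]^x` and `φ`. -/
noncomputable def slowRate (m t : ℝ) : Fin 4 → ℝ :=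
  ![Real.sqrt m / jap t ^ (1 / 2 : ℝ), Real.sqrt m / jap t ^ (1 / 2 : ℝ), 1 / jap t,
    Real.sqrt m / jap t ^ (1 / 2 : ℝ)]

/-- The decay rates of `ℙ[u]^y`. -/
noncomputable def fastRate (m t : ℝ) : Fin 4 → ℝ :=
  ![Real.sqrt m / jap t ^ (3 / 2 : ℝ), Real.sqrt m / jap t ^ (3 / 2 : ℝ), 1 / jap t ^ 2,
    Real.sqrt m / jap t ^ (3 / 2 : ℝ)]

/-- The growth rate. -/
noncomputable def growthRate (t : ℝ) : Fin 3 → ℝ := fun _ => jap t ^ (1 / 2 : ℝ)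

theorem slowRate_nonneg (m t : ℝ) (i : Fin 4) : 0 ≤ slowRate m t i := by
  have := jap_pos t
  fin_cases i <;> simp [slowRate] <;> positivity

theorem fastRate_nonneg (m t : ℝ) (i : Fin 4) : 0 ≤ fastRate m t i := by
  have := jap_pos t
  fin_cases i <;> simp [fastRate] <;> positivity

theorem growthRate_nonneg (t : ℝ) (i : Fin 3) : 0 ≤ growthRate t i := by
  have := jap_pos t
  unfold growthRate; positivity

theorem slowWeight_nonneg (i : Fin 4) (k : ℤ) (ξ : ℝ) : 0 ≤ slowWeight i k ξ := by
  fin_cases i <;> exact anisoWeight_nonneg _ _ _ _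

theorem fastWeight_nonneg (i : Fin 4) (k : ℤ) (ξ : ℝ) : 0 ≤ fastWeight i k ξ := by
  fin_cases i <;> exact anisoWeight_nonneg _ _ _ _

theorem growthWeight_nonneg (i : Fin 3) (k : ℤ) (ξ : ℝ) : 0 ≤ growthWeight i k ξ := by
  fin_cases i
  · exact zero_le_one
  all_goals exact sobWeight_nonneg _ _ _

theorem measurable_slowWeight (i : Fin 4) (k : ℤ) : Measurable (slowWeight i k) := by
  fin_cases i <;> exact measurable_anisoWeight _ _ _

theorem measurable_fastWeight (i : Fin 4) (k : ℤ) : Measurable (fastWeight i k) := by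
  fin_cases i <;> exact measurable_anisoWeight _ _ _

theorem measurable_growthWeight (i : Fin 3) (k : ℤ) : Measurable (growthWeight i k) := by
  fin_cases i
  · exact measurable_const
  all_goals exact measurable_sobWeight _ _

theorem rpow_div_two_sq {a : ℝ} (ha : 0 ≤ a) (n : ℕ) : (a ^ (n / 2 : ℝ)) ^ 2 = a ^ n := by
  rw [← Real.rpow_natCast, ← Real.rpow_mul ha, ← Real.rpow_natCast]
  congr 1
  push_cast; ring

section Sums

variable {m : ℝ} {η ψ ω : ℝ → ℝ → ℝ} {k : ℤ} {ξ : ℝ} {N₀ : ℂ}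

/-- The factor `√m` of the rate cancels `m^{-1/2}` on the density, so the first term is free of `m`,
while the second and fourth keep a factor `m`. -/
theorem slow_sum_eq (hm : 0 < m)
    (hN : ft (fun x y => Real.sqrt (1 / m) * η x y) k ξ = (Real.sqrt (1 / m) : ℝ) * N₀) (t : ℝ) :
    ∑ i, slowRate m t i ^ 2 * (slowWeight i k ξ * ‖ft (decayField m η ψ ω i) k ξ‖ ^ 2) =
      1 / jap t * (1 / jap k * ‖N₀‖ ^ 2) +
      m * (1 / jap t * (jap ξ / jap k * ‖ft (fun x y => η x y + ω x y) k ξ‖ ^ 2)) +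
      1 / jap t ^ 2 * (jap ξ ^ 2 / jap k ^ 2 * ‖ft (fun x y => η x y + ω x y) k ξ‖ ^ 2) +
      m * (1 / jap t * (1 / (jap k * jap ξ ^ 2) * ‖ft ψ k ξ‖ ^ 2)) := by
  have h1 : (jap t ^ (1 / 2 : ℝ)) ^ 2 = jap t := by
    simpa using rpow_div_two_sq (jap_pos t).le 1
  have w1 : anisoWeight (-1 / 2) 0 k ξ = 1 / jap k := by
    rw [anisoWeight_eq k ξ (a := 1) (b := 0) (by norm_num) (by norm_num), pow_zero, pow_one]
  have w2 : anisoWeight (-1 / 2) (1 / 2) k ξ = jap ξ / jap k := by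
    rw [anisoWeight_eq k ξ (a := 1) (b := 1) (by norm_num) (by norm_num), pow_one, pow_one]
  have w3 : anisoWeight (-1) 1 k ξ = jap ξ ^ 2 / jap k ^ 2 :=
    anisoWeight_eq k ξ (a := 2) (b := 2) (by norm_num) (by norm_num)
  have w4 : anisoWeight (-1 / 2) (-1) k ξ = 1 / (jap k * jap ξ ^ 2) := by
    rw [anisoWeight_neg_eq k ξ (a := 1) (b := 2) (by norm_num) (by norm_num), pow_one]
  have hn : ‖((Real.sqrt (1 / m) : ℝ) : ℂ) * N₀‖ ^ 2 = 1 / m * ‖N₀‖ ^ 2 := by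
    rw [norm_mul, mul_pow, Complex.norm_real, Real.norm_eq_abs, sq_abs,
      Real.sq_sqrt (by positivity)]
  simp only [Fin.sum_univ_four, slowRate, slowWeight, decayField, Matrix.cons_val, w1, w2, w3, w4,
    hN, hn, div_pow, h1, Real.sq_sqrt hm.le, one_pow]
  have := jap_pos t
  field_simp

theorem fast_sum_eq (hm : 0 < m)
    (hN : ft (fun x y => Real.sqrt (1 / m) * η x y) k ξ = (Real.sqrt (1 / m) : ℝ) * N₀) (t : ℝ) :
    ∑ i, fastRate m t i ^ 2 * (fastWeight i k ξ * ‖ft (decayField m η ψ ω i) k ξ‖ ^ 2) =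
      1 / jap t ^ 3 * (jap ξ ^ 2 / jap k * ‖N₀‖ ^ 2) +
      m * (1 / jap t ^ 3 * (jap ξ ^ 3 / jap k * ‖ft (fun x y => η x y + ω x y) k ξ‖ ^ 2)) +
      1 / jap t ^ 4 * (jap ξ ^ 4 / jap k ^ 2 * ‖ft (fun x y => η x y + ω x y) k ξ‖ ^ 2) +
      m * (1 / jap t ^ 3 * (1 / jap k * ‖ft ψ k ξ‖ ^ 2)) := by
  have h1 : (jap t ^ (3 / 2 : ℝ)) ^ 2 = jap t ^ 3 := by
    simpa using rpow_div_two_sq (jap_pos t).le 3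
  have w1 : anisoWeight (-1 / 2) 1 k ξ = jap ξ ^ 2 / jap k := by
    rw [anisoWeight_eq k ξ (a := 1) (b := 2) (by norm_num) (by norm_num), pow_one]
  have w2 : anisoWeight (-1 / 2) (3 / 2) k ξ = jap ξ ^ 3 / jap k := by
    rw [anisoWeight_eq k ξ (a := 1) (b := 3) (by norm_num) (by norm_num), pow_one]
  have w3 : anisoWeight (-1) 2 k ξ = jap ξ ^ 4 / jap k ^ 2 :=
    anisoWeight_eq k ξ (a := 2) (b := 4) (by norm_num) (by norm_num)
  have w4 : anisoWeight (-1 / 2) 0 k ξ = 1 / jap k := by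
    rw [anisoWeight_eq k ξ (a := 1) (b := 0) (by norm_num) (by norm_num), pow_zero, pow_one]
  have hn : ‖((Real.sqrt (1 / m) : ℝ) : ℂ) * N₀‖ ^ 2 = 1 / m * ‖N₀‖ ^ 2 := by
    rw [norm_mul, mul_pow, Complex.norm_real, Real.norm_eq_abs, sq_abs,
      Real.sq_sqrt (by positivity)]
  simp only [Fin.sum_univ_four, fastRate, fastWeight, decayField, Matrix.cons_val, w1, w2, w3, w4,
    hN, hn, div_pow, h1, Real.sq_sqrt hm.le, one_pow]
  have := jap_pos t
  field_simp

theorem growth_sum_eq (hm : 0 < m)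
    (hN : ft (fun x y => Real.sqrt (1 / m) * η x y) k ξ = (Real.sqrt (1 / m) : ℝ) * N₀) (t : ℝ) :
    ∑ i, growthRate t i ^ 2 * (growthWeight i k ξ * ‖ft (growthField m η ψ ω i) k ξ‖ ^ 2) =
      1 / m * (jap t * ‖N₀‖ ^ 2) + jap t * (1 / jap₂ k ξ ^ 2 * ‖ft ψ k ξ‖ ^ 2) +
      jap t * (jap₂ k ξ ^ 2 * ‖ft (fun x y => η x y + ω x y) k ξ‖ ^ 2) := by
  have h1 : (jap t ^ (1 / 2 : ℝ)) ^ 2 = jap t := by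
    simpa using rpow_div_two_sq (jap_pos t).le 1
  have hn : ‖((Real.sqrt (1 / m) : ℝ) : ℂ) * N₀‖ ^ 2 = 1 / m * ‖N₀‖ ^ 2 := by
    rw [norm_mul, mul_pow, Complex.norm_real, Real.norm_eq_abs, sq_abs,
      Real.sq_sqrt (by positivity)]
  simp only [Fin.sum_univ_three, growthRate, growthWeight, growthField, Matrix.cons_val,
    sobWeight_one, sobWeight_neg_one, hN, hn, h1]
  ring

end Sums

end ElectronEP

/-! ### The estimates at a single frequency -/

namespace ElectronEP

/-- The estimates at a single frequency, in terms of the transforms `N₀, D₀, Γ` of the data and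
`N, D, W` of the solution. -/
theorem mode_estimates {C m p : ℝ} (hC : 0 ≤ C) (hm : 0 < m) {k : ℤ} (hk : k ≠ 0) {ξ t : ℝ}
    (hp : p = k ^ 2 + (ξ - k * t) ^ 2) {N D W N₀ D₀ Γ : ℂ} (hΓ : N + W = Γ)
    (h : ‖N‖ ^ 2 + ‖D‖ ^ 2 / (k ^ 2 * (1 + (t - ξ / k) ^ 2)) ≤
      C * (Real.sqrt (1 + (t - ξ / k) ^ 2) / Real.sqrt (1 + (ξ / k) ^ 2) *
        (‖N₀‖ ^ 2 + ‖D₀‖ ^ 2 / (k ^ 2 * (1 + (ξ / k) ^ 2)) +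
          Real.sqrt (1 + (ξ / k) ^ 2) / k ^ 2 * ‖Γ‖ ^ 2))) :
    (‖N‖ ^ 2 + ‖W‖ ^ 2) / p ≤ (1 + 1 / m) * (3 * (4 * C + 8)) *
      (1 / jap t * (1 / jap k * ‖N₀‖ ^ 2) + m * (1 / jap t * (jap ξ / jap k * ‖Γ‖ ^ 2)) +
        1 / jap t ^ 2 * (jap ξ ^ 2 / jap k ^ 2 * ‖Γ‖ ^ 2) +
        m * (1 / jap t * (1 / (jap k * jap ξ ^ 2) * ‖D₀‖ ^ 2))) ∧
    k ^ 2 * ‖W‖ ^ 2 / p ^ 2 ≤ (1 + 1 / m) * (3 * (16 * C + 32)) *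
      (1 / jap t ^ 3 * (jap ξ ^ 2 / jap k * ‖N₀‖ ^ 2) +
        m * (1 / jap t ^ 3 * (jap ξ ^ 3 / jap k * ‖Γ‖ ^ 2)) +
        1 / jap t ^ 4 * (jap ξ ^ 4 / jap k ^ 2 * ‖Γ‖ ^ 2) +
        m * (1 / jap t ^ 3 * (1 / jap k * ‖D₀‖ ^ 2))) ∧
    ‖N‖ ^ 2 + ‖D‖ ^ 2 / p ≤ (1 + m) * (4 * C) *
      (1 / m * (jap t * ‖N₀‖ ^ 2) + jap t * (1 / jap₂ k ξ ^ 2 * ‖D₀‖ ^ 2) +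
        jap t * (jap₂ k ξ ^ 2 * ‖Γ‖ ^ 2)) := by
  have hk0 : (k : ℝ) ≠ 0 := by exact_mod_cast hk
  have hk1 : 1 ≤ (k : ℝ) ^ 2 := by
    have : 1 ≤ k ^ 2 := by nlinarith [Int.one_le_abs hk, sq_abs k]
    exact_mod_cast this
  have hf := isFrequencyData_jap hk1 ξ t
  have hp' : p = k ^ 2 * jap (t - ξ / k) ^ 2 := by
    rw [hp, jap_sq]; field_simp; ring
  set A := ‖N‖ ^ 2 + ‖D‖ ^ 2 / p with hAdef
  have hA : A ≤ C * (jap (t - ξ / k) / jap (ξ / k) * (‖N₀‖ ^ 2 +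
      ‖D₀‖ ^ 2 / (k ^ 2 * jap (ξ / k) ^ 2) + jap (ξ / k) / k ^ 2 * ‖Γ‖ ^ 2)) := by
    rw [hAdef, hp', jap_sq, jap_sq]
    exact h
  have hp0 : 0 < p := by rw [hp]; positivity
  have hNA : ‖N‖ ^ 2 ≤ A := by rw [hAdef]; linarith [div_nonneg (sq_nonneg ‖D‖) hp0.le]
  have hW : ‖W‖ ^ 2 ≤ 2 * A + 2 * ‖Γ‖ ^ 2 := by
    have e : W = Γ - N := by rw [← hΓ]; ring
    have h1 : ‖W‖ ≤ ‖Γ‖ + ‖N‖ := by rw [e]; exact norm_sub_le _ _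
    nlinarith [norm_nonneg W, sq_nonneg (‖Γ‖ - ‖N‖)]
  have jt := jap_pos t
  have jk := jap_pos k
  have jx := jap_pos ξ
  have jj := jap₂_pos k ξ
  -- The weights involve `m` in some terms and not in others. The prefactor `1 + 1/m` (or `1 + m`
  -- for the growth estimate) makes every resulting coefficient at least `1`.
  have hm1 : (1 + 1 / m) * m = m + 1 := by field_simp
  have hm2 : (1 + m) * (1 / m) = 1 / m + 1 := by field_simp
  have hm3 : 0 < 1 / m := by positivity
  have hN2 := sq_nonneg ‖N₀‖
  have hD2 := sq_nonneg ‖D₀‖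
  have hG2 := sq_nonneg ‖Γ‖
  refine ⟨?_, ?_, ?_⟩
  · have h1 := hf.density_decay hC hN2 hD2 hG2 hA
    rw [← hp'] at h1
    have h2 : (‖N‖ ^ 2 + ‖W‖ ^ 2) / p ≤ 3 * ((A + ‖Γ‖ ^ 2) / p) := by
      rw [← mul_div_assoc]; gcongr; linarith
    have a1 : 0 ≤ 1 / jap t * (1 / jap k * ‖N₀‖ ^ 2) := by positivity
    have a2 : 0 ≤ 1 / jap t * (jap ξ / jap k * ‖Γ‖ ^ 2) := by positivity
    have a3 : 0 ≤ 1 / jap t ^ 2 * (jap ξ ^ 2 / jap k ^ 2 * ‖Γ‖ ^ 2) := by positivity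
    have a4 : 0 ≤ 1 / jap t * (1 / (jap k * jap ξ ^ 2) * ‖D₀‖ ^ 2) := by positivity
    refine h2.trans ((mul_le_mul_of_nonneg_left h1 (by norm_num)).trans ?_)
    rw [← mul_assoc, mul_comm (1 + 1 / m), mul_assoc (3 * (4 * C + 8))]
    refine mul_le_mul_of_nonneg_left ?_ (by linarith)
    rw [mul_add, mul_add, mul_add, ← mul_assoc _ m, ← mul_assoc _ m, hm1]
    linarith [mul_nonneg hm3.le a1, mul_nonneg hm.le a2, mul_nonneg hm3.le a3,
      mul_nonneg hm.le a4]
  · have h1 := hf.curl_decay hC hN2 hD2 hG2 hA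
    rw [← hp'] at h1
    have h2 : k ^ 2 * ‖W‖ ^ 2 / p ^ 2 ≤ 3 * (k ^ 2 * (A + ‖Γ‖ ^ 2) / p ^ 2) := by
      rw [← mul_div_assoc, ← mul_assoc, mul_comm 3, mul_assoc]
      gcongr
      linarith [sq_nonneg ‖N‖]
    have a1 : 0 ≤ 1 / jap t ^ 3 * (jap ξ ^ 2 / jap k * ‖N₀‖ ^ 2) := by positivity
    have a2 : 0 ≤ 1 / jap t ^ 3 * (jap ξ ^ 3 / jap k * ‖Γ‖ ^ 2) := by positivity
    have a3 : 0 ≤ 1 / jap t ^ 4 * (jap ξ ^ 4 / jap k ^ 2 * ‖Γ‖ ^ 2) := by positivity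
    have a4 : 0 ≤ 1 / jap t ^ 3 * (1 / jap k * ‖D₀‖ ^ 2) := by positivity
    refine h2.trans ((mul_le_mul_of_nonneg_left h1 (by norm_num)).trans ?_)
    rw [← mul_assoc, mul_comm (1 + 1 / m), mul_assoc (3 * (16 * C + 32))]
    refine mul_le_mul_of_nonneg_left ?_ (by linarith)
    rw [mul_add, mul_add, mul_add, ← mul_assoc _ m, ← mul_assoc _ m, hm1]
    linarith [mul_nonneg hm3.le a1, mul_nonneg hm.le a2, mul_nonneg hm3.le a3,
      mul_nonneg hm.le a4]
  · have h1 := hf.energy_growth hC hN2 hD2 hG2 hA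
    have a1 : 0 ≤ jap t * ‖N₀‖ ^ 2 := by positivity
    have a2 : 0 ≤ jap t * (1 / jap₂ k ξ ^ 2 * ‖D₀‖ ^ 2) := by positivity
    have a3 : 0 ≤ jap t * (jap₂ k ξ ^ 2 * ‖Γ‖ ^ 2) := by positivity
    refine h1.trans ?_
    rw [mul_comm (1 + m), mul_assoc (4 * C)]
    refine mul_le_mul_of_nonneg_left ?_ (by linarith)
    rw [mul_add, mul_add, ← mul_assoc _ (1 / m), hm2]
    linarith [mul_nonneg hm3.le a1, mul_nonneg hm.le a2, mul_nonneg hm.le a3]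

/-- Used for `φ` at `k ≠ 0`: Poisson's equation gains `1/p²` with `p ≥ 1`, and one power of `1/p`
already suffices, so `φ` obeys the same bound as `ℙ[u]^x`. -/
theorem le_of_sq_mul_eq {F c N W p : ℝ} (hp : 1 ≤ p) (hF : 0 ≤ F) (hW : 0 ≤ W)
    (h : p ^ 2 * F = c ^ 2 * N) : F ≤ c ^ 2 * ((N + W) / p) := by
  rw [← mul_div_assoc, le_div_iff₀ (by linarith)]
  calc F * p ≤ F * p * p := le_mul_of_one_le_right (by positivity) hp
    _ = p ^ 2 * F := by ring
    _ = c ^ 2 * N := h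
    _ ≤ c ^ 2 * (N + W) := by gcongr; linarith

/-- The estimates of the solution in Fourier variables, along characteristics. -/
theorem exists_ae_weighted_bound {e m : ℝ} (he : 0 < e) (hm : 0 < m) : ∃ K : ℝ, 0 ≤ K ∧
    ∀ {η ux uy φ : ℝ → ℝ → ℝ → ℝ}, IsSmoothSolution e m η ux uy φ →
      ∀ {ψ ω : ℝ → ℝ → ℝ}, ψ = divergence (ux 0) (uy 0) → ω = curl (ux 0) (uy 0) →
      HasL2Modes ψ → HasL2Modes ω → (∀ y, xAverage (η 0) y = 0) → (∀ y, xAverage ψ y = 0) →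
      (∀ y, xAverage ω y = 0) → ∀ {T : ℝ}, 0 ≤ T → ∀ k : ℤ, ∀ᵐ ξ : ℝ,
        (‖ft (η T) k (ξ - k * T)‖ ^ 2 + ‖curlHat (ux T) (uy T) k (ξ - k * T)‖ ^ 2) /
            (k ^ 2 + (ξ - k * T) ^ 2) ≤
          K * ∑ i, slowRate m T i ^ 2 *
            (slowWeight i k ξ * ‖ft (decayField m (η 0) ψ ω i) k ξ‖ ^ 2) ∧
        ‖ft (φ T) k (ξ - k * T)‖ ^ 2 ≤
          K * ∑ i, slowRate m T i ^ 2 *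
            (slowWeight i k ξ * ‖ft (decayField m (η 0) ψ ω i) k ξ‖ ^ 2) ∧
        k ^ 2 * ‖curlHat (ux T) (uy T) k (ξ - k * T)‖ ^ 2 / (k ^ 2 + (ξ - k * T) ^ 2) ^ 2 ≤
          K * ∑ i, fastRate m T i ^ 2 *
            (fastWeight i k ξ * ‖ft (decayField m (η 0) ψ ω i) k ξ‖ ^ 2) ∧
        ‖ft (η T) k (ξ - k * T)‖ ^ 2 + ‖divHat (ux T) (uy T) k (ξ - k * T)‖ ^ 2 /
            (k ^ 2 + (ξ - k * T) ^ 2) ≤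
          K * ∑ i, growthRate T i ^ 2 *
            (growthWeight i k ξ * ‖ft (growthField m (η 0) ψ ω i) k ξ‖ ^ 2) := by
  obtain ⟨C, hC0, hC⟩ := exists_ae_mode_bound (e := e) hm
  have hm3 : 0 < 1 / m := by positivity
  set K₁ := (1 + 1 / m) * (3 * (4 * C + 8)) with hK₁
  set K₂ := (1 + 1 / m) * (3 * (16 * C + 32)) with hK₂
  set K₃ := (1 + m) * (4 * C) with hK₃
  have k1 : 0 ≤ K₁ := by positivity
  have k2 : 0 ≤ K₂ := by positivity
  have k3 : 0 ≤ K₃ := by positivity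
  have kφ : 0 ≤ (4 * Real.pi * e) ^ 2 * K₁ := by positivity
  refine ⟨K₁ + (4 * Real.pi * e) ^ 2 * K₁ + K₂ + K₃, by positivity, ?_⟩
  intro η ux uy φ hs ψ ω hψ hω hLψ hLω aη aψ aω T hT k
  have cη := (hs.density.contDiff le_rfl).continuous
  have sx := hs.velocity_x.contDiff le_rfl
  have sy := hs.velocity_y.contDiff le_rfl
  have hLη := hs.density.hasL2Modes le_rfl
  have cω : Continuous (Function.uncurry ω) := hω ▸ continuous_curl sx sy
  have hdiv : ∀ᵐ ξ : ℝ, ft ψ k ξ = divHat (ux 0) (uy 0) k ξ := by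
    subst hψ
    exact ae_ft_divergence sx sy (hs.velocity_x.periodic 0 le_rfl)
      (hs.velocity_x.l2Norm_ne_top le_rfl) (hs.velocity_y.l2Norm_ne_top le_rfl) hLψ k
  have hcurl : ∀ᵐ ξ : ℝ, ft ω k ξ = curlHat (ux 0) (uy 0) k ξ := by
    subst hω
    exact ae_ft_curl sx sy (hs.velocity_y.periodic 0 le_rfl)
      (hs.velocity_x.l2Norm_ne_top le_rfl) (hs.velocity_y.l2Norm_ne_top le_rfl) hLω k
  have hS₁ : ∀ ξ, 0 ≤ ∑ i, slowRate m T i ^ 2 *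
      (slowWeight i k ξ * ‖ft (decayField m (η 0) ψ ω i) k ξ‖ ^ 2) := fun ξ =>
    Finset.sum_nonneg fun i _ => mul_nonneg (sq_nonneg _)
      (mul_nonneg (slowWeight_nonneg i k ξ) (sq_nonneg _))
  have hS₂ : ∀ ξ, 0 ≤ ∑ i, fastRate m T i ^ 2 *
      (fastWeight i k ξ * ‖ft (decayField m (η 0) ψ ω i) k ξ‖ ^ 2) := fun ξ =>
    Finset.sum_nonneg fun i _ => mul_nonneg (sq_nonneg _)
      (mul_nonneg (fastWeight_nonneg i k ξ) (sq_nonneg _))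
  have hS₃ : ∀ ξ, 0 ≤ ∑ i, growthRate T i ^ 2 *
      (growthWeight i k ξ * ‖ft (growthField m (η 0) ψ ω i) k ξ‖ ^ 2) := fun ξ =>
    Finset.sum_nonneg fun i _ => mul_nonneg (sq_nonneg _)
      (mul_nonneg (growthWeight_nonneg i k ξ) (sq_nonneg _))
  have hpois : ∀ᵐ ξ : ℝ, -((k : ℂ) ^ 2 + ((ξ - k * T : ℝ) : ℂ) ^ 2) * ft (φ T) k (ξ - k * T) =
      4 * Real.pi * e * ft (η T) k (ξ - k * T) :=
    (measurePreserving_sub_right volume ((k : ℝ) * T)).quasiMeasurePreserving.ae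
      (ae_ft_poisson hs k hT)
  by_cases hk : k = 0
  · subst hk
    -- At `k = 0` Poisson's equation says `ξ²φ̂ = 0`, which determines `φ̂` only away from the null
    -- set `ξ = 0`.
    have hne : ∀ᵐ ξ : ℝ, ξ ≠ 0 := by simp [ae_iff]
    filter_upwards [hdiv, hcurl, hpois, ae_zero_mode hs hm he hT, ae_ft_zero_of_xAverage aη,
      ae_ft_zero_of_xAverage aψ, ae_ft_zero_of_xAverage aω, hne] with ξ h1 h2 h3 h4 h5 h6 h7 h8
    obtain ⟨z1, z2, z3⟩ := h4 h5 (h1 ▸ h6) (h2 ▸ h7)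
    simp only [Int.cast_zero, zero_mul, sub_zero, z1, z2, z3, norm_zero, mul_zero] at h3 ⊢
    have z4 : ft (φ T) 0 ξ = 0 := by
      have : (ξ : ℂ) ≠ 0 := by exact_mod_cast h8
      simpa [this] using h3
    simp only [z4, norm_zero, ne_eq, OfNat.ofNat_ne_zero, not_false_eq_true, zero_pow, zero_div,
      add_zero, mul_zero]
    have q1 := hS₁ ξ
    have q2 := hS₂ ξ
    have q3 := hS₃ ξ
    exact ⟨by positivity, by positivity, by positivity, by positivity⟩
  · have hk1 : 1 ≤ (k : ℝ) ^ 2 := by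
      have : 1 ≤ k ^ 2 := by nlinarith [Int.one_le_abs hk, sq_abs k]
      exact_mod_cast this
    filter_upwards [hdiv, hcurl, hpois, hC hs hk hT, ae_density_add_curl hs hm k hT,
      ae_ft_add cη cω (hLη k) (hLω k), ae_ft_const_mul (Real.sqrt (1 / m)) (hLη k)]
      with ξ h1 h2 h3 h4 h5 h6 h7
    have q1 := hS₁ ξ
    have q2 := hS₂ ξ
    have q3 := hS₃ ξ
    rw [← h2, ← h6] at h5
    rw [← h2, ← h6, ← h1] at h4
    obtain ⟨b1, b2, b3⟩ := mode_estimates hC0 hm hk rfl h5 h4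
    rw [← slow_sum_eq (η := η 0) (ψ := ψ) (ω := ω) hm h7 T] at b1
    rw [← fast_sum_eq (η := η 0) (ψ := ψ) (ω := ω) hm h7 T] at b2
    rw [← growth_sum_eq (η := η 0) (ψ := ψ) (ω := ω) hm h7 T] at b3
    have hφ : ‖ft (φ T) k (ξ - k * T)‖ ^ 2 ≤ (4 * Real.pi * e) ^ 2 *
        ((‖ft (η T) k (ξ - k * T)‖ ^ 2 + ‖curlHat (ux T) (uy T) k (ξ - k * T)‖ ^ 2) /
          (k ^ 2 + (ξ - k * T) ^ 2)) := by
      have hp1 : 1 ≤ (k : ℝ) ^ 2 + (ξ - k * T) ^ 2 := by nlinarith [sq_nonneg (ξ - k * T)]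
      have h8 := congrArg (fun z : ℂ => ‖z‖ ^ 2) h3
      have e1 : -((k : ℂ) ^ 2 + ((ξ - k * T : ℝ) : ℂ) ^ 2) =
          ((-((k : ℝ) ^ 2 + (ξ - k * T) ^ 2) : ℝ) : ℂ) := by push_cast; ring
      have e2 : (4 * Real.pi * e : ℂ) = ((4 * Real.pi * e : ℝ) : ℂ) := by push_cast; ring
      rw [e1, e2] at h8
      simp only [norm_mul, mul_pow, Complex.norm_real, Real.norm_eq_abs, sq_abs, neg_sq] at h8
      exact le_of_sq_mul_eq hp1 (sq_nonneg _) (sq_nonneg _) (h8.trans (by ring))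
    refine ⟨b1.trans ?_, (hφ.trans (mul_le_mul_of_nonneg_left b1 (sq_nonneg _))).trans ?_,
      b2.trans ?_, b3.trans ?_⟩
    · gcongr; linarith
    · rw [← mul_assoc]; gcongr; linarith
    · gcongr; linarith
    · gcongr; linarith

end ElectronEP

/-! ### Symbols of the projections and conclusion -/

namespace ElectronEP

theorem norm_invLapHat_sq (g : ℤ → ℝ → ℂ) (k : ℤ) (ξ : ℝ) :
    ‖invLapHat g k ξ‖ ^ 2 = ‖g k ξ‖ ^ 2 / (k ^ 2 + ξ ^ 2) ^ 2 := by
  have e : (k : ℂ) ^ 2 + (ξ : ℂ) ^ 2 = (((k : ℝ) ^ 2 + ξ ^ 2 : ℝ) : ℂ) := by push_cast; ring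
  rw [invLapHat, norm_mul, norm_neg, norm_inv, mul_pow, e, Complex.norm_real, inv_pow,
    Real.norm_eq_abs, sq_abs, inv_mul_eq_div]

theorem norm_dxHat_sq (g : ℤ → ℝ → ℂ) (k : ℤ) (ξ : ℝ) :
    ‖dxHat g k ξ‖ ^ 2 = k ^ 2 * ‖g k ξ‖ ^ 2 := by
  simp [dxHat, mul_pow]

theorem norm_dyHat_sq (g : ℤ → ℝ → ℂ) (k : ℤ) (ξ : ℝ) :
    ‖dyHat g k ξ‖ ^ 2 = ξ ^ 2 * ‖g k ξ‖ ^ 2 := by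
  simp [dyHat, mul_pow]

/-- The case `p = 0` is the zero frequency, where division by zero makes both sides vanish. -/
theorem mul_div_sq_le_div {a p G : ℝ} (hap : a ≤ p) (hp : 0 ≤ p) (hG : 0 ≤ G) :
    a * (G / p ^ 2) ≤ G / p := by
  rcases hp.eq_or_lt with rfl | hp
  · simp
  · rw [← mul_div_assoc, div_le_div_iff₀ (by positivity) hp]
    calc a * G * p ≤ p * G * p := by gcongr
      _ = G * p ^ 2 := by ring

theorem norm_dyHat_invLapHat_sq_le (g : ℤ → ℝ → ℂ) (k : ℤ) (ξ : ℝ) :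
    ‖dyHat (invLapHat g) k ξ‖ ^ 2 ≤ ‖g k ξ‖ ^ 2 / (k ^ 2 + ξ ^ 2) := by
  rw [norm_dyHat_sq, norm_invLapHat_sq]
  exact mul_div_sq_le_div (by linarith [sq_nonneg (k : ℝ)]) (by positivity) (sq_nonneg _)

theorem norm_dxHat_invLapHat_sq_le (g : ℤ → ℝ → ℂ) (k : ℤ) (ξ : ℝ) :
    ‖dxHat (invLapHat g) k ξ‖ ^ 2 ≤ ‖g k ξ‖ ^ 2 / (k ^ 2 + ξ ^ 2) := by
  rw [norm_dxHat_sq, norm_invLapHat_sq]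
  exact mul_div_sq_le_div (by linarith [sq_nonneg ξ]) (by positivity) (sq_nonneg _)

theorem normQ_le (ux uy : ℝ → ℝ → ℝ) : normQ ux uy ≤ ‖projQx ux uy‖ₑ + ‖projQy ux uy‖ₑ := by
  refine le_of_sq_le_sq ?_
  rw [normQ, sq_rpow_half, add_sq, add_right_comm]
  exact le_self_add

theorem slow_sum_norm (m t : ℝ) (η ψ ω : ℝ → ℝ → ℝ) :
    ∑ i, ENNReal.ofReal (slowRate m t i) * weightedNorm (slowWeight i) (decayField m η ψ ω i) =
      ENNReal.ofReal (Real.sqrt m / jap t ^ (1 / 2 : ℝ)) *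
          (anisoNorm (-1 / 2) 0 (fun x y => Real.sqrt (1 / m) * η x y)
            + anisoNorm (-1 / 2) (1 / 2) (fun x y => η x y + ω x y))
        + ENNReal.ofReal (1 / jap t) * anisoNorm (-1) 1 (fun x y => η x y + ω x y)
        + ENNReal.ofReal (Real.sqrt m / jap t ^ (1 / 2 : ℝ)) * anisoNorm (-1 / 2) (-1) ψ := by
  simp only [Fin.sum_univ_four, slowRate, slowWeight, decayField, Matrix.cons_val, anisoNorm_eq,
    mul_add]

theorem fast_sum_norm (m t : ℝ) (η ψ ω : ℝ → ℝ → ℝ) :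
    ∑ i, ENNReal.ofReal (fastRate m t i) * weightedNorm (fastWeight i) (decayField m η ψ ω i) =
      ENNReal.ofReal (Real.sqrt m / jap t ^ (3 / 2 : ℝ)) *
          (anisoNorm (-1 / 2) 1 (fun x y => Real.sqrt (1 / m) * η x y)
            + anisoNorm (-1 / 2) (3 / 2) (fun x y => η x y + ω x y))
        + ENNReal.ofReal (1 / jap t ^ 2) * anisoNorm (-1) 2 (fun x y => η x y + ω x y)
        + ENNReal.ofReal (Real.sqrt m / jap t ^ (3 / 2 : ℝ)) * anisoNorm (-1 / 2) 0 ψ := by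
  simp only [Fin.sum_univ_four, fastRate, fastWeight, decayField, Matrix.cons_val, anisoNorm_eq,
    mul_add]

theorem growth_sum_norm (m t : ℝ) {η : ℝ → ℝ → ℝ} (ψ ω : ℝ → ℝ → ℝ)
    (hη : Continuous (Function.uncurry η)) (h : HasL2Modes η) :
    ∑ i, ENNReal.ofReal (growthRate t i) *
        weightedNorm (growthWeight i) (growthField m η ψ ω i) =
      ENNReal.ofReal (jap t ^ (1 / 2 : ℝ)) *
        (l2Norm (fun x y => Real.sqrt (1 / m) * η x y) + sobNorm (-1) ψ
          + sobNorm 1 (fun x y => η x y + ω x y)) := by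
  have hc : Continuous (Function.uncurry fun x y => Real.sqrt (1 / m) * η x y) :=
    continuous_const.mul hη
  have hL : HasL2Modes fun x y => Real.sqrt (1 / m) * η x y := fun k => by
    rw [xMode_const_mul]; exact (h k).const_smul _
  rw [← weightedNorm_one hc hL]
  simp only [Fin.sum_univ_three, growthRate, growthWeight, growthField, Matrix.cons_val,
    sobNorm_eq, mul_add]

end ElectronEP

open ElectronEP in
theorem theorem1p3 (e m : ℝ) (he : 0 < e) (hm : 0 < m) :
    ∃ C : ℝ≥0, ∀ η ux uy φ : ℝ → ℝ → ℝ → ℝ,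
      IsSmoothSolution e m η ux uy φ →
      ∀ ηin ψin ωin : ℝ → ℝ → ℝ,
        ηin = η 0 → ψin = divergence (ux 0) (uy 0) → ωin = curl (ux 0) (uy 0) →
        MemAniso 1 2 ηin → MemAniso 1 2 ωin → MemAniso (-1 / 2) 0 ψin →
        (∀ y : ℝ, xAverage ηin y = 0) → (∀ y : ℝ, xAverage ψin y = 0) →
        (∀ y : ℝ, xAverage ωin y = 0) →
        ∀ t : ℝ, 0 ≤ t →
          (‖projPx (ux t) (uy t)‖ₑ + l2Norm (φ t) ≤
            C * (ENNReal.ofReal (Real.sqrt m / jap t ^ (1 / 2 : ℝ)) *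
                  (anisoNorm (-1 / 2) 0 (fun x y => Real.sqrt (1 / m) * ηin x y)
                    + anisoNorm (-1 / 2) (1 / 2) (fun x y => ηin x y + ωin x y))
                + ENNReal.ofReal (1 / jap t) *
                    anisoNorm (-1) 1 (fun x y => ηin x y + ωin x y)
                + ENNReal.ofReal (Real.sqrt m / jap t ^ (1 / 2 : ℝ)) *
                    anisoNorm (-1 / 2) (-1) ψin)) ∧
          (‖projPy (ux t) (uy t)‖ₑ ≤
            C * (ENNReal.ofReal (Real.sqrt m / jap t ^ (3 / 2 : ℝ)) *
                  (anisoNorm (-1 / 2) 1 (fun x y => Real.sqrt (1 / m) * ηin x y)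
                    + anisoNorm (-1 / 2) (3 / 2) (fun x y => ηin x y + ωin x y))
                + ENNReal.ofReal (1 / jap t ^ 2) *
                    anisoNorm (-1) 2 (fun x y => ηin x y + ωin x y)
                + ENNReal.ofReal (Real.sqrt m / jap t ^ (3 / 2 : ℝ)) *
                    anisoNorm (-1 / 2) 0 ψin)) ∧
          (normQ (ux t) (uy t) + ENNReal.ofReal (Real.sqrt (1 / m)) * l2Norm (η t) ≤
            C * (ENNReal.ofReal (jap t ^ (1 / 2 : ℝ)) *
                  (l2Norm (fun x y => Real.sqrt (1 / m) * ηin x y)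
                    + sobNorm (-1) ψin
                    + sobNorm 1 (fun x y => ηin x y + ωin x y)))) := by
  obtain ⟨K, hK, h⟩ := exists_ae_weighted_bound he hm
  set B : ℝ≥0 := (Real.sqrt K).toNNReal with hB
  have hBK : ENNReal.ofReal (Real.sqrt K) = B := rfl
  have hmB : ENNReal.ofReal (Real.sqrt (1 / m)) = ((Real.sqrt (1 / m)).toNNReal : ℝ≥0) := rfl
  -- `2B` serves the sums of two terms, `ℙ[u]^x` with `φ` and the two components of `ℚ[u]`; the last
  -- summand serves the density with its factor `m^{-1/2}`.
  refine ⟨2 * B + (Real.sqrt (1 / m)).toNNReal * B, ?_⟩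
  rintro η ux uy φ hs ηin ψin ωin rfl hψ hω - hωin hψin aη aψ aω t ht
  have hae := h hs hψ hω hψin.1 hωin.1 aη aψ aω ht
  have cη := hs.density.contDiff ht
  have cφ := hs.potential.contDiff ht
  have hP : ‖projPx (ux t) (uy t)‖ₑ ≤ B * _ := hBK ▸ le_sum_weightedNorm (T := t)
    (enorm_invFT_sq_le _) hK (slowRate_nonneg m t) measurable_slowWeight slowWeight_nonneg
    fun k => by
      filter_upwards [hae k] with ξ hξ
      rw [norm_neg]
      refine ((norm_dyHat_invLapHat_sq_le _ _ _).trans ?_).trans hξ.1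
      gcongr
      linarith [sq_nonneg ‖ft (η t) k (ξ - k * t)‖]
  have hφ : l2Norm (φ t) ≤ B * _ := hBK ▸ le_sum_weightedNorm (T := t)
    (l2Norm_sq_eq_tsum_ft cφ.continuous (hs.potential.hasL2Modes ht)).le hK
    (slowRate_nonneg m t) measurable_slowWeight slowWeight_nonneg
    fun k => by filter_upwards [hae k] with ξ hξ using hξ.2.1
  have hPy : ‖projPy (ux t) (uy t)‖ₑ ≤ B * _ := hBK ▸ le_sum_weightedNorm (T := t)
    (enorm_invFT_sq_le _) hK (fastRate_nonneg m t) measurable_fastWeight fastWeight_nonneg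
    fun k => by
      filter_upwards [hae k] with ξ hξ
      rw [norm_dxHat_sq, norm_invLapHat_sq, ← mul_div_assoc]
      exact hξ.2.2.1
  have hQx : ‖projQx (ux t) (uy t)‖ₑ ≤ B * _ := hBK ▸ le_sum_weightedNorm (T := t)
    (enorm_invFT_sq_le _) hK (growthRate_nonneg t) measurable_growthWeight growthWeight_nonneg
    fun k => by
      filter_upwards [hae k] with ξ hξ
      refine ((norm_dxHat_invLapHat_sq_le _ _ _).trans ?_).trans hξ.2.2.2
      exact le_add_of_nonneg_left (sq_nonneg _)
  have hQy : ‖projQy (ux t) (uy t)‖ₑ ≤ B * _ := hBK ▸ le_sum_weightedNorm (T := t)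
    (enorm_invFT_sq_le _) hK (growthRate_nonneg t) measurable_growthWeight growthWeight_nonneg
    fun k => by
      filter_upwards [hae k] with ξ hξ
      refine ((norm_dyHat_invLapHat_sq_le _ _ _).trans ?_).trans hξ.2.2.2
      exact le_add_of_nonneg_left (sq_nonneg _)
  have hη : l2Norm (η t) ≤ B * _ := hBK ▸ le_sum_weightedNorm (T := t)
    (l2Norm_sq_eq_tsum_ft cη.continuous (hs.density.hasL2Modes ht)).le hK
    (growthRate_nonneg t) measurable_growthWeight growthWeight_nonneg
    fun k => by
      filter_upwards [hae k] with ξ hξ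
      refine le_trans ?_ hξ.2.2.2
      exact le_add_of_nonneg_right (by positivity)
  rw [slow_sum_norm] at hP hφ
  rw [fast_sum_norm] at hPy
  rw [growth_sum_norm m t ψin ωin (hs.density.contDiff le_rfl).continuous
    (hs.density.hasL2Modes le_rfl)] at hQx hQy hη
  refine ⟨(add_le_add hP hφ).trans ?_, hPy.trans ?_,
    (add_le_add ((normQ_le _ _).trans (add_le_add hQx hQy))
      (mul_le_mul_right hη (ENNReal.ofReal (Real.sqrt (1 / m))))).trans ?_⟩
  · rw [← add_mul, ← two_mul]
    push_cast
    gcongr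
    exact le_self_add
  · push_cast
    gcongr
    calc (B : ℝ≥0∞) ≤ 2 * B := le_mul_of_one_le_left zero_le one_le_two
      _ ≤ _ := le_self_add
  · rw [hmB]
    push_cast
    exact le_of_eq (by ring)
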